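/- **Setting.** Let $(\Omega,\mathcal F,\mathbb P)$ be a complete probability space which is countably generated modulo null sets, $\vartheta:\Omega\to\Omega$ a measurable $\mathbb P$-preserving map, and $X$ a compact metric space with Borel $\sigma$-algebra $\mathcal B$. Let $\mathcal E\in\mathcal F\otimes\mathcal B$ have compact fibers $\mathcal E_\omega=\{x:(\omega,x)\in\mathcal E\}$, non-empty for $\mathbb P$-a.e. $\omega$. A *continuous bundle RDS* $T$ on $\mathcal E$ is a family of maps $T_\omega:\mathcal E_\omega\to\mathcal E_{\vartheta\omega}$ such that $(\omega,x)\mapsto T_\omega x$ is measurable on $\mathcal E$ and $T_\omega$ is continuous for $\mathbb P$-a.e. $\omega$; put $\Theta(\omega,x)=(\vartheta\omega,T_\omega x)$. For a family $\mathcal R$ of subsets of $\mathcal E$ write $\mathcal R^{(n)}=\bigvee_{i=0}^{n-1}(\Theta^i)^{-1}\mathcal R$, and $A(\omega)=\{x:(\omega,x)\in A\}$ for $A\subset\mathcal E$. **Relative tail entropy.** An *open random cover* of $\mathcal E$ is a finite family of measurable sets with union $\mathcal E$ whose sections at $\omega$ are open in $\mathcal E_\omega$ for $\mathbb P$-a.e.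 $\omega$. Let $N(A,\mathcal R)(\omega)$ be the least number of members of $\mathcal R$ whose sections at $\omega$ cover $A(\omega)$ (and $1$ if $A(\omega)=\emptyset$), and $N(\mathcal R\mid\mathcal Q)(\omega)=\max_{A\in\mathcal Q}N(A,\mathcal R)(\omega)$. Put $$h_\Theta(\mathcal R\mid\mathcal Q)=\lim_{n\to\infty}\frac1n\int\log N(\mathcal R^{(n)}\mid\mathcal Q^{(n)})(\omega)\,d\mathbb P(\omega),\qquad h^*(\Theta)=\inf_{\mathcal Q}\,\sup_{\mathcal R}\,h_\Theta(\mathcal R\mid\mathcal Q)\in[0,\infty],$$ where $\mathcal Q$ and $\mathcal R$ range over the open random covers of $\mathcal E$. **The fibered square.** Let $\mathcal E^{(2)}=\{(\omega,x,y):x,y\in\mathcal E_\omega\}$, $\Theta^{(2)}(\omega,x,y)=(\vartheta\omega,T_\omega x,T_\omega y)$ and $\mathcal A_{\mathcal E^{(2)}}=\{(A\times X)\cap\mathcal E^{(2)}:A\in\mathcal F\otimes\mathcal B\}$. Let $\mathcal I_{\mathbb P}(\mathcal E^{(2)})$ be the set of $\Theta^{(2)}$-invariant probability measures on $\mathcal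 E^{(2)}$ with marginal $\mathbb P$ on $\Omega$, with the narrow topology, that is, the coarsest topology for which $\mu\mapsto\int f\,d\mu$ is continuous for every measurable $f:\mathcal E^{(2)}\to\mathbb R$ such that $f(\omega,\cdot)$ is continuous on $\mathcal E^{(2)}_\omega$ for $\mathbb P$-a.e. $\omega$ and $|f(\omega,\cdot)|\le g(\omega)$ for some $g\in L^1(\mathbb P)$. For $\mu\in\mathcal I_{\mathbb P}(\mathcal E^{(2)})$ and a finite or countable measurable partition $\mathcal R$ of $\mathcal E^{(2)}$ put $H_\mu(\mathcal R\mid\mathcal A_{\mathcal E^{(2)}})=-\int\sum_{R\in\mathcal R}E_\mu(1_R\mid\mathcal A_{\mathcal E^{(2)}})\log E_\mu(1_R\mid\mathcal A_{\mathcal E^{(2)}})\,d\mu$ and $$h_\mu(\Theta^{(2)}\mid\mathcal A_{\mathcal E^{(2)}})=\sup_{\mathcal R}\lim_{n\to\infty}\frac1nH_\mu\Big(\bigvee_{i=0}^{n-1}((\Theta^{(2)})^{i})^{-1}\mathcal R\;\Big|\;\mathcal A_{\mathcal E^{(2)}}\Big),$$ the supremum being over the $\mathcal R$ with $H_\mu(\mathcal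 R\mid\mathcal A_{\mathcal E^{(2)}})<\infty$. The defect of upper semi-continuity at $m\in\mathcal I_{\mathbb P}(\mathcal E^{(2)})$ is $$h^*_m(\Theta^{(2)}\mid\mathcal A_{\mathcal E^{(2)}})=\limsup_{\mu\to m}h_\mu(\Theta^{(2)}\mid\mathcal A_{\mathcal E^{(2)}})-h_m(\Theta^{(2)}\mid\mathcal A_{\mathcal E^{(2)}})$$ if $h_m(\Theta^{(2)}\mid\mathcal A_{\mathcal E^{(2)}})<\infty$, and $\infty$ otherwise (the limit superior is over neighbourhoods of $m$ with $m$ included). **Theorem.** For every continuous bundle RDS $T$ on $\mathcal E$, $$\max\{h^*_\mu(\Theta^{(2)}\mid\mathcal A_{\mathcal E^{(2)}}):\mu\in\mathcal I_{\mathbb P}(\mathcal E^{(2)})\}=h^*(\Theta),$$ the maximum being attained; moreover it is attained at some $m\in\mathcal I_{\mathbb P}(\mathcal E^{(2)})$ supported on the diagonal, $m(\{(\omega,x,x):x\in\mathcal E_\omega\})=1$. -/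

import Mathlib

open MeasureTheory Filter Topology Set
open scoped ENNReal

noncomputable section

/-- `P` is countably generated modulo null sets: some countably generated sub-σ-algebra contains,
up to `P`-null sets, every measurable set. (This is the usual meaning of a countably generated
space when the σ-algebra is also required to be complete.) -/
def CountablyGeneratedModNull {Ω : Type*} [mΩ : MeasurableSpace Ω] (P : Measure Ω) : Prop :=
  ∃ m₀ : MeasurableSpace Ω, m₀ ≤ mΩ ∧ @MeasurableSpace.CountablyGenerated Ω m₀ ∧
    ∀ s : Set Ω, MeasurableSet s → ∃ t : Set Ω, MeasurableSet[m₀] t ∧ s =ᵐ[P] t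

/-- A continuous bundle random dynamical system over `(Ω, P, ϑ)` with fibers in `X`.
The values of `map ω` off the fiber over `ω` are irrelevant: nothing below depends on them. -/
structure BundleRDS {Ω : Type*} [MeasurableSpace Ω] (P : Measure Ω) (ϑ : Ω → Ω)
    (X : Type*) [TopologicalSpace X] [MeasurableSpace X] where
  carrier : Set (Ω × X)
  measurableSet_carrier : MeasurableSet carrier
  isCompact_fiber : ∀ ω, IsCompact {x | (ω, x) ∈ carrier}
  nonempty_fiber : ∀ᵐ ω ∂P, {x | (ω, x) ∈ carrier}.Nonempty
  map : Ω → X → X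
  mapsTo : ∀ ω x, (ω, x) ∈ carrier → (ϑ ω, map ω x) ∈ carrier
  measurable_map : Measurable fun p : carrier => map p.1.1 p.1.2
  continuousOn_map : ∀ᵐ ω ∂P, ContinuousOn (map ω) {x | (ω, x) ∈ carrier}

namespace BundleRDS

variable {Ω : Type*} [MeasurableSpace Ω] {P : Measure Ω} {ϑ : Ω → Ω}
  {X : Type*} [TopologicalSpace X] [MeasurableSpace X]

/-- The bundle `ℰ` as a measurable space (with the restriction of the product σ-algebra). -/
abbrev Total (T : BundleRDS P ϑ X) : Type _ := ↥T.carrier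

/-- The fiber `ℰ_ω`. -/
def fiber (T : BundleRDS P ϑ X) (ω : Ω) : Set X := {x | (ω, x) ∈ T.carrier}

/-- The inclusion `x ↦ (ω, x)` of a fiber into the bundle. The preimage of `A` under it is the
section `A(ω)`. -/
def incl (T : BundleRDS P ϑ X) (ω : Ω) (x : T.fiber ω) : T.Total := ⟨(ω, x.1), x.2⟩

/-- The skew product transformation `Θ(ω, x) = (ϑ ω, T_ω x)`. -/
def skew (T : BundleRDS P ϑ X) (p : T.Total) : T.Total :=
  ⟨(ϑ p.1.1, T.map p.1.1 p.1.2), T.mapsTo p.1.1 p.1.2 p.2⟩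

/-- For a family `A` of subsets of the bundle, the members of `⋁_{i<n} (Θ^i)⁻¹ A`. -/
def refine (T : BundleRDS P ϑ X) {ι : Type*} (A : ι → Set T.Total) (n : ℕ) :
    (Fin n → ι) → Set T.Total :=
  fun a => ⋂ i : Fin n, (T.skew^[(i : ℕ)]) ⁻¹' A (a i)

/-! ### Invariant measures and the narrow topology -/

/-- The `Θ`-invariant probability measures on the bundle with marginal `P`. -/
def InvMeasure (T : BundleRDS P ϑ X) : Type _ :=
  {μ : Measure T.Total // IsProbabilityMeasure μ ∧ μ.map (fun p => p.1.1) = P ∧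
    MeasurePreserving T.skew μ μ}

/-- Random continuous functions on the bundle. -/
def RandomContinuous (T : BundleRDS P ϑ X) : Type _ :=
  {f : T.Total → ℝ // Measurable f ∧ (∀ᵐ ω ∂P, Continuous (f ∘ T.incl ω)) ∧
    ∃ g : Ω → ℝ, Integrable g P ∧ ∀ p, |f p| ≤ g p.1.1}

/-- The narrow topology: the coarsest one for which `μ ↦ ∫ f dμ` is continuous for every random
continuous function `f`. -/
instance narrowTopology (T : BundleRDS P ϑ X) : TopologicalSpace T.InvMeasure :=
  TopologicalSpace.induced
    (fun (μ : T.InvMeasure) (f : T.RandomContinuous) => ∫ p, f.1 p ∂μ.1) inferInstance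

/-! ### Relative measure-theoretic entropy -/

/-- Conditional entropy `H_μ(R | S)` of a countable family `R` of sets given a σ-algebra `S`. -/
def condEntropy {Y : Type*} (S : MeasurableSpace Y) {mY : MeasurableSpace Y} (μ : Measure Y)
    {ι : Type*} (R : ι → Set Y) : ℝ≥0∞ :=
  ∫⁻ y, ∑' i, ENNReal.ofReal
    (Real.negMulLog ((μ[(R i).indicator (fun _ => (1 : ℝ)) | S]) y)) ∂μ

/-- Finite or countable measurable partitions of the bundle (finite ones are padded by empty
sets). -/
structure Partition (T : BundleRDS P ϑ X) where
  set : ℕ → Set T.Total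
  measurableSet : ∀ i, MeasurableSet (set i)
  disjoint : Pairwise fun i j => Disjoint (set i) (set j)
  iUnion_eq : ⋃ i, set i = univ

/-- `h_μ(R | S) = lim (1/n) H_μ(R^{(n)} | S)`; the limit exists by subadditivity
when `Θ⁻¹ S ⊆ S`. -/
def partitionEntropy (T : BundleRDS P ϑ X) (S : MeasurableSpace T.Total) (μ : T.InvMeasure)
    (R : T.Partition) : ℝ≥0∞ :=
  limsup (fun n : ℕ => condEntropy S μ.1 (T.refine R.set n) / (n : ℝ≥0∞)) atTop

/-- The relative entropy `h_μ(Θ | S)`. -/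
def relEntropy (T : BundleRDS P ϑ X) (S : MeasurableSpace T.Total) (μ : T.InvMeasure) : ℝ≥0∞ :=
  ⨆ (R : T.Partition) (_ : condEntropy S μ.1 R.set < ∞), T.partitionEntropy S μ R

open Classical in
/-- The defect of upper semi-continuity of `μ ↦ h_μ(Θ | S)` at `m`. The limit superior is taken
over all neighbourhoods of `m`, with `m` included, so it is at least `h_m(Θ | S)`. -/
def defect (T : BundleRDS P ϑ X) (S : MeasurableSpace T.Total) (m : T.InvMeasure) : ℝ≥0∞ :=
  if T.relEntropy S m < ∞ then limsup (T.relEntropy S) (𝓝 m) - T.relEntropy S m else ∞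

/-! ### Relative tail entropy -/

/-- A finite random cover of the bundle. -/
structure RandomCover (T : BundleRDS P ϑ X) where
  size : ℕ
  set : Fin size → Set T.Total
  measurableSet : ∀ i, MeasurableSet (set i)
  iUnion_eq : ⋃ i, set i = univ

/-- The cover consists of open random sets: for almost every `ω` all the sections are open in
the fiber over `ω`. -/
def RandomCover.IsOpenCover {T : BundleRDS P ϑ X} (Q : T.RandomCover) : Prop :=
  ∀ i, ∀ᵐ ω ∂P, IsOpen (T.incl ω ⁻¹' Q.set i)

open Classical in
/-- `N(A, R)(ω)`: the least number of members of `R` whose sections at `ω` cover `A(ω)`; it is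
`1` if `A(ω)` is empty. -/
def coverNum (T : BundleRDS P ϑ X) {ι : Type*} (A : Set T.Total) (R : ι → Set T.Total)
    (ω : Ω) : ℕ :=
  if T.incl ω ⁻¹' A = ∅ then 1
  else sInf {k | ∃ s : Finset ι, s.card = k ∧ T.incl ω ⁻¹' A ⊆ ⋃ i ∈ s, T.incl ω ⁻¹' R i}

/-- `N(R | Q)(ω) = max_{A ∈ Q} N(A, R)(ω)`. -/
def condCoverNum (T : BundleRDS P ϑ X) {ι κ : Type*} [Fintype κ] (R : ι → Set T.Total)
    (Q : κ → Set T.Total) (ω : Ω) : ℕ :=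
  Finset.univ.sup fun j => T.coverNum (Q j) R ω

/-- `h_Θ(R | Q) = lim (1/n) ∫ log N(R^{(n)} | Q^{(n)})(ω) dP(ω)`; the limit exists by
subadditivity when `R` is an open random cover. -/
def coverTailEntropy (T : BundleRDS P ϑ X) (R Q : T.RandomCover) : ℝ≥0∞ :=
  limsup (fun n : ℕ =>
    (∫⁻ ω, ENNReal.ofReal
      (Real.log (T.condCoverNum (T.refine R.set n) (T.refine Q.set n) ω : ℝ)) ∂P)
      / (n : ℝ≥0∞)) atTop

/-- `h(Θ | Q)`: the supremum of `h_Θ(R | Q)` over the open random covers `R`. -/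
def tailEntropyGiven (T : BundleRDS P ϑ X) (Q : T.RandomCover) : ℝ≥0∞ :=
  ⨆ (R : T.RandomCover) (_ : R.IsOpenCover), T.coverTailEntropy R Q

/-- The relative tail entropy `h^*(Θ)`: the infimum of `h(Θ | Q)` over the open random
covers `Q`. -/
def tailEntropy (T : BundleRDS P ϑ X) : ℝ≥0∞ :=
  ⨅ (Q : T.RandomCover) (_ : Q.IsOpenCover), T.tailEntropyGiven Q

/-! ### The fibered square -/

/-- The system `T × T` on `ℰ^{(2)} = {(ω, x, y) : x, y ∈ ℰ_ω}`; its skew product is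
`Θ^{(2)}(ω, x, y) = (ϑ ω, T_ω x, T_ω y)`. -/
def square (T : BundleRDS P ϑ X) : BundleRDS P ϑ (X × X) where
  carrier := {p | (p.1, p.2.1) ∈ T.carrier ∧ (p.1, p.2.2) ∈ T.carrier}
  measurableSet_carrier := by
    have h1 : Measurable fun p : Ω × X × X => (p.1, p.2.1) := by fun_prop
    have h2 : Measurable fun p : Ω × X × X => (p.1, p.2.2) := by fun_prop
    exact (h1 T.measurableSet_carrier).inter (h2 T.measurableSet_carrier)
  isCompact_fiber ω := (T.isCompact_fiber ω).prod (T.isCompact_fiber ω)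
  nonempty_fiber := by
    filter_upwards [T.nonempty_fiber] with ω hω
    exact hω.prod hω
  map ω z := (T.map ω z.1, T.map ω z.2)
  mapsTo ω z hz := ⟨T.mapsTo ω z.1 hz.1, T.mapsTo ω z.2 hz.2⟩
  measurable_map := by
    have h1 : Measurable fun p : {p : Ω × X × X | (p.1, p.2.1) ∈ T.carrier ∧
        (p.1, p.2.2) ∈ T.carrier} => (⟨(p.1.1, p.1.2.1), p.2.1⟩ : T.carrier) :=
      Measurable.subtype_mk (by fun_prop)
    have h2 : Measurable fun p : {p : Ω × X × X | (p.1, p.2.1) ∈ T.carrier ∧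
        (p.1, p.2.2) ∈ T.carrier} => (⟨(p.1.1, p.1.2.2), p.2.2⟩ : T.carrier) :=
      Measurable.subtype_mk (by fun_prop)
    exact (T.measurable_map.comp h1).prodMk (T.measurable_map.comp h2)
  continuousOn_map := by
    filter_upwards [T.continuousOn_map] with ω hω
    exact ContinuousOn.prodMap hω hω

/-- The σ-algebra `𝒜_{ℰ^{(2)}}` of the sets `(A × X) ∩ ℰ^{(2)}`, `A` measurable in `Ω × X`. -/
abbrev firstCoordSigma (T : BundleRDS P ϑ X) : MeasurableSpace T.square.Total :=
  MeasurableSpace.comap (fun p => (p.1.1, p.1.2.1)) (inferInstance : MeasurableSpace (Ω × X))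

/-- The diagonal `{(ω, x, x) : x ∈ ℰ_ω}` of `ℰ^{(2)}`. -/
def diagonal (T : BundleRDS P ϑ X) : Set T.square.Total := {p | p.1.2.1 = p.1.2.2}

end BundleRDS

end

/-! Let `S` be the σ-algebra of the first point of a pair, `h_μ` the entropy of `μ` relative to `S`,
and `h(Θ | Q)` the quantity `tailEntropyGiven`. Everything rests on one device: by the Gibbs
inequality, `H_μ(ξ | S)` is the infimum, over `S`-measurable sub-probability vectors `g`, of the
mean code length `∫ -log g(ξ(y), y) dμ` (`condEntropy_eq_codeEntropy`). Each of these functionals is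
linear in `μ`, so the chain rule, concavity and upper semicontinuity of conditional entropy all come
from exhibiting a code.

Upper bound. Let `Q` be an open cover and `a` a finite partition of `X` subordinate to it. The
`n`-itinerary of the second point under `a` places that point in a known member of `Q^(n)`, which is
covered by `N(R^(n) | Q^(n))(ω)` members of `R^(n)`. For a suitable `R`, any other finite partition
can therefore be coded, given `a`, at cost `log N` plus a small multiple of `n`
(`codeEntropyGiven_itinerary_le_logCover`). Hence `h_μ` is at most the entropy rate of `a` plus `h(Θ
| Q)`, for every `μ`. If the atoms of `a` have boundaries that are null for `m`, the entropies of
the itineraries of `a` are upper semicontinuous at `m`. The rate is bounded by each of them divided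
by its length, so it is upper semicontinuous as well. This gives `limsup h_μ ≤ h_m + h(Θ | Q)`
(`limsup_relEntropy_le`); covers by small balls suffice to take the infimum over `Q`.

Lower bound. Fix the cover `Q` by balls of radius `1 / (k + 1)` and a cover `R` by smaller balls.
Over each `ω` the member of `Q^(n)` that is hardest to cover contains `N(R^(n) | Q^(n))(ω)` points
whose `n`-orbits are separated. A measurable selection turns these tuples into a measure on pairs:
the first point is one selected point, the second is uniform on the tuple. A code that sees only the
first point cannot do better than `log N` on average, so the `n`-step entropy is at least `∫ log N`
(`exists_separated_measure`). Limits of orbit averages are invariant measures, carried by pairs at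
distance at most `2 / (k + 1)`, with entropy at least a prescribed value below `h*(Θ)`
(`exists_invMeasure_le_relEntropy`). A narrow limit `m` as `k → ∞` lives on the diagonal. There the
first point determines the second, so `h_m = 0`, and the defect at `m` is the whole upper limit,
which is at least `h*(Θ)`.

The base `Ω` has no topology. Measurability of covering numbers and of selections comes from the
projection theorem over a complete probability space, and narrow compactness from a factor map of
`Ω` into the Cantor space. -/

noncomputable section

/-! ### Analytic sets, projections and measurable selections -/

section Projection

/-- A continuous image of the Baire space is inner regular for compact subsets. -/
theorem exists_isCompact_subset_range_lt_measure {α : Type*} [TopologicalSpace α] [PolishSpace α]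
    [MeasurableSpace α] [BorelSpace α] (μ : Measure α) [IsFiniteMeasure μ] {f : (ℕ → ℕ) → α}
    (hf : Continuous f) {c : ℝ≥0∞} (hc : c < μ (range f)) :
    ∃ K ⊆ range f, IsCompact K ∧ c ≤ μ K := by
  let S : ℕ → (ℕ → ℕ) → Set (ℕ → ℕ) := fun n b => {x | ∀ i < n, x i ≤ b i}
  -- Measures are continuous along increasing unions of arbitrary sets, so one more coordinate can
  -- be bounded while the image keeps measure greater than `c`, even though the images need not be
  -- measurable.
  have step : ∀ n b, c < μ (f '' S n b) → ∃ k, c < μ (f '' (S n b ∩ {x | x n ≤ k})) := by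
    intro n b h
    have hmono : Monotone fun k : ℕ => f '' (S n b ∩ {x | x n ≤ k}) := fun k l hkl =>
      image_mono (inter_subset_inter_right _ fun x (hx : x n ≤ k) => hx.trans hkl)
    have hU : f '' S n b = ⋃ k : ℕ, f '' (S n b ∩ {x | x n ≤ k}) := by
      rw [← image_iUnion, ← inter_iUnion]
      congr 1
      ext x
      simp only [mem_inter_iff, mem_iUnion, mem_ofPred_eq]
      exact ⟨fun h => ⟨h, x n, le_rfl⟩, fun h => h.1⟩
    rw [hU, hmono.measure_iUnion] at h
    exact lt_iSup_iff.1 h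
  let next : (n : ℕ) → {b : ℕ → ℕ // c < μ (f '' S n b)} → {b : ℕ → ℕ // c < μ (f '' S (n + 1) b)} :=
    fun n b => ⟨Function.update b.1 n (step n b.1 b.2).choose, by
      have hk := (step n b.1 b.2).choose_spec
      refine hk.trans_le (measure_mono (image_mono ?_))
      rintro x ⟨hx, hxn⟩ i hi
      rcases Nat.lt_succ_iff_lt_or_eq.1 hi with h | rfl
      · rw [Function.update_of_ne h.ne]; exact hx i h
      · rw [Function.update_self]; exact hxn⟩
  let B : (n : ℕ) → {b : ℕ → ℕ // c < μ (f '' S n b)} := fun n =>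
    Nat.rec ⟨fun _ => 0, by simpa [S, ← image_univ] using hc⟩ (fun n b => next n b) n
  have hB : ∀ i n, i < n → (B n).1 i = (B (i + 1)).1 i := by
    intro i n hin
    induction n, hin using Nat.le_induction with
    | base => rfl
    | succ n hn ih =>
      have : (B (n + 1)).1 = Function.update (B n).1 n (step n (B n).1 (B n).2).choose := rfl
      rw [this, Function.update_of_ne (by omega : i ≠ n), ih]
  let b : ℕ → ℕ := fun i => (B (i + 1)).1 i
  have hSb : ∀ n, c < μ (f '' S n b) := fun n => by
    have h := (B n).2
    have : S n (B n).1 = S n b := by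
      ext x
      exact forall₂_congr fun i hi => by rw [hB i n hi]
    rwa [this] at h
  let K : Set (ℕ → ℕ) := Set.pi univ fun i => Iic (b i)
  have hK : IsCompact K := isCompact_univ_pi fun i => (Set.finite_Iic (b i)).isCompact
  refine ⟨f '' K, image_subset_range _ _, hK.image hf, ?_⟩
  -- By outer regularity it suffices that every open `U` containing `f '' K` contains some `f '' S n
  -- b`. Otherwise a sequence of counterexamples, truncated so as to lie in the compact set `K`, has
  -- a convergent subsequence; the truncation does not affect the coordinatewise limit, which lies
  -- in `K`.
  rw [Set.measure_eq_iInf_isOpen]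
  refine le_iInf₂ fun U hU => le_iInf fun hUo => ?_
  suffices h : ∃ n, S n b ⊆ f ⁻¹' U by
    obtain ⟨n, hn⟩ := h
    exact (hSb n).le.trans (measure_mono (image_subset_iff.2 hn))
  by_contra! h
  choose z hz hzU using fun n => not_subset.1 (h n)
  let z' : ℕ → ℕ → ℕ := fun n i => if i < n then z n i else 0
  have hz' : ∀ n, z' n ∈ K := fun n i _ => by
    by_cases hi : i < n
    · simpa [z', hi] using hz n i hi
    · simp [z', hi]
  obtain ⟨x, hx, φ, hφ, hlim⟩ := hK.tendsto_subseq hz'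
  have hlim' : Tendsto (fun k => z (φ k)) atTop (𝓝 x) := by
    rw [tendsto_pi_nhds] at hlim ⊢
    intro i
    refine (hlim i).congr' ?_
    filter_upwards [hφ.tendsto_atTop.eventually_gt_atTop i] with k hk
    simp [z', hk]
  have := (hf.tendsto x).comp hlim' |>.eventually (hUo.mem_nhds (hU ⟨x, hx, rfl⟩))
  obtain ⟨k, hk⟩ := this.exists
  exact hzU _ hk

/-- Analytic sets in Polish spaces are universally measurable. -/
theorem MeasureTheory.AnalyticSet.nullMeasurableSet {α : Type*} [TopologicalSpace α]
    [PolishSpace α] [MeasurableSpace α] [BorelSpace α] (μ : Measure α) [IsFiniteMeasure μ]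
    {s : Set α} (hs : AnalyticSet s) : NullMeasurableSet s μ := by
  rw [AnalyticSet] at hs
  rcases hs with rfl | ⟨f, hf, rfl⟩
  · exact nullMeasurableSet_empty
  rcases eq_or_ne (μ (range f)) 0 with h0 | h0
  · exact NullMeasurableSet.of_null h0
  obtain ⟨u, -, hu, hlim⟩ := exists_seq_strictMono_tendsto' (pos_iff_ne_zero.2 h0)
  choose K hKs hK hcK using fun n => exists_isCompact_subset_range_lt_measure μ hf (hu n).2
  have hM : MeasurableSet (⋃ n, K n) := .iUnion fun n => (hK n).isClosed.measurableSet
  have hsub : (⋃ n, K n) ⊆ range f := iUnion_subset hKs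
  have hle : μ (range f) ≤ μ (⋃ n, K n) :=
    le_of_tendsto' hlim fun n => (hcK n).trans (measure_mono (subset_iUnion K n))
  have hd : μ (range f \ ⋃ n, K n) = 0 := by
    rw [measure_sdiff hsub hM.nullMeasurableSet (measure_ne_top _ _)]
    exact tsub_eq_zero_of_le hle
  have := hM.nullMeasurableSet.union (NullMeasurableSet.of_null hd)
  rwa [union_sdiff_cancel hsub] at this

/-- A measurable subset of a product is a preimage of a measurable set under a measurable coding of
the first factor in the Cantor space. -/
theorem MeasurableSet.exists_coding {Ω Z : Type*} [mΩ : MeasurableSpace Ω] [mZ : MeasurableSpace Z]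
    {D : Set (Ω × Z)} (hD : MeasurableSet D) :
    ∃ π : Ω → ℕ → Bool, Measurable π ∧ ∃ D' : Set ((ℕ → Bool) × Z), MeasurableSet D' ∧
      D = Prod.map π id ⁻¹' D' := by
  rw [← generateFrom_prod] at hD
  induction D, hD using MeasurableSpace.generateFrom_induction with
  | hC t ht _ =>
    obtain ⟨A, hA, B, hB, rfl⟩ := ht
    classical
    refine ⟨fun ω _ => decide (ω ∈ A), measurable_pi_lambda _ fun n => measurable_to_bool ?_,
      {c | c.1 0 = true ∧ c.2 ∈ B}, ?_, ?_⟩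
    · have : (fun ω => decide (ω ∈ A)) ⁻¹' {true} = A := by
        ext ω
        simp
      rw [this]
      exact hA
    · exact (measurableSet_eq_fun (by fun_prop) measurable_const).inter (measurable_snd hB)
    · ext p
      simp
  | empty => exact ⟨fun _ _ => true, measurable_const, ∅, .empty, rfl⟩
  | compl t _ ih =>
    obtain ⟨π, hπ, D', hD', rfl⟩ := ih
    exact ⟨π, hπ, D'ᶜ, hD'.compl, rfl⟩
  | iUnion s _ ih =>
    choose π hπ D' hD' h using ih
    -- Countably many Cantor codes are packed into one by the pairing function; `e n` reads off the
    -- `n`-th.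
    let e : ℕ → (ℕ → Bool) → ℕ → Bool := fun n c k => c (Nat.pair n k)
    have he : ∀ n, Measurable (e n) := fun n => measurable_pi_lambda _ fun k => measurable_pi_apply _
    refine ⟨fun ω k => π k.unpair.1 ω k.unpair.2,
      measurable_pi_lambda _ fun k => (measurable_pi_apply _).comp (hπ _),
      ⋃ n, Prod.map (e n) id ⁻¹' D' n, .iUnion fun n => ((he n).prodMap measurable_id) (hD' n), ?_⟩
    rw [preimage_iUnion]
    refine iUnion_congr fun n => ?_
    rw [h n, ← preimage_comp, Prod.map_comp_map]
    congr 2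
    funext ω
    simp [e]

/-- The measurable projection theorem. -/
theorem MeasurableSet.image_fst {Ω Z : Type*} [MeasurableSpace Ω] (P : Measure Ω)
    [IsFiniteMeasure P] [P.IsComplete] [MeasurableSpace Z] [StandardBorelSpace Z]
    {D : Set (Ω × Z)} (hD : MeasurableSet D) : MeasurableSet (Prod.fst '' D) := by
  obtain ⟨π, hπ, D', hD', rfl⟩ := hD.exists_coding
  have h1 : Prod.fst '' (Prod.map π id ⁻¹' D') = π ⁻¹' (Prod.fst '' D') := by
    ext ω
    constructor
    · rintro ⟨⟨ω, z⟩, h, rfl⟩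
      exact ⟨_, h, rfl⟩
    · rintro ⟨⟨c, z⟩, h, rfl⟩
      exact ⟨(ω, z), h, rfl⟩
  rw [h1]
  have : PolishSpace Bool := (IsClosedEmbedding.of_continuous_injective_isClosedMap
    (f := Bool.toNat) (by fun_prop) (by decide) fun _ _ => isClosed_discrete _).polishSpace
  -- Over the Cantor space the projection is analytic, hence null-measurable for the image of `P`;
  -- completeness of `P` makes its preimage measurable.
  have h2 : AnalyticSet (Prod.fst '' D') := hD'.analyticSet_image measurable_fst
  have h3 := h2.nullMeasurableSet (P.map π)
  exact (h3.preimage (hπ.quasiMeasurePreserving P)).measurable_of_complete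

variable {Ω Z : Type*} [MeasurableSpace Ω]

theorem measurableSet_setOf_exists_mem (P : Measure Ω) [IsFiniteMeasure P] [P.IsComplete]
    [MeasurableSpace Z] [StandardBorelSpace Z]
    {D : Set (Ω × Z)} (hD : MeasurableSet D) : MeasurableSet {ω | ∃ z, (ω, z) ∈ D} := by
  convert hD.image_fst P using 1
  ext ω
  simp

/-- For a measurable set `K`, the distance to the section `K_ω` depends measurably on `ω`. -/
theorem measurable_infEDist_section (P : Measure Ω) [IsFiniteMeasure P] [P.IsComplete]
    [PseudoEMetricSpace Z] [MeasurableSpace Z] [BorelSpace Z]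
    [StandardBorelSpace Z] {K : Set (Ω × Z)} (hK : MeasurableSet K) (z : Z) :
    Measurable fun ω => Metric.infEDist z {x | (ω, x) ∈ K} := by
  refine measurable_of_Iio fun r => ?_
  have : MeasurableSet (K ∩ {p : Ω × Z | edist z p.2 < r}) :=
    hK.inter (measurableSet_lt (by fun_prop) measurable_const)
  convert measurableSet_setOf_exists_mem P this using 1
  ext ω
  simp [Metric.infEDist_lt_iff]

/-- Measurable selection for random compact sets. -/
theorem exists_measurable_selection (P : Measure Ω) [IsFiniteMeasure P] [P.IsComplete]
    [MetricSpace Z] [CompactSpace Z] [MeasurableSpace Z]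
    [BorelSpace Z] [Nonempty Z] {K : Set (Ω × Z)} (hK : MeasurableSet K)
    (hc : ∀ᵐ ω ∂P, IsClosed {x | (ω, x) ∈ K}) (hne : ∀ᵐ ω ∂P, ∃ z, (ω, z) ∈ K) :
    ∃ f : Ω → Z, Measurable f ∧ ∀ᵐ ω ∂P, (ω, f ω) ∈ K := by
  let d : ℕ → Z := TopologicalSpace.denseSeq Z
  -- Each step keeps the points of a section that are nearest to the next point of a dense sequence.
  -- Sections stay closed and non-empty, and two points surviving all steps have equal distances to
  -- a dense set, hence coincide.
  let next : ℕ → Set (Ω × Z) → Set (Ω × Z) := fun k L =>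
    L ∩ {p | edist (d k) p.2 = Metric.infEDist (d k) {x | (p.1, x) ∈ L}}
  let L : ℕ → Set (Ω × Z) := fun n => Nat.rec K (fun k M => next k M) n
  have hLs : ∀ n, L (n + 1) = next n (L n) := fun n => rfl
  have hLm : ∀ n, MeasurableSet (L n) := by
    intro n
    induction n with
    | zero => exact hK
    | succ n ih =>
      rw [hLs]
      refine ih.inter (measurableSet_eq_fun ?_ ?_)
      · fun_prop
      · exact (measurable_infEDist_section P ih (d n)).comp measurable_fst
  let G : Set (Ω × Z) := ⋂ n, L n
  have hGm : MeasurableSet G := .iInter hLm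
  have hGK : G ⊆ K := iInter_subset L 0
  have hG1 : ∀ ω x y, (ω, x) ∈ G → (ω, y) ∈ G → x = y := by
    intro ω x y hx hy
    have h : ∀ n, edist (d n) x = edist (d n) y := fun n => by
      have h1 := (mem_iInter.1 hx (n + 1)).2
      have h2 := (mem_iInter.1 hy (n + 1)).2
      exact h1.trans h2.symm
    have h' : ∀ z, edist z x = edist z y := by
      have hx : Continuous fun z => edist z x := by fun_prop
      have hy : Continuous fun z => edist z y := by fun_prop
      exact congrFun ((TopologicalSpace.denseRange_denseSeq Z).equalizer hx hy (funext h))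
    have := h' x
    rw [edist_self] at this
    exact edist_eq_zero.1 this.symm
  have hGne : ∀ᵐ ω ∂P, ∃ z, (ω, z) ∈ G := by
    filter_upwards [hc, hne] with ω hω hω'
    have hcl : ∀ n, IsClosed {x | (ω, x) ∈ L n} := by
      intro n
      induction n with
      | zero => exact hω
      | succ n ih =>
        exact ih.inter (isClosed_eq (f := fun x => edist (d n) x)
          (g := fun _ => Metric.infEDist (d n) {x | (ω, x) ∈ L n}) (by fun_prop) continuous_const)
    have hn : ∀ n, {x | (ω, x) ∈ L n}.Nonempty := by
      intro n
      induction n with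
      | zero => exact hω'
      | succ n ih =>
        obtain ⟨y, hy, hxy⟩ := (hcl n).isCompact.exists_infEDist_eq_edist ih (d n)
        exact ⟨y, hy, hxy.symm⟩
    have := IsCompact.nonempty_iInter_of_sequence_nonempty_isCompact_isClosed
      (fun n => {x | (ω, x) ∈ L n}) (fun n x hx => hx.1) hn (hcl 0).isCompact hcl
    obtain ⟨z, hz⟩ := this
    exact ⟨z, mem_iInter.2 fun n => mem_iInter.1 hz n⟩
  classical
  let z₀ : Z := Classical.arbitrary Z
  let f : Ω → Z := fun ω => if h : ∃ z, (ω, z) ∈ G then h.choose else z₀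
  have hf : ∀ ω, (∃ z, (ω, z) ∈ G) → (ω, f ω) ∈ G := fun ω h => by
    simp only [f, h, dif_pos]
    exact h.choose_spec
  refine ⟨f, fun B hB => ?_, by filter_upwards [hGne] with ω hω using hGK (hf ω hω)⟩
  -- As `G` has at most one point over each `ω`, preimages under `f` are projections of parts of
  -- `G`, together with the `ω` of empty section if the default point lies in `B`.
  have h1 := measurableSet_setOf_exists_mem P hGm
  have h2 := measurableSet_setOf_exists_mem P (hGm.inter (measurable_snd hB))
  by_cases hz : z₀ ∈ B
  · convert h2.union h1.compl using 1
    ext ω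
    by_cases h : ∃ z, (ω, z) ∈ G
    · have : f ω ∈ B ↔ ∃ z, (ω, z) ∈ G ∧ z ∈ B :=
        ⟨fun hb => ⟨_, hf ω h, hb⟩, fun ⟨z, hz, hb⟩ => hG1 ω _ _ (hf ω h) hz ▸ hb⟩
      simpa [h] using this
    · have h' := h
      push Not at h'
      simp [f, h', hz]
  · convert h2 using 1
    ext ω
    by_cases h : ∃ z, (ω, z) ∈ G
    · have : f ω ∈ B ↔ ∃ z, (ω, z) ∈ G ∧ z ∈ B :=
        ⟨fun hb => ⟨_, hf ω h, hb⟩, fun ⟨z, hz, hb⟩ => hG1 ω _ _ (hf ω h) hz ▸ hb⟩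
      simpa [h] using this
    · have h' := h
      push Not at h'
      simp [f, h', hz]

end Projection

end

noncomputable section

/-! ### Conditional entropy as an infimum of linear functionals -/

/-- `-log t` with values in `[0, ∞]`; it is `0` for `t ≥ 1`. -/
def neglog (t : ℝ≥0∞) : ℝ≥0∞ := if t = 0 then ∞ else ENNReal.ofReal (-Real.log t.toReal)

@[simp] theorem neglog_zero : neglog 0 = ∞ := by simp [neglog]

@[simp] theorem neglog_one : neglog 1 = 0 := by simp [neglog]

@[simp] theorem neglog_top : neglog ∞ = 0 := by simp [neglog]

theorem neglog_of_ne_zero {t : ℝ≥0∞} (ht : t ≠ 0) :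
    neglog t = ENNReal.ofReal (-Real.log t.toReal) := by simp [neglog, ht]

theorem neglog_ne_top {t : ℝ≥0∞} (ht : t ≠ 0) : neglog t ≠ ∞ := by
  rw [neglog_of_ne_zero ht]; exact ENNReal.ofReal_ne_top

theorem neglog_antitone : Antitone neglog := by
  intro s t hst
  rcases eq_or_ne s 0 with rfl | hs
  · simp
  rcases eq_or_ne t ∞ with rfl | ht
  · simp
  have ht0 : t ≠ 0 := fun h => hs (le_zero_iff.1 (h ▸ hst))
  rw [neglog_of_ne_zero hs, neglog_of_ne_zero ht0]
  refine ENNReal.ofReal_le_ofReal (neg_le_neg (Real.log_le_log ?_ (ENNReal.toReal_mono ht hst)))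
  exact ENNReal.toReal_pos hs (ne_top_of_le_ne_top ht hst)

theorem measurable_neglog : Measurable neglog := neglog_antitone.measurable

theorem neglog_mul_le (a b : ℝ≥0∞) : neglog (a * b) ≤ neglog a + neglog b := by
  rcases eq_or_ne a 0 with rfl | ha
  · simp
  rcases eq_or_ne b 0 with rfl | hb
  · simp
  rcases eq_or_ne a ∞ with rfl | ha'
  · simp [ENNReal.top_mul hb]
  rcases eq_or_ne b ∞ with rfl | hb'
  · simp [ENNReal.mul_top ha]
  rw [neglog_of_ne_zero ha, neglog_of_ne_zero hb, neglog_of_ne_zero (mul_ne_zero ha hb),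
    ENNReal.toReal_mul, Real.log_mul (ENNReal.toReal_pos ha ha').ne' (ENNReal.toReal_pos hb hb').ne',
    neg_add]
  exact ENNReal.ofReal_add_le

theorem neglog_prod_le {ι : Type*} (s : Finset ι) (f : ι → ℝ≥0∞) :
    neglog (∏ i ∈ s, f i) ≤ ∑ i ∈ s, neglog (f i) := by
  classical
  induction s using Finset.induction_on with
  | empty => simp
  | insert a s ha ih =>
    rw [Finset.prod_insert ha, Finset.sum_insert ha]
    exact (neglog_mul_le _ _).trans (add_le_add_right ih _)

theorem neglog_inv_natCast (n : ℕ) :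
    neglog ((n : ℝ≥0∞)⁻¹) = ENNReal.ofReal (Real.log n) := by
  rw [neglog_of_ne_zero (by simp)]
  simp

theorem ENNReal.ofReal_negMulLog {t : ℝ} (ht : 0 ≤ t) :
    ENNReal.ofReal (Real.negMulLog t) = ENNReal.ofReal t * neglog (ENNReal.ofReal t) := by
  rcases ht.eq_or_lt with rfl | h
  · simp
  rw [neglog_of_ne_zero (by simpa using h), ENNReal.toReal_ofReal ht, ← ENNReal.ofReal_mul ht,
    Real.negMulLog]
  ring_nf

/-- The Gibbs inequality, for one term. -/
theorem mul_neglog_add_le {p q : ℝ≥0∞} (hp : p ≤ 1) (hq : q ≤ 1) :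
    p * neglog p + p ≤ p * neglog q + q := by
  rcases eq_or_ne p 0 with rfl | hp0
  · simp
  rcases eq_or_ne q 0 with rfl | hq0
  · simp [ENNReal.mul_top hp0]
  have hpt : p ≠ ∞ := ne_top_of_le_ne_top ENNReal.one_ne_top hp
  have hqt : q ≠ ∞ := ne_top_of_le_ne_top ENNReal.one_ne_top hq
  lift p to NNReal using hpt
  lift q to NNReal using hqt
  have hp' : (0 : ℝ) < p := by
    simpa [pos_iff_ne_zero] using hp0
  have hq' : (0 : ℝ) < q := by
    simpa [pos_iff_ne_zero] using hq0
  have hp1 : (p : ℝ) ≤ 1 := by exact_mod_cast hp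
  have hq1 : (q : ℝ) ≤ 1 := by exact_mod_cast hq
  have lp : 0 ≤ -Real.log p := by linarith [Real.log_nonpos hp'.le hp1]
  have lq : 0 ≤ -Real.log q := by linarith [Real.log_nonpos hq'.le hq1]
  rw [neglog_of_ne_zero hp0, neglog_of_ne_zero hq0]
  simp only [ENNReal.coe_toReal]
  have e : ∀ r : NNReal, (r : ℝ≥0∞) = ENNReal.ofReal (r : ℝ) := fun r => by simp
  rw [e p, e q, ← ENNReal.ofReal_mul hp'.le, ← ENNReal.ofReal_mul hp'.le,
    ← ENNReal.ofReal_add (by positivity) hp'.le, ← ENNReal.ofReal_add (by positivity) hq'.le]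
  refine ENNReal.ofReal_le_ofReal ?_
  have := Real.log_le_sub_one_of_pos (div_pos hq' hp')
  rw [Real.log_div hq'.ne' hp'.ne'] at this
  have h2 : (p : ℝ) * (Real.log q - Real.log p) ≤ p * (q / p - 1) :=
    mul_le_mul_of_nonneg_left this hp'.le
  have h3 : (p : ℝ) * (q / p - 1) = q - p := by field_simp
  nlinarith

/-- The Gibbs inequality. -/
theorem tsum_mul_neglog_le {ι : Type*} {p q : ι → ℝ≥0∞} (hp : ∑' i, p i = 1)
    (hq : ∑' i, q i ≤ 1) : ∑' i, p i * neglog (p i) ≤ ∑' i, p i * neglog (q i) := by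
  have h : ∑' i, (p i * neglog (p i) + p i) ≤ ∑' i, (p i * neglog (q i) + q i) :=
    ENNReal.tsum_le_tsum fun i => mul_neglog_add_le
      ((ENNReal.le_tsum i).trans hp.le) ((ENNReal.le_tsum i).trans hq)
  -- The terms added to avoid subtraction sum to `1` on the left and to at most `1` on the right, so
  -- they cancel.
  rw [ENNReal.tsum_add, ENNReal.tsum_add, hp] at h
  exact (ENNReal.add_le_add_iff_right ENNReal.one_ne_top).1 (h.trans (add_le_add_right hq _))

section DualEntropy

/-- A family of `S`-measurable functions forming a sub-probability vector at every point. -/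
structure IsSubProb {Y ι : Type*} (S : MeasurableSpace Y) (g : ι → Y → ℝ≥0∞) : Prop where
  measurable : ∀ i, Measurable[S] (g i)
  tsum_le_one : ∀ y, ∑' i, g i y ≤ 1

/-- The entropy of the partition into the level sets of `ξ`, conditionally on `S`, as an infimum
over coding strategies. -/
def codeEntropy {Y ι : Type*} (S : MeasurableSpace Y) {mY : MeasurableSpace Y} (μ : Measure Y)
    (ξ : Y → ι) : ℝ≥0∞ :=
  ⨅ (g : ι → Y → ℝ≥0∞) (_ : IsSubProb S g), ∫⁻ y, neglog (g (ξ y) y) ∂μ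

/-- The entropy of `ξ` conditionally on `S` and on the level sets of `β`. -/
def codeEntropyGiven {Y ι κ : Type*} (S : MeasurableSpace Y) {mY : MeasurableSpace Y}
    (μ : Measure Y) (β : Y → κ) (ξ : Y → ι) : ℝ≥0∞ :=
  ⨅ (k : κ → ι → Y → ℝ≥0∞) (_ : ∀ b, IsSubProb S (k b)), ∫⁻ y, neglog (k (β y) (ξ y) y) ∂μ

variable {Y ι κ ι' κ' : Type*} {S mY : MeasurableSpace Y} {μ : Measure Y}

theorem codeEntropy_le {ξ : Y → ι} {g : ι → Y → ℝ≥0∞} (hg : IsSubProb S g) :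
    codeEntropy S μ ξ ≤ ∫⁻ y, neglog (g (ξ y) y) ∂μ := iInf₂_le g hg

theorem codeEntropyGiven_le {β : Y → κ} {ξ : Y → ι} {k : κ → ι → Y → ℝ≥0∞}
    (hk : ∀ b, IsSubProb S (k b)) :
    codeEntropyGiven S μ β ξ ≤ ∫⁻ y, neglog (k (β y) (ξ y) y) ∂μ := iInf₂_le k hk

theorem exists_lintegral_lt_of_codeEntropy_lt {ξ : Y → ι} {c : ℝ≥0∞} (h : codeEntropy S μ ξ < c) :
    ∃ g : ι → Y → ℝ≥0∞, IsSubProb S g ∧ ∫⁻ y, neglog (g (ξ y) y) ∂μ < c := by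
  simpa [codeEntropy, iInf_lt_iff] using h

theorem IsSubProb.le_one {g : ι → Y → ℝ≥0∞} (hg : IsSubProb S g) (i : ι) (y : Y) : g i y ≤ 1 :=
  (ENNReal.le_tsum i).trans (hg.tsum_le_one y)

theorem IsSubProb.prod {g : ι → Y → ℝ≥0∞} {h : ι' → Y → ℝ≥0∞} (hg : IsSubProb S g)
    (hh : IsSubProb S h) : IsSubProb S fun (p : ι × ι') y => g p.1 y * h p.2 y where
  measurable p := (hg.measurable p.1).mul (hh.measurable p.2)
  tsum_le_one y := by
    rw [ENNReal.tsum_prod (f := fun i j => g i y * h j y)]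
    simp_rw [ENNReal.tsum_mul_left, ENNReal.tsum_mul_right]
    exact mul_le_one' (hg.tsum_le_one y) (hh.tsum_le_one y)

open Classical in
theorem IsSubProb.factor [Countable ι] {g : ι → Y → ℝ≥0∞} (hg : IsSubProb S g) (φ : ι → ι') :
    IsSubProb S fun j y => ∑' i, if φ i = j then g i y else 0 where
  measurable j := Measurable.tsum fun i => by
    split_ifs
    · exact hg.measurable i
    · exact measurable_const
  tsum_le_one y := by
    rw [ENNReal.tsum_comm]
    simpa [tsum_ite_eq] using hg.tsum_le_one y

theorem IsSubProb.comp {g : ι → Y → ℝ≥0∞} (hg : IsSubProb S g) {θ : Y → Y}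
    (hθ : Measurable[S, S] θ) : IsSubProb S fun i y => g i (θ y) where
  measurable i := (hg.measurable i).comp hθ
  tsum_le_one _ := hg.tsum_le_one _

/-- This is the code behind the chain rule: code the letter `b` with `g`, then code `i` with `k b`,
and forget `b`. -/
theorem IsSubProb.mixture [Countable κ] {g : κ → Y → ℝ≥0∞} (hg : IsSubProb S g)
    {k : κ → ι → Y → ℝ≥0∞} (hk : ∀ b, IsSubProb S (k b)) :
    IsSubProb S fun i y => ∑' b, g b y * k b i y where
  measurable i := Measurable.tsum fun b => (hg.measurable b).mul ((hk b).measurable i)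
  tsum_le_one y := by
    rw [ENNReal.tsum_comm]
    simp_rw [ENNReal.tsum_mul_left]
    refine le_trans (ENNReal.tsum_le_tsum fun b => ?_) (hg.tsum_le_one y)
    exact mul_le_of_le_one_right' ((hk b).tsum_le_one y)

theorem IsSubProb.const [Fintype ι] : IsSubProb S fun (_ : ι) _ => (Fintype.card ι : ℝ≥0∞)⁻¹ where
  measurable _ := measurable_const
  tsum_le_one y := by
    rw [tsum_fintype, Finset.sum_const, Finset.card_univ, nsmul_eq_mul]
    exact ENNReal.mul_inv_le_one _

theorem measurable_apply_apply [MeasurableSpace ι] [MeasurableSingletonClass ι] [Countable ι]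
    (hS : S ≤ mY) {g : ι → Y → ℝ≥0∞} (hg : ∀ i, Measurable[S] (g i))
    {ξ : Y → ι} (hξ : Measurable ξ) : Measurable fun y => g (ξ y) y := by
  have h : Measurable fun p : ι × Y => g p.1 p.2 :=
    measurable_from_prod_countable_right fun i => (hg i).mono hS le_rfl
  exact h.comp (hξ.prodMk measurable_id)

theorem measurable_neglog_apply [MeasurableSpace ι] [MeasurableSingletonClass ι] [Countable ι]
    (hS : S ≤ mY) {g : ι → Y → ℝ≥0∞} (hg : ∀ i, Measurable[S] (g i))
    {ξ : Y → ι} (hξ : Measurable ξ) : Measurable fun y => neglog (g (ξ y) y) :=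
  measurable_neglog.comp (measurable_apply_apply hS hg hξ)

/-- The product of a code for `ξ` and a code for `η` codes the pair, and code lengths add. -/
theorem codeEntropy_prodMk_le [MeasurableSpace ι] [MeasurableSingletonClass ι] [Countable ι]
    (hS : S ≤ mY) {ξ : Y → ι} (hξ : Measurable ξ) (η : Y → ι') :
    codeEntropy S μ (fun y => (ξ y, η y)) ≤ codeEntropy S μ ξ + codeEntropy S μ η := by
  conv_rhs => rw [codeEntropy, codeEntropy]
  simp only [ENNReal.iInf_add, ENNReal.add_iInf]
  refine le_iInf₂ fun h hh => le_iInf₂ fun g hg => ?_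
  refine (codeEntropy_le (hg.prod hh)).trans ?_
  rw [← lintegral_add_left (measurable_neglog_apply hS hg.measurable hξ)]
  exact lintegral_mono fun y => neglog_mul_le _ _

/-- Pushing a code forward along `φ` only increases the weight of the letter that occurs. -/
theorem codeEntropy_comp_le [Countable ι] (φ : ι → ι') (ξ : Y → ι) :
    codeEntropy S μ (fun y => φ (ξ y)) ≤ codeEntropy S μ ξ := by
  classical
  refine le_iInf₂ fun g hg => (codeEntropy_le (hg.factor φ)).trans (lintegral_mono fun y => ?_)
  refine neglog_antitone (le_trans (le_of_eq ?_) (ENNReal.le_tsum (ξ y)))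
  simp

/-- In the mixture of codes, the single summand with index `β y` already gives the bound. -/
theorem codeEntropy_le_add_given [MeasurableSpace κ] [MeasurableSingletonClass κ] [Countable κ]
    (hS : S ≤ mY) {β : Y → κ} (hβ : Measurable β) (ξ : Y → ι) :
    codeEntropy S μ ξ ≤ codeEntropy S μ β + codeEntropyGiven S μ β ξ := by
  conv_rhs => rw [codeEntropy, codeEntropyGiven]
  simp only [ENNReal.iInf_add, ENNReal.add_iInf]
  refine le_iInf₂ fun k hk => le_iInf₂ fun g hg => ?_
  refine (codeEntropy_le (hg.mixture hk)).trans ?_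
  rw [← lintegral_add_left (measurable_neglog_apply hS hg.measurable hβ)]
  exact lintegral_mono fun y => (neglog_antitone (ENNReal.le_tsum (β y))).trans (neglog_mul_le _ _)

theorem codeEntropy_le_log_card [Fintype ι] (ξ : Y → ι) [IsProbabilityMeasure μ] :
    codeEntropy S μ ξ ≤ ENNReal.ofReal (Real.log (Fintype.card ι)) := by
  refine (codeEntropy_le IsSubProb.const).trans ?_
  simp [neglog_inv_natCast]

/-- A code for `ξ` composed with `θ` codes `ξ ∘ θ` with the same mean length. Not every code arises
in this way, so only an inequality results. -/
theorem codeEntropy_comp_map_le [MeasurableSpace ι] [MeasurableSingletonClass ι] [Countable ι]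
    (hS : S ≤ mY) {ξ : Y → ι} (hξ : Measurable ξ) {θ : Y → Y}
    (hθ : Measurable θ) (hθS : Measurable[S, S] θ) :
    codeEntropy S μ (fun y => ξ (θ y)) ≤ codeEntropy S (μ.map θ) ξ := by
  refine le_iInf₂ fun g hg => (codeEntropy_le (hg.comp hθS)).trans ?_
  rw [lintegral_map (measurable_neglog_apply hS hg.measurable hξ) hθ]

/-- An infimum of functionals linear in the measure is superadditive. With `mul_codeEntropy_le` this
is the concavity of conditional entropy needed for orbit averages. -/
theorem sum_codeEntropy_le {J : Type*} (s : Finset J) (ν : J → Measure Y) (ξ : Y → ι) :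
    ∑ j ∈ s, codeEntropy S (ν j) ξ ≤ codeEntropy S (∑ j ∈ s, ν j) ξ := by
  refine le_iInf₂ fun g hg => ?_
  rw [lintegral_finsetSum_measure]
  exact Finset.sum_le_sum fun j _ => codeEntropy_le hg

theorem mul_codeEntropy_le (c : ℝ≥0∞) (ξ : Y → ι) :
    c * codeEntropy S μ ξ ≤ codeEntropy S (c • μ) ξ := by
  refine le_iInf₂ fun g hg => ?_
  rw [lintegral_smul_measure]
  exact mul_le_mul_right (codeEntropy_le hg) c

theorem codeEntropyGiven_prodMk_le [MeasurableSpace ι] [MeasurableSingletonClass ι] [Countable ι]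
    [MeasurableSpace κ] [MeasurableSingletonClass κ] [Countable κ]
    (hS : S ≤ mY) {β : Y → κ} (hβ : Measurable β) {ξ : Y → ι} (hξ : Measurable ξ)
    (β' : Y → κ') (ξ' : Y → ι') :
    codeEntropyGiven S μ (fun y => (β y, β' y)) (fun y => (ξ y, ξ' y)) ≤
      codeEntropyGiven S μ β ξ + codeEntropyGiven S μ β' ξ' := by
  conv_rhs => rw [codeEntropyGiven, codeEntropyGiven]
  simp only [ENNReal.iInf_add, ENNReal.add_iInf]
  refine le_iInf₂ fun l hl => le_iInf₂ fun k hk => ?_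
  refine (codeEntropyGiven_le (k := fun b i y => k b.1 i.1 y * l b.2 i.2 y)
    fun b => (hk b.1).prod (hl b.2)).trans ?_
  have hm : Measurable fun y => neglog (k (β y) (ξ y) y) :=
    measurable_neglog_apply (g := fun (p : κ × ι) y => k p.1 p.2 y) hS
      (fun p => (hk p.1).measurable p.2) (hβ.prodMk hξ)
  rw [← lintegral_add_left hm]
  exact lintegral_mono fun y => neglog_mul_le _ _

theorem codeEntropyGiven_comp_le [Countable ι] (φ : ι → ι') (ψ : κ → κ') (β : Y → κ) (ξ : Y → ι) :
    codeEntropyGiven S μ β (fun y => φ (ξ y)) ≤ codeEntropyGiven S μ (fun y => ψ (β y)) ξ := by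
  classical
  refine le_iInf₂ fun k hk => (codeEntropyGiven_le fun b => (hk (ψ b)).factor φ).trans
    (lintegral_mono fun y => ?_)
  refine neglog_antitone (le_trans (le_of_eq ?_) (ENNReal.le_tsum (ξ y)))
  simp

theorem codeEntropyGiven_comp_map_le [MeasurableSpace ι] [MeasurableSingletonClass ι] [Countable ι]
    [MeasurableSpace κ] [MeasurableSingletonClass κ] [Countable κ]
    (hS : S ≤ mY) {β : Y → κ} (hβ : Measurable β) {ξ : Y → ι} (hξ : Measurable ξ) {θ : Y → Y}
    (hθ : Measurable θ) (hθS : Measurable[S, S] θ) :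
    codeEntropyGiven S μ (fun y => β (θ y)) (fun y => ξ (θ y)) ≤
      codeEntropyGiven S (μ.map θ) β ξ := by
  refine le_iInf₂ fun k hk => (codeEntropyGiven_le fun b => (hk b).comp hθS).trans ?_
  have hm : Measurable fun y => neglog (k (β y) (ξ y) y) :=
    measurable_neglog_apply (g := fun (p : κ × ι) y => k p.1 p.2 y) hS
      (fun p => (hk p.1).measurable p.2) (hβ.prodMk hξ)
  rw [lintegral_map hm hθ]

/-! #### Itineraries -/

/-- The itinerary of length `n` with respect to the partition into level sets of `ξ`. -/
def itinerary (θ : Y → Y) (ξ : Y → ι) (n : ℕ) (y : Y) : Fin n → ι := fun i => ξ (θ^[i] y)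

theorem measurable_itinerary [MeasurableSpace ι] {θ : Y → Y} (hθ : Measurable θ) {ξ : Y → ι}
    (hξ : Measurable ξ) (n : ℕ) : Measurable (itinerary θ ξ n) :=
  measurable_pi_lambda _ fun i => hξ.comp (hθ.iterate i)

theorem itinerary_add (θ : Y → Y) (ξ : Y → ι) (m n : ℕ) (y : Y) :
    itinerary θ ξ (m + n) y = Fin.append (itinerary θ ξ m y) (itinerary θ ξ n (θ^[m] y)) := by
  funext i
  refine Fin.addCases (fun j => ?_) (fun j => ?_) i
  · simp [itinerary]
  · simp only [itinerary, Fin.val_natAdd, Fin.append_right]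
    rw [← Function.iterate_add_apply, add_comm]

theorem codeEntropy_itinerary_add_le [MeasurableSpace ι] [MeasurableSingletonClass ι] [Countable ι]
    (hS : S ≤ mY) {ξ : Y → ι} (hξ : Measurable ξ) {θ : Y → Y} (hθ : Measurable θ) (m n : ℕ) :
    codeEntropy S μ (itinerary θ ξ (m + n)) ≤ codeEntropy S μ (itinerary θ ξ m) +
      codeEntropy S μ (fun y => itinerary θ ξ n (θ^[m] y)) := by
  refine le_trans ?_ (codeEntropy_prodMk_le hS (measurable_itinerary hθ hξ m) _)
  have : itinerary θ ξ (m + n) = fun y => (fun p : (Fin m → ι) × (Fin n → ι) => Fin.append p.1 p.2)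
      (itinerary θ ξ m y, itinerary θ ξ n (θ^[m] y)) := funext (itinerary_add θ ξ m n)
  rw [this]
  exact codeEntropy_comp_le (fun p : (Fin m → ι) × (Fin n → ι) => Fin.append p.1 p.2) _

theorem codeEntropy_itinerary_mono [Countable ι] (θ : Y → Y) (ξ : Y → ι) {m n : ℕ} (h : m ≤ n) :
    codeEntropy S μ (itinerary θ ξ m) ≤ codeEntropy S μ (itinerary θ ξ n) :=
  codeEntropy_comp_le (fun (a : Fin n → ι) (i : Fin m) => a (Fin.castLE h i)) (itinerary θ ξ n)

theorem Measurable.iterate_same {θ : Y → Y} (hθ : Measurable[S, S] θ) (n : ℕ) :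
    Measurable[S, S] θ^[n] := Measurable.iterate hθ n

/-- Subadditivity of the entropy of itineraries for an invariant measure. -/
theorem codeEntropy_itinerary_add_le_add [MeasurableSpace ι] [MeasurableSingletonClass ι]
    [Countable ι] (hS : S ≤ mY) {ξ : Y → ι} (hξ : Measurable ξ) {θ : Y → Y}
    (hθ : MeasurePreserving θ μ μ) (hθS : Measurable[S, S] θ) (m n : ℕ) :
    codeEntropy S μ (itinerary θ ξ (m + n)) ≤ codeEntropy S μ (itinerary θ ξ m) +
      codeEntropy S μ (itinerary θ ξ n) := by
  refine (codeEntropy_itinerary_add_le hS hξ hθ.measurable m n).trans (add_le_add_right ?_ _)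
  have := codeEntropy_comp_map_le (μ := μ) hS (measurable_itinerary hθ.measurable hξ n)
    (hθ.iterate m).measurable (hθS.iterate_same m)
  rwa [(hθ.iterate m).map_eq] at this

/-- The itinerary is coded one time step after another, using only the current letter of `β`; by
invariance each step costs at most as much as the initial one. -/
theorem codeEntropyGiven_itinerary_le [MeasurableSpace ι] [MeasurableSingletonClass ι]
    [Countable ι] [MeasurableSpace κ] [MeasurableSingletonClass κ] [Countable κ]
    (hS : S ≤ mY) {β : Y → κ} (hβ : Measurable β) {ξ : Y → ι}
    (hξ : Measurable ξ) {θ : Y → Y} (hθ : MeasurePreserving θ μ μ) (hθS : Measurable[S, S] θ)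
    (n : ℕ) :
    codeEntropyGiven S μ (itinerary θ β n) (itinerary θ ξ n) ≤ n * codeEntropyGiven S μ β ξ := by
  induction n with
  | zero =>
    refine (codeEntropyGiven_le (k := fun _ _ _ => 1) fun b => ⟨fun i => measurable_const,
      fun y => by simp⟩).trans ?_
    simp
  | succ n ih =>
    have e : itinerary θ ξ (n + 1) = fun y => (fun p : (Fin n → ι) × ι =>
        (Fin.snoc p.1 p.2 : Fin (n + 1) → ι)) (itinerary θ ξ n y, ξ (θ^[n] y)) := by
      funext y i
      refine Fin.lastCases ?_ (fun j => ?_) i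
      · simp [itinerary]
      · simp [itinerary]
    have e' : (fun y => (itinerary θ β n y, β (θ^[n] y))) = fun y =>
        (fun b : Fin (n + 1) → κ => ((fun i : Fin n => b i.castSucc), b (Fin.last n)))
          (itinerary θ β (n + 1) y) := by
      funext y
      simp [itinerary, funext_iff]
    rw [e]
    refine (codeEntropyGiven_comp_le (fun p : (Fin n → ι) × ι =>
      (Fin.snoc p.1 p.2 : Fin (n + 1) → ι)) (fun b : Fin (n + 1) → κ =>
      ((fun i : Fin n => b i.castSucc), b (Fin.last n))) _ _).trans ?_
    rw [← e']
    refine (codeEntropyGiven_prodMk_le hS (measurable_itinerary hθ.measurable hβ n)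
      (measurable_itinerary hθ.measurable hξ n) _ _).trans ?_
    rw [Nat.cast_succ, add_mul, one_mul]
    refine add_le_add ih ?_
    have := codeEntropyGiven_comp_map_le (μ := μ) hS hβ hξ (hθ.iterate n).measurable
      (hθS.iterate_same n)
    rwa [(hθ.iterate n).map_eq] at this

end DualEntropy

end

/-! ### Conditional expectations and the equality of conditional entropy with `codeEntropy`. -/

noncomputable section

section CondEntropy

variable {Y ι : Type*} {S mY : MeasurableSpace Y} {μ : Measure Y}

/-- Integration against a conditional probability. -/
theorem lintegral_condExp_indicator_mul [IsFiniteMeasure μ] (hS : S ≤ mY) {R : Set Y}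
    (hR : MeasurableSet R) {u : Y → ℝ≥0∞} (hu : Measurable[S] u) :
    ∫⁻ y, ENNReal.ofReal ((μ[R.indicator (fun _ => (1 : ℝ)) | S]) y) * u y ∂μ =
      ∫⁻ y in R, u y ∂μ := by
  have hf : Measurable[S] fun y => ENNReal.ofReal ((μ[R.indicator (fun _ => (1 : ℝ)) | S]) y) :=
    (stronglyMeasurable_condExp (m := S)).measurable.ennreal_ofReal
  have hi : Integrable (R.indicator (fun _ => (1 : ℝ))) μ := (integrable_const _).indicator hR
  have h0 : 0 ≤ᵐ[μ] μ[R.indicator (fun _ => (1 : ℝ)) | S] :=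
    condExp_nonneg (Eventually.of_forall fun y => indicator_nonneg (by simp) y)
  -- The two measures agree on `S`, which is enough to integrate the `S`-measurable function `u`.
  have key : (μ.withDensity fun y => ENNReal.ofReal ((μ[R.indicator (fun _ => (1 : ℝ)) | S]) y)).trim
      hS = (μ.restrict R).trim hS := by
    refine @Measure.ext _ S _ _ fun A hA => ?_
    rw [trim_measurableSet_eq hS hA, trim_measurableSet_eq hS hA, withDensity_apply _ (hS _ hA),
      Measure.restrict_apply (hS _ hA),
      ← ofReal_integral_eq_lintegral_ofReal integrable_condExp.integrableOn
        (ae_restrict_of_ae h0), setIntegral_condExp hS hi hA, integral_indicator_const _ hR]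
    simp [measureReal_def, Measure.restrict_apply hR, inter_comm]
  have hum : Measurable u := hu.mono hS le_rfl
  have := lintegral_withDensity_eq_lintegral_mul μ (hf.mono hS le_rfl) hum
  simp only [Pi.mul_apply] at this
  rw [← this, ← lintegral_trim hS hu, key, lintegral_trim hS hu]

theorem measurable_tsum_ennreal [Countable ι] (S : MeasurableSpace Y) {f : ι → Y → ℝ≥0∞}
    (hf : ∀ i, Measurable[S] (f i)) : Measurable[S] fun y => ∑' i, f i y :=
  Measurable.tsum hf

/-- The conditional probability of a level set. -/
def condProb (S : MeasurableSpace Y) {mY : MeasurableSpace Y} (μ : Measure Y) (ξ : Y → ι) (i : ι)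
    (y : Y) : ℝ≥0∞ :=
  ENNReal.ofReal ((μ[(ξ ⁻¹' {i}).indicator (fun _ => (1 : ℝ)) | S]) y)

theorem measurable_condProb (ξ : Y → ι) (i : ι) : Measurable[S] (condProb S μ ξ i) :=
  (stronglyMeasurable_condExp (m := S)).measurable.ennreal_ofReal

theorem condEntropy_eq_lintegral_condProb [Countable ι] (ξ : Y → ι) :
    BundleRDS.condEntropy S μ (fun i => ξ ⁻¹' {i}) =
      ∫⁻ y, ∑' i, condProb S μ ξ i y * neglog (condProb S μ ξ i y) ∂μ := by
  rw [BundleRDS.condEntropy]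
  refine lintegral_congr_ae ?_
  have h0 : ∀ᵐ y ∂μ, ∀ i, 0 ≤ (μ[(ξ ⁻¹' {i}).indicator (fun _ => (1 : ℝ)) | S]) y :=
    ae_all_iff.2 fun i => condExp_nonneg (Eventually.of_forall fun y => indicator_nonneg (by simp) y)
  filter_upwards [h0] with y hy
  exact tsum_congr fun i => ENNReal.ofReal_negMulLog (hy i)

variable [MeasurableSpace ι] [MeasurableSingletonClass ι] [Countable ι]

/-- On each level set of `ξ` the integrand is an `S`-measurable function, so the indicator of the
level set may be replaced by its conditional probability. -/
theorem lintegral_apply_eq [IsFiniteMeasure μ] (hS : S ≤ mY) {ξ : Y → ι} (hξ : Measurable ξ)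
    {u : ι → Y → ℝ≥0∞} (hu : ∀ i, Measurable[S] (u i)) :
    ∫⁻ y, u (ξ y) y ∂μ = ∫⁻ y, ∑' i, condProb S μ ξ i y * u i y ∂μ := by
  have hm : ∀ i, MeasurableSet (ξ ⁻¹' {i}) := fun i => hξ (measurableSet_singleton i)
  have hmm : ∀ i, Measurable fun y => condProb S μ ξ i y * u i y := fun i =>
    ((measurable_condProb ξ i).mul (hu i)).mono hS le_rfl
  rw [lintegral_tsum fun i => (hmm i).aemeasurable]
  have : ∀ i, ∫⁻ y, condProb S μ ξ i y * u i y ∂μ = ∫⁻ y in ξ ⁻¹' {i}, u (ξ y) y ∂μ := fun i => by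
    rw [setLIntegral_congr_fun (g := u i) (hm i) (fun y hy => by rw [show ξ y = i from hy])]
    exact lintegral_condExp_indicator_mul hS (hm i) (hu i)
  simp_rw [this]
  rw [← lintegral_iUnion hm, ← preimage_iUnion, iUnion_of_singleton, preimage_univ, setLIntegral_univ]
  intro i j hij
  exact Disjoint.preimage _ (by simpa using hij)

/-- Both sides have the same integral over every set `A` of `S`: apply `lintegral_apply_eq` to the
indicator of `A`, which does not depend on the letter. -/
theorem tsum_condProb [IsFiniteMeasure μ] (hS : S ≤ mY) {ξ : Y → ι} (hξ : Measurable ξ) :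
    ∀ᵐ y ∂μ, ∑' i, condProb S μ ξ i y = 1 := by
  have hm : Measurable[S] fun y => ∑' i, condProb S μ ξ i y :=
    measurable_tsum_ennreal S fun i => measurable_condProb ξ i
  refine ae_eq_of_ae_eq_trim (hm := hS) ?_
  refine ae_eq_of_forall_setLIntegral_eq_of_sigmaFinite hm measurable_const fun A hA _ => ?_
  rw [← lintegral_indicator hA, ← lintegral_indicator hA, lintegral_trim hS (hm.indicator hA),
    lintegral_trim hS (measurable_const.indicator hA)]
  have := lintegral_apply_eq (μ := μ) hS hξ (u := fun _ => A.indicator fun _ => 1)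
    fun _ => measurable_const.indicator hA
  rw [this]
  refine lintegral_congr fun y => ?_
  by_cases hy : y ∈ A <;> simp [hy]

theorem lintegral_neglog_condProb [IsFiniteMeasure μ] (hS : S ≤ mY) {ξ : Y → ι}
    (hξ : Measurable ξ) :
    ∫⁻ y, neglog (condProb S μ ξ (ξ y) y) ∂μ =
      BundleRDS.condEntropy S μ (fun i => ξ ⁻¹' {i}) := by
  rw [condEntropy_eq_lintegral_condProb,
    lintegral_apply_eq hS hξ (u := fun i y => neglog (condProb S μ ξ i y))
      fun i => measurable_neglog.comp (measurable_condProb ξ i)]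

/-- A version of the conditional probabilities which is a sub-probability vector at all points. -/
theorem exists_isSubProb_ae_eq_condProb [IsFiniteMeasure μ] (hS : S ≤ mY) {ξ : Y → ι}
    (hξ : Measurable ξ) :
    ∃ g : ι → Y → ℝ≥0∞, IsSubProb S g ∧ ∀ᵐ y ∂μ, ∀ i, g i y = condProb S μ ξ i y := by
  have hm : Measurable[S] fun y => ∑' i, condProb S μ ξ i y :=
    measurable_tsum_ennreal S fun i => measurable_condProb ξ i
  -- A code must be sub-probability at every point, so the conditional probabilities are set to `0`
  -- off this set of full measure.
  let A : Set Y := {y | ∑' i, condProb S μ ξ i y ≤ 1}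
  have hA : MeasurableSet[S] A := measurableSet_le hm measurable_const
  refine ⟨fun i => A.indicator (condProb S μ ξ i), ⟨fun i => (measurable_condProb ξ i).indicator hA,
    fun y => ?_⟩, ?_⟩
  · by_cases hy : y ∈ A
    · simp only [indicator_of_mem hy]
      exact hy
    · simp [hy]
  · filter_upwards [tsum_condProb hS hξ] with y hy i
    have : y ∈ A := hy.le
    simp [this]

/-- The conditional entropy of a partition is the infimum of the mean code lengths. -/
theorem condEntropy_eq_codeEntropy [IsFiniteMeasure μ] (hS : S ≤ mY) {ξ : Y → ι}
    (hξ : Measurable ξ) :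
    BundleRDS.condEntropy S μ (fun i => ξ ⁻¹' {i}) = codeEntropy S μ ξ := by
  -- The Gibbs inequality, applied pointwise, bounds the entropy by any code length; the conditional
  -- probabilities are a code attaining it.
  refine le_antisymm (le_iInf₂ fun g hg => ?_) ?_
  · rw [condEntropy_eq_lintegral_condProb,
      lintegral_apply_eq hS hξ (u := fun i y => neglog (g i y))
        fun i => measurable_neglog.comp (hg.measurable i)]
    refine lintegral_mono_ae ?_
    filter_upwards [tsum_condProb hS hξ] with y hy
    exact tsum_mul_neglog_le hy (hg.tsum_le_one y)
  · obtain ⟨g, hg, hgf⟩ := exists_isSubProb_ae_eq_condProb (μ := μ) hS hξ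
    refine (codeEntropy_le hg).trans (le_of_eq ?_)
    rw [← lintegral_neglog_condProb hS hξ]
    refine lintegral_congr_ae ?_
    filter_upwards [hgf] with y hy
    rw [hy]

end CondEntropy

end

/-! ### Entropy rates and their approximation by finite partitions. -/

noncomputable section

section EntropyRate

theorem ENNReal.limsup_add_const_le {α : Type*} {l : Filter α} [NeBot l] {u v : α → ℝ≥0∞}
    {c : ℝ≥0∞} (h : ∀ᶠ n in l, v n ≤ u n + c) : limsup v l ≤ limsup u l + c := by
  refine (limsup_le_limsup h).trans (le_of_eq ?_)
  exact limsup_add_const l u c (by isBoundedDefault) (by isBoundedDefault)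

/-- This is the half of Fekete's lemma that is needed: divide `n` by `k` and bound the remainder
term by the constant `M`, which vanishes after division by `n`. -/
theorem ENNReal.limsup_div_le_of_subadditive {a : ℕ → ℝ≥0∞} (ha : ∀ m n, a (m + n) ≤ a m + a n)
    (hfin : ∀ n, a n ≠ ∞) {k : ℕ} (hk : k ≠ 0) :
    limsup (fun n : ℕ => a n / n) atTop ≤ a k / k := by
  have hmul : ∀ q r, a (q * k + r) ≤ q * a k + a r := by
    intro q r
    induction q with
    | zero => simp
    | succ q ih =>
      have : (q + 1) * k + r = k + (q * k + r) := by ring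
      rw [this]
      refine (ha _ _).trans ((add_le_add_right ih _).trans (le_of_eq ?_))
      push_cast
      ring
  let M : ℝ≥0∞ := ∑ r ∈ Finset.range k, a r
  have hM : M ≠ ∞ := (ENNReal.sum_lt_top.2 fun r _ => (hfin r).lt_top).ne
  have hb : ∀ᶠ n : ℕ in atTop, a n / n ≤ M / n + a k / k := by
    filter_upwards [eventually_gt_atTop 0] with n hn
    have hn0 : (n : ℝ≥0∞) ≠ 0 := by simpa using hn.ne'
    have hk0 : (k : ℝ≥0∞) ≠ 0 := by simpa using hk
    have h1 : a n ≤ (n / k : ℕ) * a k + M := by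
      conv_lhs => rw [← Nat.div_add_mod' n k]
      refine (hmul _ _).trans (add_le_add_right ?_ _)
      exact Finset.single_le_sum (f := a) (fun _ _ => zero_le)
        (Finset.mem_range.2 (Nat.mod_lt _ (Nat.pos_of_ne_zero hk)))
    have h2 : ((n / k : ℕ) : ℝ≥0∞) ≤ n / k := by
      rw [ENNReal.le_div_iff_mul_le (Or.inl hk0) (Or.inl (by simp))]
      exact_mod_cast Nat.div_mul_le_self n k
    calc a n / n ≤ ((n / k : ℝ≥0∞) * a k + M) / n := by gcongr; exact h1.trans (by gcongr)
      _ = M / n + a k / k := by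
        rw [ENNReal.add_div, add_comm]
        congr 1
        rw [div_eq_mul_inv, div_eq_mul_inv, div_eq_mul_inv]
        calc (n : ℝ≥0∞) * (k : ℝ≥0∞)⁻¹ * a k * (n : ℝ≥0∞)⁻¹
            = (n * (n : ℝ≥0∞)⁻¹) * (a k * (k : ℝ≥0∞)⁻¹) := by ring
          _ = _ := by rw [ENNReal.mul_inv_cancel hn0 (by simp), one_mul]
  refine (ENNReal.limsup_add_const_le hb).trans (le_of_eq ?_)
  have : Tendsto (fun n : ℕ => M / n) atTop (𝓝 0) := by
    have := ENNReal.Tendsto.const_div (a := M) ENNReal.tendsto_nat_nhds_top (Or.inr hM)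
    simpa using this
  rw [this.limsup_eq, zero_add]

/-- The entropy per unit time of the itineraries with respect to `ξ`. -/
def entropyRate {Y ι : Type*} (S : MeasurableSpace Y) {mY : MeasurableSpace Y} (μ : Measure Y)
    (θ : Y → Y) (ξ : Y → ι) : ℝ≥0∞ :=
  limsup (fun n : ℕ => codeEntropy S μ (itinerary θ ξ n) / n) atTop

variable {Y ι κ : Type*} {S mY : MeasurableSpace Y} {μ : Measure Y} {θ : Y → Y}

theorem entropyRate_le_add_given [MeasurableSpace ι] [MeasurableSingletonClass ι] [Countable ι]
    [MeasurableSpace κ] [MeasurableSingletonClass κ] [Countable κ]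
    (hS : S ≤ mY) {β : Y → κ} (hβ : Measurable β) {ξ : Y → ι} (hξ : Measurable ξ)
    (hθ : MeasurePreserving θ μ μ) (hθS : Measurable[S, S] θ) :
    entropyRate S μ θ ξ ≤ entropyRate S μ θ β + codeEntropyGiven S μ β ξ := by
  refine ENNReal.limsup_add_const_le ?_
  filter_upwards [eventually_gt_atTop 0] with n hn
  have hn0 : (n : ℝ≥0∞) ≠ 0 := by simpa using hn.ne'
  calc _ ≤ (codeEntropy S μ (itinerary θ β n) + n * codeEntropyGiven S μ β ξ) / n := by
        gcongr
        exact (codeEntropy_le_add_given hS (measurable_itinerary hθ.measurable hβ n) _).trans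
          (add_le_add_right (codeEntropyGiven_itinerary_le hS hβ hξ hθ hθS n) _)
    _ = _ := by
      rw [ENNReal.add_div, mul_comm, ENNReal.mul_div_cancel_right hn0 (by simp)]

/-- The rate is dominated by every finite-time entropy per step. Upper semicontinuity at one finite
time then passes to the rate. -/
theorem entropyRate_le_div [MeasurableSpace ι] [MeasurableSingletonClass ι] [Finite ι]
    [IsProbabilityMeasure μ] (hS : S ≤ mY) {ξ : Y → ι} (hξ : Measurable ξ)
    (hθ : MeasurePreserving θ μ μ) (hθS : Measurable[S, S] θ) {k : ℕ} (hk : k ≠ 0) :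
    entropyRate S μ θ ξ ≤ codeEntropy S μ (itinerary θ ξ k) / k := by
  have := Fintype.ofFinite ι
  exact ENNReal.limsup_div_le_of_subadditive
    (a := fun n => codeEntropy S μ (itinerary θ ξ n))
    (fun m n => codeEntropy_itinerary_add_le_add hS hξ hθ hθS m n)
    (fun n => ne_top_of_le_ne_top ENNReal.ofReal_ne_top (codeEntropy_le_log_card _)) hk

/-- A countable partition of finite entropy is approximated by finite ones. -/
theorem exists_codeEntropyGiven_min_le [IsFiniteMeasure μ] (hS : S ≤ mY) {ξ : Y → ℕ}
    (hξ : Measurable ξ) (hfin : codeEntropy S μ ξ < ∞) {ε : ℝ≥0∞} (hε : ε ≠ 0) :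
    ∃ N : ℕ, codeEntropyGiven S μ
      (fun y => (⟨min (ξ y) N, Nat.lt_succ_of_le (min_le_right _ _)⟩ : Fin (N + 1))) ξ ≤ ε := by
  obtain ⟨g, hg, hgfin⟩ := exists_lintegral_lt_of_codeEntropy_lt hfin
  have hm := measurable_neglog_apply hS hg.measurable hξ
  have hs : Tendsto (fun N : ℕ => μ {y | N ≤ ξ y}) atTop (𝓝 0) := by
    have hI : ⋂ N : ℕ, {y | N ≤ ξ y} = ∅ := by
      ext y
      simp only [mem_iInter, mem_ofPred_eq, mem_empty_iff_false, iff_false, not_forall, not_le]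
      exact ⟨ξ y + 1, Nat.lt_succ_self _⟩
    have := tendsto_measure_iInter_atTop (μ := μ) (s := fun N : ℕ => {y | N ≤ ξ y})
      (fun N => (measurableSet_le measurable_const hξ).nullMeasurableSet)
      (fun a b hab y (hy : b ≤ ξ y) => hab.trans hy) ⟨0, measure_ne_top _ _⟩
    rwa [hI, measure_empty] at this
  have h0 := tendsto_setLIntegral_zero hgfin.ne hs
  obtain ⟨N, hN⟩ := (h0.eventually_le_const (pos_iff_ne_zero.2 hε)).exists
  refine ⟨N, ?_⟩
  -- Below `N` the truncation reveals the letter, which costs nothing; at `N` the code `g` is used.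
  -- The cost is the integral of a finite code length over the small set where `N ≤ ξ`.
  let k : Fin (N + 1) → ℕ → Y → ℝ≥0∞ := fun b i y => if (b : ℕ) < N then (if i = b then 1 else 0)
    else g i y
  have hk : ∀ b, IsSubProb S (k b) := by
    intro b
    by_cases hb : (b : ℕ) < N
    · refine ⟨fun i => ?_, fun y => ?_⟩
      · simp only [k, hb, if_true]
        exact measurable_const
      · simp [k, hb]
    · simpa [k, hb] using hg
  refine (codeEntropyGiven_le hk).trans (le_trans ?_ hN)
  rw [← lintegral_indicator (measurableSet_le measurable_const hξ)]
  refine lintegral_mono fun y => ?_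
  by_cases hy : N ≤ ξ y
  · simp [k, hy]
  · have hy' : ξ y < N := not_le.1 hy
    simp [k, hy'.le, hy']

/-- The cost of a code with weight at least `a` off an exceptional set `B` and at least `b` on it.
Codes are mixed with a small uniform weight so that `b` is positive. -/
theorem lintegral_neglog_le_add {f : Y → ℝ≥0∞} {B : Set Y} (hB : MeasurableSet B) {a b : ℝ≥0∞}
    (h1 : ∀ y ∉ B, a ≤ f y) (h2 : ∀ y ∈ B, b ≤ f y) :
    ∫⁻ y, neglog (f y) ∂μ ≤ neglog a * μ univ + neglog b * μ B := by
  have : ∀ y, neglog (f y) ≤ neglog a + B.indicator (fun _ => neglog b) y := fun y => by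
    by_cases hy : y ∈ B
    · simpa [hy] using (neglog_antitone (h2 y hy)).trans le_add_self
    · simpa [hy] using neglog_antitone (h1 y hy)
  refine (lintegral_mono this).trans (le_of_eq ?_)
  rw [lintegral_add_left measurable_const, lintegral_const, lintegral_indicator_const hB]

theorem exists_neglog_one_sub_le {η : ℝ≥0∞} (hη : η ≠ 0) :
    ∃ ε : ℝ≥0∞, ε ≠ 0 ∧ ε < 1 ∧ neglog (1 - ε) ≤ η := by
  have h : Tendsto (fun t : ℝ => ENNReal.ofReal (-Real.log (1 - t))) (𝓝[>] 0) (𝓝 0) := by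
    have : ContinuousAt (fun t : ℝ => ENNReal.ofReal (-Real.log (1 - t))) 0 := by
      refine ENNReal.continuous_ofReal.continuousAt.comp (ContinuousAt.neg (ContinuousAt.log ?_ ?_))
      · fun_prop
      · simp
    have h := this.tendsto
    simp only [sub_zero, Real.log_one, neg_zero, ENNReal.ofReal_zero] at h
    exact h.mono_left nhdsWithin_le_nhds
  have h1 : ∀ᶠ t : ℝ in 𝓝[>] 0, t ∈ Ioo (0 : ℝ) 1 := Ioo_mem_nhdsGT one_pos
  obtain ⟨t, ht, ht0, ht1⟩ := ((h.eventually_le_const (pos_iff_ne_zero.2 hη)).and h1).exists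
  refine ⟨ENNReal.ofReal t, by simpa using ht0, ENNReal.ofReal_lt_one.2 ht1, ?_⟩
  have e : 1 - ENNReal.ofReal t = ENNReal.ofReal (1 - t) := by
    rw [ENNReal.ofReal_sub _ ht0.le, ENNReal.ofReal_one]
  rw [e, neglog_of_ne_zero (by simpa using ht1), ENNReal.toReal_ofReal (by linarith)]
  exact ht

/-- The sets of points `y` lying in an `S`-measurable set depending on `γ (p y)`, where `γ` is
finite-valued. -/
def finiteFiberSets {X : Type*} [MeasurableSpace X] (S : MeasurableSpace Y) (p : Y → X) :
    Set (Set Y) :=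
  {C | ∃ (r : ℕ) (γ : X → Fin r), Measurable γ ∧ ∃ E : Fin r → Set Y,
    (∀ b, MeasurableSet[S] (E b)) ∧ C = {y | y ∈ E (γ (p y))}}

theorem isSetAlgebra_finiteFiberSets {X : Type*} [MeasurableSpace X] (p : Y → X) :
    IsSetAlgebra (finiteFiberSets S p) where
  empty_mem := ⟨1, fun _ => 0, measurable_const, fun _ => ∅, fun _ => .empty, by simp⟩
  compl_mem := by
    rintro _ ⟨r, γ, hγ, E, hE, rfl⟩
    exact ⟨r, γ, hγ, fun b => (E b)ᶜ, fun b => (hE b).compl, rfl⟩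
  union_mem := by
    rintro _ _ ⟨r, γ, hγ, E, hE, rfl⟩ ⟨r', γ', hγ', E', hE', rfl⟩
    refine ⟨r * r', fun x => finProdFinEquiv (γ x, γ' x),
      (measurable_of_countable finProdFinEquiv).comp (hγ.prodMk hγ'),
      fun b => E (finProdFinEquiv.symm b).1 ∪ E' (finProdFinEquiv.symm b).2,
      fun b => (hE _).union (hE' _), ?_⟩
    ext y
    simp

/-- A finite partition is approximated by finite partitions in the direction of `p`, if `S` and `p`
generate the σ-algebra. -/
theorem exists_codeEntropyGiven_comp_le {X : Type*} [mX : MeasurableSpace X] [IsProbabilityMeasure μ]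
    (hS : S ≤ mY) {p : Y → X} (hp : Measurable p) (hgen : mY ≤ S ⊔ mX.comap p)
    [MeasurableSpace ι] [MeasurableSingletonClass ι] [Fintype ι] {ξ : Y → ι} (hξ : Measurable ξ)
    {η : ℝ≥0∞} (hη : η ≠ 0) :
    ∃ (r : ℕ) (γ : X → Fin r), Measurable γ ∧ codeEntropyGiven S μ (fun y => γ (p y)) ξ ≤ η := by
  have hgen' : mY = MeasurableSpace.generateFrom (finiteFiberSets S p) := by
    refine le_antisymm (hgen.trans (sup_le ?_ ?_)) (MeasurableSpace.generateFrom_le ?_)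
    · intro A hA
      exact MeasurableSpace.measurableSet_generateFrom
        ⟨1, fun _ => 0, measurable_const, fun _ => A, fun _ => hA, rfl⟩
    · rintro _ ⟨B, hB, rfl⟩
      classical
      refine MeasurableSpace.measurableSet_generateFrom
        ⟨2, fun x => if x ∈ B then 1 else 0, Measurable.ite hB measurable_const measurable_const,
          fun b => if b = 1 then univ else ∅, fun b => ?_, ?_⟩
      · dsimp only
        split_ifs
        · exact .univ
        · exact @MeasurableSet.empty _ S
      · ext y
        by_cases h : p y ∈ B <;> simp [h]
    · rintro _ ⟨r, γ, hγ, E, hE, rfl⟩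
      have : {y | y ∈ E (γ (p y))} = ⋃ b, (fun y => γ (p y)) ⁻¹' {b} ∩ E b := by
        ext y
        simp
      rw [this]
      exact .iUnion fun b => ((hγ.comp hp) (measurableSet_singleton b)).inter (hS _ (hE b))
  have hdense := Measure.MeasureDense.of_generateFrom_isSetAlgebra_finite μ
    (isSetAlgebra_finiteFiberSets (S := S) p) hgen'
  have hη2 : η / 2 ≠ 0 := by simpa using hη
  obtain ⟨ε, hε0, hε1, hε⟩ := exists_neglog_one_sub_le hη2
  have : Nonempty ι := by
    obtain ⟨y⟩ := nonempty_of_isProbabilityMeasure μ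
    exact ⟨ξ y⟩
  let n : ℝ≥0∞ := Fintype.card ι
  have hn0 : n ≠ 0 := by simp [n]
  have hnt : n ≠ ∞ := by simp [n]
  have hεn : ε / n ≠ 0 := by simp [ENNReal.div_eq_zero_iff, hε0, hnt]
  -- The exceptional set will have measure at most `δ * n`, where the code length is at most `neglog
  -- (ε / n)`; `δ` makes this contribution at most `η / 2`.
  obtain ⟨δ, hδ0, hδ⟩ := ENNReal.exists_nnreal_pos_mul_lt
    (ENNReal.mul_ne_top (neglog_ne_top hεn) hnt) hη2
  have hC : ∀ i, ∃ t ∈ finiteFiberSets S p, μ (symmDiff (ξ ⁻¹' {i}) t) < δ := fun i => by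
    obtain ⟨t, ht, h⟩ := hdense.approx (ξ ⁻¹' {i}) (hξ (measurableSet_singleton i))
      (measure_ne_top _ _) δ (by exact_mod_cast hδ0)
    exact ⟨t, ht, by simpa using h⟩
  choose C hCm hCμ using hC
  have hCmeas : ∀ i, MeasurableSet (C i) := fun i => hdense.measurable _ (hCm i)
  choose r γ hγ E hE hCE using hCm
  classical
  let K := ∀ i, Fin (r i)
  let e : K ≃ Fin (Fintype.card K) := Fintype.equivFin K
  -- Given the letters `b`, this is the set where `i` is the only index proposed by the
  -- approximating sets. It is disjoint from the sets for other indices, so the guess below is a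
  -- sub-probability.
  let G : K → ι → Set Y := fun b i => E i (b i) ∩ ⋂ j, if j = i then univ else (E j (b j))ᶜ
  have hG : ∀ b i, MeasurableSet[S] (G b i) := fun b i => by
    refine @MeasurableSet.inter _ S _ _ (hE i _) (@MeasurableSet.iInter _ _ S _ _ fun j => ?_)
    split_ifs
    · exact .univ
    · exact @MeasurableSet.compl _ _ S (hE j _)
  -- A confident guess mixed with the uniform distribution of total weight `ε`: right guesses cost
  -- `neglog (1 - ε)`, wrong ones a finite amount.
  let k : Fin (Fintype.card K) → ι → Y → ℝ≥0∞ := fun b i y =>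
    (1 - ε) * (G (e.symm b) i).indicator (fun _ => 1) y + ε / n
  have hk : ∀ b, IsSubProb S (k b) := by
    intro b
    refine ⟨fun i => ((measurable_const.indicator (hG _ i)).const_mul _).add_const _, fun y => ?_⟩
    have h1 : ∑ i, (G (e.symm b) i).indicator (fun _ => (1 : ℝ≥0∞)) y ≤ 1 := by
      by_cases h : ∃ i, y ∈ G (e.symm b) i
      · obtain ⟨i, hi⟩ := h
        rw [Finset.sum_eq_single i]
        · exact indicator_le_self' (by simp) y
        · intro j _ hji
          refine indicator_of_notMem (fun hj => ?_) _
          have := mem_iInter.1 hi.2 j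
          rw [if_neg hji] at this
          exact this hj.1
        · simp
      · push Not at h
        simp [h]
    rw [tsum_fintype, Finset.sum_add_distrib, ← Finset.mul_sum, Finset.sum_const, Finset.card_univ,
      nsmul_eq_mul]
    change (1 - ε) * _ + n * (ε / n) ≤ 1
    rw [ENNReal.mul_div_cancel hn0 hnt]
    calc _ ≤ (1 - ε) * 1 + ε := by gcongr
      _ = 1 := by rw [mul_one, tsub_add_cancel_of_le hε1.le]
  refine ⟨Fintype.card K, fun x => e fun i => γ i x,
    (measurable_of_countable e).comp (measurable_pi_lambda _ hγ), ?_⟩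
  refine (codeEntropyGiven_le hk).trans ?_
  let B : Set Y := ⋃ i, symmDiff (ξ ⁻¹' {i}) (C i)
  have hB : MeasurableSet B := .iUnion fun i =>
    (hξ (measurableSet_singleton i)).symmDiff (hCmeas i)
  have hμB : μ B ≤ δ * n := by
    refine (measure_iUnion_le _).trans ?_
    rw [tsum_fintype]
    refine (Finset.sum_le_card_nsmul _ _ (δ : ℝ≥0∞) fun i _ => (hCμ i).le).trans (le_of_eq ?_)
    rw [Finset.card_univ, nsmul_eq_mul, mul_comm]
  refine (lintegral_neglog_le_add (a := 1 - ε) (b := ε / n) hB (fun y hy => ?_)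
    fun y _ => le_add_self).trans ?_
  · have hy' : ∀ i, y ∈ C i ↔ ξ y = i := fun i => by
      have h := fun h => hy (mem_iUnion.2 ⟨i, h⟩)
      rw [mem_symmDiff] at h
      simp only [mem_preimage, mem_singleton_iff] at h
      tauto
    have hyG : y ∈ G (fun i => γ i (p y)) (ξ y) := by
      have hyE : ∀ i, y ∈ E i (γ i (p y)) ↔ ξ y = i := fun i => by
        rw [← hy' i, hCE i]; rfl
      refine ⟨(hyE _).2 rfl, mem_iInter.2 fun j => ?_⟩
      split_ifs with hj
      · trivial
      · exact fun h => hj ((hyE j).1 h).symm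
    simp only [Equiv.symm_apply_apply, indicator_of_mem hyG, mul_one]
    exact le_self_add
  · rw [measure_univ, mul_one]
    calc _ ≤ η / 2 + neglog (ε / n) * (δ * n) := by gcongr
      _ = η / 2 + δ * (neglog (ε / n) * n) := by ring
      _ ≤ η / 2 + η / 2 := by gcongr
      _ = η := ENNReal.add_halves η

/-- The entropy rate of a countable partition of finite entropy is at most the supremum of the
entropy rates of finite partitions in the direction of `p`. -/
theorem entropyRate_le_of_forall_finite {X : Type*} [mX : MeasurableSpace X]
    [IsProbabilityMeasure μ] (hS : S ≤ mY) {p : Y → X} (hp : Measurable p)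
    (hgen : mY ≤ S ⊔ mX.comap p) (hθ : MeasurePreserving θ μ μ) (hθS : Measurable[S, S] θ)
    {ξ : Y → ℕ} (hξ : Measurable ξ) (hfin : codeEntropy S μ ξ < ∞) {c : ℝ≥0∞}
    (hc : ∀ (r : ℕ) (γ : X → Fin r), Measurable γ → entropyRate S μ θ (fun y => γ (p y)) ≤ c) :
    entropyRate S μ θ ξ ≤ c := by
  refine ENNReal.le_of_forall_pos_le_add fun ε hε _ => ?_
  have hε2 : (ε : ℝ≥0∞) / 2 ≠ 0 := by simpa using hε.ne'
  -- Two approximations cost `ε / 2` each: truncation to finitely many letters, then replacement by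
  -- a finite partition of `X` seen through `p`.
  obtain ⟨N, hN⟩ := exists_codeEntropyGiven_min_le hS hξ hfin hε2
  have hmin : Measurable fun y => (⟨min (ξ y) N, Nat.lt_succ_of_le (min_le_right _ _)⟩ :
      Fin (N + 1)) :=
    (measurable_of_countable fun k : ℕ => (⟨min k N, Nat.lt_succ_of_le (min_le_right _ _)⟩ :
      Fin (N + 1))).comp hξ
  obtain ⟨r, γ, hγ, hr⟩ := exists_codeEntropyGiven_comp_le (μ := μ) hS hp hgen hmin hε2
  calc _ ≤ _ := entropyRate_le_add_given hS hmin hξ hθ hθS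
    _ ≤ (entropyRate S μ θ (fun y => γ (p y)) + ε / 2) + ε / 2 := by
      gcongr
      exact (entropyRate_le_add_given hS (hγ.comp hp) hmin hθ hθS).trans
        (add_le_add le_rfl hr)
    _ ≤ c + ε := by
      rw [add_assoc, ENNReal.add_halves]
      gcongr
      exact hc r γ hγ

end EntropyRate

end

/-! ### Partitions as functions, and the σ-algebras of the fibered square. -/

noncomputable section

namespace BundleRDS

section Basic

variable {Ω : Type*} [MeasurableSpace Ω] {P : Measure Ω} {ϑ : Ω → Ω}
  {X : Type*} [TopologicalSpace X] [MeasurableSpace X]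

/-- The projection of the bundle to the base. -/
def base (T : BundleRDS P ϑ X) (p : T.Total) : Ω := p.1.1

theorem measurable_base (T : BundleRDS P ϑ X) : Measurable T.base :=
  measurable_fst.comp measurable_subtype_coe

theorem measurable_skew (T : BundleRDS P ϑ X) (hϑ : Measurable ϑ) : Measurable T.skew :=
  Measurable.subtype_mk ((hϑ.comp T.measurable_base).prodMk T.measurable_map)

theorem base_skew (T : BundleRDS P ϑ X) (p : T.Total) : T.base (T.skew p) = ϑ (T.base p) := rfl

theorem base_iterate_skew (T : BundleRDS P ϑ X) (n : ℕ) (p : T.Total) :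
    T.base (T.skew^[n] p) = ϑ^[n] (T.base p) := by
  induction n generalizing p with
  | zero => rfl
  | succ n ih => rw [Function.iterate_succ_apply, ih, base_skew, Function.iterate_succ_apply]

/-- The index of the member of a partition containing a point. -/
def Partition.index {T : BundleRDS P ϑ X} (R : T.Partition) (p : T.Total) : ℕ :=
  (mem_iUnion.1 (R.iUnion_eq ▸ mem_univ p : p ∈ ⋃ i, R.set i)).choose

theorem Partition.preimage_index {T : BundleRDS P ϑ X} (R : T.Partition) (i : ℕ) :
    R.index ⁻¹' {i} = R.set i := by
  ext p
  have h : p ∈ R.set (R.index p) :=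
    (mem_iUnion.1 (R.iUnion_eq ▸ mem_univ p : p ∈ ⋃ i, R.set i)).choose_spec
  constructor
  · rintro rfl
    exact h
  · intro hp
    by_contra hne
    exact disjoint_left.1 (R.disjoint hne) h hp

theorem Partition.measurable_index {T : BundleRDS P ϑ X} (R : T.Partition) :
    Measurable R.index :=
  measurable_to_countable' fun i => R.preimage_index i ▸ R.measurableSet i

/-- The partition into the level sets of a function. -/
def Partition.ofMeasurable {T : BundleRDS P ϑ X} (ξ : T.Total → ℕ) (hξ : Measurable ξ) :
    T.Partition where
  set i := ξ ⁻¹' {i}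
  measurableSet i := hξ (measurableSet_singleton i)
  disjoint i j hij := Disjoint.preimage _ (by simpa using hij)
  iUnion_eq := by rw [← preimage_iUnion, iUnion_of_singleton, preimage_univ]

theorem refine_preimage_singleton {ι : Type*} (T : BundleRDS P ϑ X) (ξ : T.Total → ι) (n : ℕ) :
    T.refine (fun i => ξ ⁻¹' {i}) n = fun a => itinerary T.skew ξ n ⁻¹' {a} := by
  funext a
  ext p
  simp [refine, itinerary, funext_iff]

theorem condEntropy_refine (T : BundleRDS P ϑ X) (hϑ : Measurable ϑ) {R : ℕ → Set T.Total}
    {ξ : T.Total → ℕ} (hξ : Measurable ξ) (hR : R = fun i => ξ ⁻¹' {i})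
    (ν : Measure T.Total) [IsFiniteMeasure ν] {S : MeasurableSpace T.Total}
    (hS : S ≤ Subtype.instMeasurableSpace) (n : ℕ) :
    condEntropy S ν (T.refine R n) = codeEntropy S ν (itinerary T.skew ξ n) := by
  rw [hR, refine_preimage_singleton]
  exact condEntropy_eq_codeEntropy hS (measurable_itinerary (T.measurable_skew hϑ) hξ _)

theorem partitionEntropy_ofMeasurable (T : BundleRDS P ϑ X) (hϑ : Measurable ϑ)
    {R : T.Partition} {ξ : T.Total → ℕ} (hξ : Measurable ξ) (hR : R.set = fun i => ξ ⁻¹' {i})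
    (μ : T.InvMeasure) {S : MeasurableSpace T.Total} (hS : S ≤ Subtype.instMeasurableSpace) :
    T.partitionEntropy S μ R = entropyRate S μ.1 T.skew ξ := by
  have := μ.2.1
  refine limsup_congr (Eventually.of_forall fun n => ?_)
  exact congrArg (· / (n : ℝ≥0∞)) (T.condEntropy_refine hϑ hξ hR μ.1 hS n)

theorem relEntropy_le (T : BundleRDS P ϑ X) (hϑ : Measurable ϑ)
    {S : MeasurableSpace T.Total} (hS : S ≤ Subtype.instMeasurableSpace) (μ : T.InvMeasure)
    {c : ℝ≥0∞} (h : ∀ ξ : T.Total → ℕ, Measurable[Subtype.instMeasurableSpace] ξ →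
      codeEntropy S μ.1 ξ < ∞ → entropyRate S μ.1 T.skew ξ ≤ c) : T.relEntropy S μ ≤ c := by
  have := μ.2.1
  refine iSup₂_le fun R hR => ?_
  have e : R.set = fun i => R.index ⁻¹' {i} := funext fun i => (R.preimage_index i).symm
  rw [T.partitionEntropy_ofMeasurable hϑ R.measurable_index e μ hS]
  refine h _ R.measurable_index ?_
  rw [e] at hR
  exact (condEntropy_eq_codeEntropy hS R.measurable_index).symm.trans_lt hR

theorem entropyRate_le_relEntropy (T : BundleRDS P ϑ X) (hϑ : Measurable ϑ)
    {ι : Type*} [Finite ι] [MeasurableSpace ι] [MeasurableSingletonClass ι]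
    {ξ : T.Total → ι} (hξ : Measurable ξ)
    {S : MeasurableSpace T.Total} (hS : S ≤ Subtype.instMeasurableSpace) (μ : T.InvMeasure) :
    entropyRate S μ.1 T.skew ξ ≤ T.relEntropy S μ := by
  have := μ.2.1
  have := Fintype.ofFinite ι
  let e := Fintype.equivFin ι
  let ξ' : T.Total → ℕ := fun p => (e (ξ p) : ℕ)
  have hξ' : Measurable[Subtype.instMeasurableSpace] ξ' :=
    (measurable_of_countable fun i => (e i : ℕ)).comp hξ
  have h1 : codeEntropy S μ.1 ξ' < ∞ :=
    (codeEntropy_comp_le (fun i => (e i : ℕ)) ξ).trans_lt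
      ((codeEntropy_le_log_card ξ).trans_lt ENNReal.ofReal_lt_top)
  have h2 : codeEntropy S μ.1 ξ' = condEntropy S μ.1 (Partition.ofMeasurable ξ' hξ').set :=
    (condEntropy_eq_codeEntropy hS hξ').symm
  refine le_trans ?_ (le_iSup₂_of_le (Partition.ofMeasurable ξ' hξ') (h2 ▸ h1) le_rfl)
  rw [T.partitionEntropy_ofMeasurable hϑ hξ' rfl μ hS]
  refine limsup_le_limsup (Eventually.of_forall fun n => ?_)
  dsimp only
  gcongr
  -- The inverse of the enumeration, used to recover `ξ` from `ξ'`, requires a letter to exist.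
  rcases isEmpty_or_nonempty ι with hι | hι
  · have : IsEmpty T.Total := ⟨fun p => hι.elim (ξ p)⟩
    have h0 := nonempty_of_isProbabilityMeasure μ.1
    exact absurd h0 (not_nonempty_iff.2 this)
  have : itinerary T.skew ξ n = fun p => (fun (a : Fin n → ℕ) i =>
      Function.invFun (fun i => (e i : ℕ)) (a i)) (itinerary T.skew ξ' n p) := by
    funext p i
    exact (Function.leftInverse_invFun (Fin.val_injective.comp e.injective) _).symm
  rw [this]
  exact codeEntropy_comp_le (fun (a : Fin n → ℕ) i => Function.invFun (fun i => (e i : ℕ)) (a i)) _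

/-! #### The fibered square -/

/-- The first projection of the fibered square. -/
def sqFst (T : BundleRDS P ϑ X) (p : T.square.Total) : T.Total := ⟨(p.1.1, p.1.2.1), p.2.1⟩

/-- The second point of an element of the fibered square. -/
def sqSnd (T : BundleRDS P ϑ X) (p : T.square.Total) : X := p.1.2.2

theorem measurable_sqFst (T : BundleRDS P ϑ X) : Measurable T.sqFst :=
  Measurable.subtype_mk (by fun_prop)

theorem measurable_sqSnd (T : BundleRDS P ϑ X) : Measurable T.sqSnd :=
  measurable_snd.comp (measurable_snd.comp measurable_subtype_coe)

theorem firstCoordSigma_eq (T : BundleRDS P ϑ X) :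
    T.firstCoordSigma = MeasurableSpace.comap T.sqFst inferInstance := by
  rw [firstCoordSigma]
  exact (MeasurableSpace.comap_comp (f := Subtype.val) (g := T.sqFst)).symm

theorem firstCoordSigma_le (T : BundleRDS P ϑ X) :
    T.firstCoordSigma ≤ Subtype.instMeasurableSpace :=
  T.firstCoordSigma_eq ▸ T.measurable_sqFst.comap_le

theorem measurable_skew_firstCoordSigma (T : BundleRDS P ϑ X) (hϑ : Measurable ϑ) :
    Measurable[T.firstCoordSigma, T.firstCoordSigma] T.square.skew := by
  rw [T.firstCoordSigma_eq]
  rintro _ ⟨A, hA, rfl⟩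
  exact ⟨T.skew ⁻¹' A, T.measurable_skew hϑ hA, rfl⟩

theorem measurable_firstCoordSigma_comp (T : BundleRDS P ϑ X) {Z : Type*} [MeasurableSpace Z]
    {f : T.Total → Z} (hf : Measurable f) :
    Measurable[T.firstCoordSigma] fun p => f (T.sqFst p) := by
  rw [T.firstCoordSigma_eq]
  exact hf.comp (comap_measurable _)

/-- The first pair of coordinates and the second point determine a point of the square; this is the
generation hypothesis of `entropyRate_le_of_forall_finite`. -/
theorem le_firstCoordSigma_sup (T : BundleRDS P ϑ X) :
    (Subtype.instMeasurableSpace : MeasurableSpace T.square.Total) ≤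
      T.firstCoordSigma ⊔ MeasurableSpace.comap T.sqSnd inferInstance := by
  have h1 : Measurable[T.firstCoordSigma ⊔ MeasurableSpace.comap T.sqSnd inferInstance]
      (fun p : T.square.Total => (p.1.1, p.1.2.1)) :=
    (comap_measurable _).mono le_sup_left le_rfl
  have h2 : Measurable[T.firstCoordSigma ⊔ MeasurableSpace.comap T.sqSnd inferInstance] T.sqSnd :=
    (comap_measurable _).mono le_sup_right le_rfl
  have h3 : Measurable[T.firstCoordSigma ⊔ MeasurableSpace.comap T.sqSnd inferInstance]
      (Subtype.val : T.square.Total → Ω × X × X) :=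
    (measurable_fst.comp h1).prodMk ((measurable_snd.comp h1).prodMk h2)
  exact h3.comap_le

/-- Relative to the first point, only finite partitions of `X` applied to the second point need to
be tested. Both halves of the argument handle no other partitions afterwards. -/
theorem relEntropy_square_le (T : BundleRDS P ϑ X) (hϑ : Measurable ϑ) (μ : T.square.InvMeasure)
    {c : ℝ≥0∞} (hc : ∀ (r : ℕ) (γ : X → Fin r), Measurable γ →
      entropyRate T.firstCoordSigma μ.1 T.square.skew (fun p => γ (T.sqSnd p)) ≤ c) :
    T.square.relEntropy T.firstCoordSigma μ ≤ c := by
  have := μ.2.1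
  refine T.square.relEntropy_le hϑ T.firstCoordSigma_le μ fun ξ hξ hfin => ?_
  exact entropyRate_le_of_forall_finite T.firstCoordSigma_le T.measurable_sqSnd
    T.le_firstCoordSigma_sup μ.2.2.2 (T.measurable_skew_firstCoordSigma hϑ) hξ hfin hc

end Basic

end BundleRDS

end

/-! ### Covering numbers: submultiplicativity, measurability, tail entropy. -/

noncomputable section

namespace BundleRDS

section Cover

variable {Ω : Type*} [MeasurableSpace Ω] {P : Measure Ω} {ϑ : Ω → Ω}
  {X : Type*} [TopologicalSpace X] [MeasurableSpace X]

/-- The sections at `ω` of the members of `R` with index in `s` cover the section of `A`. -/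
def Covers (T : BundleRDS P ϑ X) {ι : Type*} (A : Set T.Total) (R : ι → Set T.Total)
    (s : Finset ι) (ω : Ω) : Prop :=
  T.incl ω ⁻¹' A ⊆ ⋃ i ∈ s, T.incl ω ⁻¹' R i

/-- The bound `1 ≤ k` is due to the value `1` assigned to empty sections, which an empty family
would cover. -/
theorem coverNum_le (T : BundleRDS P ϑ X) {ι : Type*} {A : Set T.Total} {R : ι → Set T.Total}
    {ω : Ω} {s : Finset ι} (hs : T.Covers A R s ω) {k : ℕ} (hk : 1 ≤ k) (hsk : s.card ≤ k) :
    T.coverNum A R ω ≤ k := by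
  unfold coverNum
  split_ifs with h
  · exact hk
  · refine (Nat.sInf_le ?_).trans hsk
    exact ⟨s, rfl, hs⟩

theorem exists_covers_card_eq (T : BundleRDS P ϑ X) {ι : Type*} [Fintype ι] (A : Set T.Total)
    {R : ι → Set T.Total} (hR : ⋃ i, R i = univ) {ω : Ω} (hA : (T.incl ω ⁻¹' A).Nonempty) :
    ∃ s : Finset ι, T.Covers A R s ω ∧ s.card = T.coverNum A R ω := by
  unfold coverNum
  rw [if_neg hA.ne_empty]
  have hne : {k | ∃ s : Finset ι, s.card = k ∧
      T.incl ω ⁻¹' A ⊆ ⋃ i ∈ s, T.incl ω ⁻¹' R i}.Nonempty := by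
    refine ⟨_, Finset.univ, rfl, fun x _ => ?_⟩
    have : T.incl ω x ∈ ⋃ i, R i := hR ▸ mem_univ _
    simpa using this
  obtain ⟨s, hs, hcov⟩ := Nat.sInf_mem hne
  exact ⟨s, hcov, hs⟩

theorem exists_covers (T : BundleRDS P ϑ X) {ι : Type*} [Fintype ι] (A : Set T.Total)
    {R : ι → Set T.Total} (hR : ⋃ i, R i = univ) (ω : Ω) :
    ∃ s : Finset ι, T.Covers A R s ω ∧ s.card ≤ T.coverNum A R ω := by
  by_cases hA : (T.incl ω ⁻¹' A).Nonempty
  · obtain ⟨s, h1, h2⟩ := T.exists_covers_card_eq A hR hA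
    exact ⟨s, h1, h2.le⟩
  · refine ⟨∅, ?_, by simp⟩
    rw [Covers, not_nonempty_iff_eq_empty.1 hA]
    exact empty_subset _

theorem one_le_coverNum (T : BundleRDS P ϑ X) {ι : Type*} [Fintype ι] (A : Set T.Total)
    {R : ι → Set T.Total} (hR : ⋃ i, R i = univ) (ω : Ω) : 1 ≤ T.coverNum A R ω := by
  by_cases hA : (T.incl ω ⁻¹' A).Nonempty
  · obtain ⟨s, h1, h2⟩ := T.exists_covers_card_eq A hR hA
    rw [← h2, Nat.one_le_iff_ne_zero, Finset.card_ne_zero]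
    obtain ⟨x, hx⟩ := hA
    obtain ⟨i, hi, -⟩ := mem_iUnion₂.1 (h1 hx)
    exact ⟨i, hi⟩
  · unfold coverNum
    rw [if_pos (not_nonempty_iff_eq_empty.1 hA)]

theorem condCoverNum_le (T : BundleRDS P ϑ X) {ι κ : Type*} [Fintype κ]
    {R : ι → Set T.Total} {Q : κ → Set T.Total} {ω : Ω} {k : ℕ} (hk : 1 ≤ k)
    (h : ∀ j, ∃ s : Finset ι, T.Covers (Q j) R s ω ∧ s.card ≤ k) :
    T.condCoverNum R Q ω ≤ k :=
  Finset.sup_le fun j _ => (h j).elim fun _ hs => T.coverNum_le hs.1 hk hs.2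

theorem exists_covers_card_le_condCoverNum (T : BundleRDS P ϑ X) {ι κ : Type*} [Fintype ι]
    [Fintype κ] {R : ι → Set T.Total} (hR : ⋃ i, R i = univ) (Q : κ → Set T.Total) (ω : Ω) (j : κ) :
    ∃ s : Finset ι, T.Covers (Q j) R s ω ∧ s.card ≤ T.condCoverNum R Q ω := by
  obtain ⟨s, h1, h2⟩ := T.exists_covers (Q j) hR ω
  exact ⟨s, h1, h2.trans (Finset.le_sup (f := fun j => T.coverNum (Q j) R ω) (Finset.mem_univ j))⟩

theorem one_le_condCoverNum (T : BundleRDS P ϑ X) {ι κ : Type*} [Fintype ι] [Fintype κ]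
    [Nonempty κ] {R : ι → Set T.Total} (hR : ⋃ i, R i = univ) (Q : κ → Set T.Total) (ω : Ω) :
    1 ≤ T.condCoverNum R Q ω :=
  (T.one_le_coverNum (Q (Classical.arbitrary κ)) hR ω).trans
    (Finset.le_sup (f := fun j => T.coverNum (Q j) R ω) (Finset.mem_univ _))

/-- Cover a member of `Q'` by members of `Q`, and each of these by members of `R`. -/
theorem condCoverNum_le_mul (T : BundleRDS P ϑ X) {ι κ κ' : Type*} [Fintype ι] [Fintype κ]
    [Fintype κ'] [Nonempty κ] [Nonempty κ'] {R : ι → Set T.Total} (hR : ⋃ i, R i = univ)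
    {Q : κ → Set T.Total} (hQ : ⋃ i, Q i = univ) (Q' : κ' → Set T.Total) (ω : Ω) :
    T.condCoverNum R Q' ω ≤ T.condCoverNum R Q ω * T.condCoverNum Q Q' ω := by
  classical
  refine T.condCoverNum_le (one_le_mul (T.one_le_condCoverNum hR Q ω)
    (T.one_le_condCoverNum hQ Q' ω)) fun j => ?_
  obtain ⟨s, hs, hsc⟩ := T.exists_covers_card_le_condCoverNum hQ Q' ω j
  choose t ht htc using T.exists_covers_card_le_condCoverNum hR Q ω
  refine ⟨s.biUnion t, fun x hx => ?_, ?_⟩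
  · obtain ⟨i, hi, hxi⟩ := mem_iUnion₂.1 (hs hx)
    obtain ⟨l, hl, hxl⟩ := mem_iUnion₂.1 (ht i hxi)
    exact mem_iUnion₂.2 ⟨l, Finset.mem_biUnion.2 ⟨i, hi, hl⟩, hxl⟩
  · calc (s.biUnion t).card ≤ s.card * T.condCoverNum R Q ω :=
        Finset.card_biUnion_le_card_mul _ _ _ fun i _ => htc i
      _ ≤ _ := by rw [mul_comm]; exact Nat.mul_le_mul_left _ hsc

theorem iUnion_refine (T : BundleRDS P ϑ X) {ι : Type*} {R : ι → Set T.Total}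
    (hR : ⋃ i, R i = univ) (n : ℕ) : ⋃ a, T.refine R n a = univ := by
  refine eq_univ_of_forall fun p => ?_
  have h : ∀ q, ∃ i, q ∈ R i := fun q => mem_iUnion.1 (hR ▸ mem_univ q)
  choose f hf using h
  exact mem_iUnion.2 ⟨fun i => f (T.skew^[i] p), mem_iInter.2 fun i => hf _⟩

/-- At each time `i` choose a subfamily of `R` over `ϑ^i ω` covering the `i`-th letter of the
`Q`-word; the product of the subfamilies covers the word. -/
theorem condCoverNum_refine_le (T : BundleRDS P ϑ X) {ι κ : Type*} [Fintype ι] [Fintype κ]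
    [Nonempty κ] {R : ι → Set T.Total} (hR : ⋃ i, R i = univ) (Q : κ → Set T.Total) (n : ℕ)
    (ω : Ω) : T.condCoverNum (T.refine R n) (T.refine Q n) ω ≤
      ∏ i : Fin n, T.condCoverNum R Q (ϑ^[i] ω) := by
  classical
  refine T.condCoverNum_le (Finset.one_le_prod' fun i _ => T.one_le_condCoverNum hR Q _)
    fun a => ?_
  choose t ht htc using fun i : Fin n =>
    T.exists_covers_card_le_condCoverNum hR Q (ϑ^[i] ω) (a i)
  refine ⟨Fintype.piFinset t, fun x hx => ?_, ?_⟩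
  · have h : ∀ i : Fin n, ∃ l ∈ t i, T.skew^[i] (T.incl ω x) ∈ R l := fun i => by
      have hxi : T.skew^[i] (T.incl ω x) ∈ Q (a i) := mem_iInter.1 hx i
      have hb : T.base (T.skew^[i] (T.incl ω x)) = ϑ^[i] ω := T.base_iterate_skew i _
      -- The fiber containing the iterate agrees with the one over `ϑ^[i] ω` only propositionally,
      -- so the base point is generalized before substitution.
      have key : ∀ (p : T.Total) (ω' : Ω), T.base p = ω' → p ∈ Q (a i) →
          T.Covers (Q (a i)) R (t i) ω' → ∃ l ∈ t i, p ∈ R l := by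
        rintro p _ rfl hp hc
        obtain ⟨l, hl, hxl⟩ := mem_iUnion₂.1 (hc (show (⟨p.1.2, p.2⟩ : T.fiber (T.base p)) ∈
          T.incl (T.base p) ⁻¹' Q (a i) from hp))
        exact ⟨l, hl, hxl⟩
      exact key _ _ hb hxi (ht i)
    choose l hl hxl using h
    exact mem_iUnion₂.2 ⟨l, Fintype.mem_piFinset.2 hl, mem_iInter.2 hxl⟩
  · rw [Fintype.card_piFinset]
    exact Finset.prod_le_prod' fun i _ => htc i

/-- The logarithm of the conditional covering number. -/
def logCover (T : BundleRDS P ϑ X) {ι κ : Type*} [Fintype κ] (R : ι → Set T.Total)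
    (Q : κ → Set T.Total) (ω : Ω) : ℝ≥0∞ :=
  ENNReal.ofReal (Real.log (T.condCoverNum R Q ω : ℝ))

theorem logCover_le_add (T : BundleRDS P ϑ X) {ι κ κ' : Type*} [Fintype ι] [Fintype κ]
    [Fintype κ'] [Nonempty κ] [Nonempty κ'] {R : ι → Set T.Total} (hR : ⋃ i, R i = univ)
    {Q : κ → Set T.Total} (hQ : ⋃ i, Q i = univ) (Q' : κ' → Set T.Total) (ω : Ω) :
    T.logCover R Q' ω ≤ T.logCover R Q ω + T.logCover Q Q' ω := by
  have h1 := T.one_le_condCoverNum hR Q ω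
  have h2 := T.one_le_condCoverNum hQ Q' ω
  have h3 := T.one_le_condCoverNum hR Q' ω
  unfold logCover
  rw [← ENNReal.ofReal_add (Real.log_natCast_nonneg _) (Real.log_natCast_nonneg _),
    ← Real.log_mul (by positivity) (by positivity)]
  refine ENNReal.ofReal_le_ofReal (Real.log_le_log (by positivity) ?_)
  exact_mod_cast T.condCoverNum_le_mul hR hQ Q' ω

theorem logCover_refine_le (T : BundleRDS P ϑ X) {ι κ : Type*} [Fintype ι] [Fintype κ]
    [Nonempty κ] {R : ι → Set T.Total} (hR : ⋃ i, R i = univ) (Q : κ → Set T.Total) (n : ℕ)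
    (ω : Ω) : T.logCover (T.refine R n) (T.refine Q n) ω ≤
      ∑ i : Fin n, T.logCover R Q (ϑ^[i] ω) := by
  have h0 := T.one_le_condCoverNum (T.iUnion_refine hR n) (T.refine Q n) ω
  unfold logCover
  rw [← ENNReal.ofReal_sum_of_nonneg fun i _ => Real.log_natCast_nonneg _, ← Real.log_prod fun i _ => ?_]
  · refine ENNReal.ofReal_le_ofReal (Real.log_le_log (by positivity) ?_)
    exact_mod_cast T.condCoverNum_refine_le hR Q n ω
  · have := T.one_le_condCoverNum hR Q (ϑ^[i] ω)
    positivity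

section Measurability

variable [StandardBorelSpace X] [IsFiniteMeasure P] [P.IsComplete]

/-- The subfamily fails to cover exactly over the projection of `A \ ⋃ i ∈ s, R i`, which is
measurable by the projection theorem. -/
theorem measurableSet_covers (T : BundleRDS P ϑ X) {ι : Type*} [Countable ι] {A : Set T.Total}
    (hA : MeasurableSet A) {R : ι → Set T.Total} (hR : ∀ i, MeasurableSet (R i)) (s : Finset ι) :
    MeasurableSet {ω | T.Covers A R s ω} := by
  have hD : MeasurableSet (Subtype.val '' (A \ ⋃ i ∈ s, R i)) :=
    T.measurableSet_carrier.subtype_image (hA.diff (Finset.measurableSet_biUnion _ fun i _ => hR i))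
  convert (measurableSet_setOf_exists_mem P hD).compl using 1
  ext ω
  simp only [Covers, mem_ofPred_eq, mem_compl_iff, not_exists]
  constructor
  · rintro h x ⟨p, hp, hpx⟩
    have hb : T.base p = ω := congrArg Prod.fst hpx
    subst hb
    have := h (show (⟨p.1.2, p.2⟩ : T.fiber (T.base p)) ∈ T.incl (T.base p) ⁻¹' A from hp.1)
    obtain ⟨i, hi, hxi⟩ := mem_iUnion₂.1 this
    exact hp.2 (mem_iUnion₂.2 ⟨i, hi, hxi⟩)
  · intro h x hx
    by_contra hcon
    refine h x.1 ⟨T.incl ω x, ⟨hx, fun hmem => hcon ?_⟩, rfl⟩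
    obtain ⟨i, hi, hxi⟩ := mem_iUnion₂.1 hmem
    exact mem_iUnion₂.2 ⟨i, hi, hxi⟩

theorem measurable_coverNum (T : BundleRDS P ϑ X) {ι : Type*} [Fintype ι] {A : Set T.Total}
    (hA : MeasurableSet A) {R : ι → Set T.Total} (hRm : ∀ i, MeasurableSet (R i))
    (hR : ⋃ i, R i = univ) : Measurable (T.coverNum A R) := by
  refine measurable_of_Iic fun k => ?_
  have : T.coverNum A R ⁻¹' Iic k =
      ⋃ (s : Finset ι) (_ : s.card ≤ k ∧ 1 ≤ k), {ω | T.Covers A R s ω} := by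
    ext ω
    simp only [mem_preimage, mem_Iic, mem_iUnion, mem_ofPred_eq, exists_prop]
    constructor
    · intro h
      obtain ⟨s, hs, hsc⟩ := T.exists_covers A hR ω
      exact ⟨s, ⟨hsc.trans h, (T.one_le_coverNum A hR ω).trans h⟩, hs⟩
    · rintro ⟨s, ⟨h1, h2⟩, hs⟩
      exact T.coverNum_le hs h2 h1
  rw [this]
  exact .iUnion fun s => .iUnion fun _ => T.measurableSet_covers hA hRm s

theorem measurable_condCoverNum (T : BundleRDS P ϑ X) {ι κ : Type*} [Fintype ι] [Fintype κ]
    {R : ι → Set T.Total} (hRm : ∀ i, MeasurableSet (R i)) (hR : ⋃ i, R i = univ)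
    {Q : κ → Set T.Total} (hQ : ∀ i, MeasurableSet (Q i)) : Measurable (T.condCoverNum R Q) := by
  refine measurable_of_Iic fun k => ?_
  have : T.condCoverNum R Q ⁻¹' Iic k = ⋂ j, T.coverNum (Q j) R ⁻¹' Iic k := by
    ext ω
    simp [condCoverNum, Finset.sup_le_iff]
  rw [this]
  exact .iInter fun j => T.measurable_coverNum (hQ j) hRm hR measurableSet_Iic

theorem measurable_logCover (T : BundleRDS P ϑ X) {ι κ : Type*} [Fintype ι] [Fintype κ]
    {R : ι → Set T.Total} (hRm : ∀ i, MeasurableSet (R i)) (hR : ⋃ i, R i = univ)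
    {Q : κ → Set T.Total} (hQ : ∀ i, MeasurableSet (Q i)) : Measurable (T.logCover R Q) :=
  (measurable_of_countable fun n : ℕ => ENNReal.ofReal (Real.log n)).comp
    (T.measurable_condCoverNum hRm hR hQ)

end Measurability

theorem measurableSet_refine (T : BundleRDS P ϑ X) (hϑ : Measurable ϑ) {ι : Type*}
    {R : ι → Set T.Total} (hR : ∀ i, MeasurableSet (R i)) (n : ℕ) (a : Fin n → ι) :
    MeasurableSet (T.refine R n a) :=
  .iInter fun i => ((T.measurable_skew hϑ).iterate i) (hR _)

theorem RandomCover.nonempty_fin {T : BundleRDS P ϑ X} [IsProbabilityMeasure P]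
    (Q : T.RandomCover) : Nonempty (Fin Q.size) := by
  obtain ⟨ω, x, hx⟩ := T.nonempty_fiber.exists
  have : (⟨(ω, x), hx⟩ : T.Total) ∈ ⋃ i, Q.set i := Q.iUnion_eq ▸ mem_univ _
  exact ⟨(mem_iUnion.1 this).choose⟩

theorem coverTailEntropy_eq (T : BundleRDS P ϑ X) (R Q : T.RandomCover) :
    T.coverTailEntropy R Q = limsup (fun n : ℕ =>
      (∫⁻ ω, T.logCover (T.refine R.set n) (T.refine Q.set n) ω ∂P) / (n : ℝ≥0∞)) atTop := rfl

section TailEntropy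

variable [StandardBorelSpace X] [IsProbabilityMeasure P] [P.IsComplete]

theorem lintegral_logCover_refine_le (T : BundleRDS P ϑ X) (hϑ : MeasurePreserving ϑ P P)
    (R Q : T.RandomCover) (n : ℕ) :
    ∫⁻ ω, T.logCover (T.refine R.set n) (T.refine Q.set n) ω ∂P ≤
      n * ∫⁻ ω, T.logCover R.set Q.set ω ∂P := by
  have := Q.nonempty_fin
  have hm := T.measurable_logCover R.measurableSet R.iUnion_eq Q.measurableSet
  refine (lintegral_mono fun ω => T.logCover_refine_le R.iUnion_eq Q.set n ω).trans ?_
  have hm' : ∀ i : Fin n, Measurable fun ω => T.logCover R.set Q.set (ϑ^[i] ω) := fun i =>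
    hm.comp (hϑ.iterate i).measurable
  rw [lintegral_finsetSum _ fun i _ => hm' i]
  simp_rw [fun i : Fin n => (hϑ.iterate i).lintegral_comp hm]
  simp

theorem lintegral_logCover_refine_le_add (T : BundleRDS P ϑ X) (hϑ : MeasurePreserving ϑ P P)
    (R Q Q' : T.RandomCover) (n : ℕ) :
    ∫⁻ ω, T.logCover (T.refine R.set n) (T.refine Q'.set n) ω ∂P ≤
      ∫⁻ ω, T.logCover (T.refine R.set n) (T.refine Q.set n) ω ∂P +
        ∫⁻ ω, T.logCover (T.refine Q.set n) (T.refine Q'.set n) ω ∂P := by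
  have := Q.nonempty_fin
  have := Q'.nonempty_fin
  have h1 := T.measurable_logCover (T.measurableSet_refine hϑ.measurable R.measurableSet n)
    (T.iUnion_refine R.iUnion_eq n) (T.measurableSet_refine hϑ.measurable Q.measurableSet n)
  rw [← lintegral_add_left h1]
  exact lintegral_mono fun ω => T.logCover_le_add (T.iUnion_refine R.iUnion_eq n)
    (T.iUnion_refine Q.iUnion_eq n) _ ω

theorem div_le_of_le_nsmul {a c : ℝ≥0∞} {n : ℕ} (h : a ≤ n * c) : a / n ≤ c :=
  ENNReal.div_le_of_le_mul (by rwa [mul_comm])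

/-- Changing the conditioning cover costs at most the mean logarithm of the number of members of `Q`
needed inside one member of `Q'`, as `ϑ` preserves `P`. -/
theorem coverTailEntropy_le_add_right (T : BundleRDS P ϑ X) (hϑ : MeasurePreserving ϑ P P)
    (R Q Q' : T.RandomCover) :
    T.coverTailEntropy R Q' ≤ T.coverTailEntropy R Q + ∫⁻ ω, T.logCover Q.set Q'.set ω ∂P := by
  rw [coverTailEntropy_eq, coverTailEntropy_eq]
  refine ENNReal.limsup_add_const_le (Eventually.of_forall fun n => ?_)
  calc _ ≤ (_ + _) / (n : ℝ≥0∞) := by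
        gcongr
        exact T.lintegral_logCover_refine_le_add hϑ R Q Q' n
    _ ≤ _ := by
      rw [ENNReal.add_div]
      gcongr
      exact div_le_of_le_nsmul (T.lintegral_logCover_refine_le hϑ Q Q' n)

theorem coverTailEntropy_le_add_left (T : BundleRDS P ϑ X) (hϑ : MeasurePreserving ϑ P P)
    (R R' Q : T.RandomCover) :
    T.coverTailEntropy R Q ≤ T.coverTailEntropy R' Q + ∫⁻ ω, T.logCover R.set R'.set ω ∂P := by
  rw [coverTailEntropy_eq, coverTailEntropy_eq]
  refine ENNReal.limsup_add_const_le (Eventually.of_forall fun n => ?_)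
  calc _ ≤ (_ + _) / (n : ℝ≥0∞) := by
        gcongr
        exact T.lintegral_logCover_refine_le_add hϑ R R' Q n
    _ ≤ _ := by
      rw [ENNReal.add_div, add_comm]
      gcongr
      exact div_le_of_le_nsmul (T.lintegral_logCover_refine_le hϑ R R' n)

end TailEntropy

end Cover

/-! ### Reduction of random covers to covers of `X` by small balls. -/

section DetCover

variable {Ω : Type*} [MeasurableSpace Ω] {P : Measure Ω} {ϑ : Ω → Ω}
  {X : Type*} [MetricSpace X] [MeasurableSpace X] [BorelSpace X]

/-- The random cover given by an open cover of `X`. -/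
def detCover (T : BundleRDS P ϑ X) {s : ℕ} (U : Fin s → Set X) (hU : ∀ i, IsOpen (U i))
    (hc : ⋃ i, U i = univ) : T.RandomCover where
  size := s
  set i := {p | p.1.2 ∈ U i}
  measurableSet i := (measurable_snd.comp measurable_subtype_coe) (hU i).measurableSet
  iUnion_eq := by
    refine eq_univ_of_forall fun p => ?_
    have : p.1.2 ∈ ⋃ i, U i := hc ▸ mem_univ _
    simpa using this

theorem isOpenCover_detCover (T : BundleRDS P ϑ X) {s : ℕ} (U : Fin s → Set X)
    (hU : ∀ i, IsOpen (U i)) (hc : ⋃ i, U i = univ) : (T.detCover U hU hc).IsOpenCover :=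
  fun i => Eventually.of_forall fun _ => (hU i).preimage continuous_subtype_val

theorem exists_finite_ball_cover (X : Type*) [MetricSpace X] [CompactSpace X] (k : ℕ) :
    ∃ (s : ℕ) (c : Fin s → X), ⋃ i, Metric.ball (c i) (1 / ((k : ℝ) + 1)) = univ := by
  obtain ⟨t, -, ht⟩ := (isCompact_univ (X := X)).elim_finite_subcover_image
    (b := univ) (c := fun x => Metric.ball x (1 / ((k : ℝ) + 1)))
    (fun _ _ => Metric.isOpen_ball)
    (fun x _ => mem_iUnion₂.2 ⟨x, mem_univ x, Metric.mem_ball_self (by positivity)⟩)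
  have := ht.1.fintype
  refine ⟨Fintype.card t, fun i => ((Fintype.equivFin t).symm i).1, eq_univ_of_forall fun x => ?_⟩
  obtain ⟨y, hy, hxy⟩ := mem_iUnion₂.1 (ht.2 (mem_univ x))
  exact mem_iUnion.2 ⟨Fintype.equivFin t ⟨y, hy⟩, by simpa using hxy⟩

variable [CompactSpace X]

/-- A sequence of covers by balls of radius `1 / (k + 1)`. -/
def ballCover (T : BundleRDS P ϑ X) (k : ℕ) : T.RandomCover :=
  T.detCover (fun i => Metric.ball ((exists_finite_ball_cover X k).choose_spec.choose i)
    (1 / ((k : ℝ) + 1))) (fun _ => Metric.isOpen_ball)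
    (exists_finite_ball_cover X k).choose_spec.choose_spec

theorem isOpenCover_ballCover (T : BundleRDS P ϑ X) (k : ℕ) : (T.ballCover k).IsOpenCover :=
  T.isOpenCover_detCover _ _ _

theorem exists_mem_ball_of_mem_ballCover (T : BundleRDS P ϑ X) (k : ℕ) (j) :
    ∃ c : X, ∀ p ∈ (T.ballCover k).set j, p.1.2 ∈ Metric.ball c (1 / ((k : ℝ) + 1)) :=
  ⟨_, fun _ hp => hp⟩

variable [IsProbabilityMeasure P] [P.IsComplete]

/-- On a compact fiber the open cover has a Lebesgue number, so for large `k` each small ball meets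
the fiber inside one member of `R` and the covering number is `1`. The logarithms are bounded by
that of the size of `R`, and dominated convergence applies. -/
theorem tendsto_lintegral_logCover_ballCover (T : BundleRDS P ϑ X) {R : T.RandomCover}
    (hR : R.IsOpenCover) :
    Tendsto (fun k => ∫⁻ ω, T.logCover R.set (T.ballCover k).set ω ∂P) atTop (𝓝 0) := by
  have hne := R.nonempty_fin
  have hne' := fun k => (T.ballCover k).nonempty_fin
  have hbound : ∀ k ω, T.logCover R.set (T.ballCover k).set ω ≤
      ENNReal.ofReal (Real.log R.size) := fun k ω => by
    have h1 := T.one_le_condCoverNum R.iUnion_eq (T.ballCover k).set ω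
    refine ENNReal.ofReal_le_ofReal (Real.log_le_log (by positivity) ?_)
    have : 1 ≤ R.size := Fin.pos_iff_nonempty.2 hne
    exact_mod_cast T.condCoverNum_le this fun j => ⟨Finset.univ, fun x _ => by
      have : T.incl ω x ∈ ⋃ i, R.set i := R.iUnion_eq ▸ mem_univ _
      simpa using this, by simp⟩
  have hlim : ∀ᵐ ω ∂P, Tendsto (fun k => T.logCover R.set (T.ballCover k).set ω) atTop (𝓝 0) := by
    filter_upwards [ae_all_iff.2 hR] with ω hω
    have : CompactSpace (T.fiber ω) := isCompact_iff_compactSpace.1 (T.isCompact_fiber ω)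
    obtain ⟨δ, hδ, hL⟩ := lebesgue_number_lemma_of_metric (isCompact_univ (X := T.fiber ω))
      hω (fun x _ => by
        have : T.incl ω x ∈ ⋃ i, R.set i := R.iUnion_eq ▸ mem_univ _
        simpa using this)
    refine tendsto_const_nhds.congr' ?_
    have hk : Tendsto (fun k : ℕ => 1 / ((k : ℝ) + 1)) atTop (𝓝 0) :=
      tendsto_one_div_add_atTop_nhds_zero_nat
    filter_upwards [hk.eventually_lt_const (half_pos hδ)] with k hk
    have h1 : T.condCoverNum R.set (T.ballCover k).set ω ≤ 1 := by
      refine T.condCoverNum_le le_rfl fun j => ?_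
      by_cases hj : (T.incl ω ⁻¹' (T.ballCover k).set j).Nonempty
      · obtain ⟨x, hx⟩ := hj
        obtain ⟨i, hi⟩ := hL x (mem_univ x)
        refine ⟨{i}, fun y hy => ?_, by simp⟩
        obtain ⟨c, hc⟩ := T.exists_mem_ball_of_mem_ballCover k j
        have h1 : dist x.1 c < 1 / ((k : ℝ) + 1) := hc _ hx
        have h2 : dist y.1 c < 1 / ((k : ℝ) + 1) := hc _ hy
        have : dist y x < δ := by
          rw [Subtype.dist_eq]
          linarith [dist_triangle_right y.1 x.1 c]
        simpa using hi this
      · refine ⟨∅, ?_, by simp⟩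
        rw [Covers, not_nonempty_iff_eq_empty.1 hj]
        exact empty_subset _
    have h2 := T.one_le_condCoverNum R.iUnion_eq (T.ballCover k).set ω
    rw [logCover, le_antisymm h1 h2]
    simp
  have := tendsto_lintegral_of_dominated_convergence (fun _ => ENNReal.ofReal (Real.log R.size))
    (fun k => T.measurable_logCover R.measurableSet R.iUnion_eq (T.ballCover k).measurableSet)
    (fun k => Eventually.of_forall (hbound k)) (by simp) hlim
  simpa using this

/-- Thus the infimum over all `Q` in the tail entropy can be reached along ball covers. -/
theorem tailEntropyGiven_ballCover_le (T : BundleRDS P ϑ X) (hϑ : MeasurePreserving ϑ P P)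
    {Q : T.RandomCover} (hQ : Q.IsOpenCover) {ε : ℝ≥0∞} (hε : ε ≠ 0) :
    ∀ᶠ k in atTop, T.tailEntropyGiven (T.ballCover k) ≤ T.tailEntropyGiven Q + ε := by
  filter_upwards [(T.tendsto_lintegral_logCover_ballCover hQ).eventually_le_const
    (pos_iff_ne_zero.2 hε)] with k hk
  refine iSup₂_le fun R hR => (T.coverTailEntropy_le_add_right hϑ R Q _).trans ?_
  exact add_le_add (le_iSup₂_of_le R hR le_rfl) hk

theorem coverTailEntropy_le_ballCover (T : BundleRDS P ϑ X) (hϑ : MeasurePreserving ϑ P P)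
    {R : T.RandomCover} (hR : R.IsOpenCover) (Q : T.RandomCover) {ε : ℝ≥0∞} (hε : ε ≠ 0) :
    ∀ᶠ k in atTop, T.coverTailEntropy R Q ≤ T.coverTailEntropy (T.ballCover k) Q + ε := by
  filter_upwards [(T.tendsto_lintegral_logCover_ballCover hR).eventually_le_const
    (pos_iff_ne_zero.2 hε)] with k hk
  exact (T.coverTailEntropy_le_add_left hϑ R _ Q).trans (add_le_add le_rfl hk)

end DetCover

end BundleRDS

end

/-! ### The coding estimate behind the upper bound. -/

noncomputable section

theorem ENNReal.limsup_add_le_add_limsup {α : Type*} {l : Filter α} (u v : α → ℝ≥0∞) :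
    limsup (fun n => u n + v n) l ≤ limsup u l + limsup v l := by
  refine ENNReal.le_of_forall_pos_le_add fun ε hε hlt => ?_
  have hu : limsup u l < limsup u l + ε / 2 :=
    ENNReal.lt_add_right (ENNReal.add_lt_top.1 hlt).1.ne (by simpa using hε.ne')
  have hv : limsup v l < limsup v l + ε / 2 :=
    ENNReal.lt_add_right (ENNReal.add_lt_top.1 hlt).2.ne (by simpa using hε.ne')
  refine limsup_le_of_le (by isBoundedDefault) ?_
  filter_upwards [eventually_lt_of_limsup_lt hu, eventually_lt_of_limsup_lt hv] with n h1 h2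
  calc u n + v n ≤ (limsup u l + ε / 2) + (limsup v l + ε / 2) := add_le_add h1.le h2.le
    _ = limsup u l + limsup v l + (ε / 2 + ε / 2) := by ring
    _ = _ := by rw [ENNReal.add_halves]

/-- Measurable choice among finitely many possibilities. -/
theorem exists_measurable_choice {Ω F : Type*} [MeasurableSpace Ω] [Finite F]
    {p : F → Ω → Prop} (hp : ∀ t, MeasurableSet {ω | p t ω}) (h : ∀ ω, ∃ t, p t ω) :
    ∃ s : Ω → F, (∀ ω, p (s ω) ω) ∧ Measurable[_, ⊤] s := by
  classical
  have := Fintype.ofFinite F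
  rcases isEmpty_or_nonempty F with hF | hF
  · exact ⟨fun ω => (h ω).choose, fun ω => (h ω).choose_spec, fun A _ => by
      rw [show A = ∅ from Subsingleton.elim _ _]; exact .empty⟩
  let e := Fintype.equivFin F
  have h' : ∀ ω, ∃ k : ℕ, ∃ t, (e t : ℕ) = k ∧ p t ω := fun ω =>
    (h ω).elim fun t ht => ⟨_, t, rfl, ht⟩
  have hm : ∀ k : ℕ, MeasurableSet {ω | ∃ t, (e t : ℕ) = k ∧ p t ω} := fun k => by
    have : {ω | ∃ t, (e t : ℕ) = k ∧ p t ω} = ⋃ (t) (_ : (e t : ℕ) = k), {ω | p t ω} := by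
      ext ω
      simp
    rw [this]
    exact .iUnion fun t => .iUnion fun _ => hp t
  -- The possibilities are enumerated, and the first admissible one is chosen.
  let g : ℕ → F := Function.invFun fun t => (e t : ℕ)
  have hg : ∀ t, g (e t : ℕ) = t :=
    Function.leftInverse_invFun (Fin.val_injective.comp e.injective)
  refine ⟨fun ω => g (Nat.find (h' ω)), fun ω => ?_, ?_⟩
  · obtain ⟨t, ht, hpt⟩ := Nat.find_spec (h' ω)
    change p (g (Nat.find (h' ω))) ω
    rw [← ht, hg]
    exact hpt
  · intro A _
    exact measurable_find h' hm (show MeasurableSet (g ⁻¹' A) from trivial)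

theorem measurable_comp_countable_pair {Ω F : Type*} [MeasurableSpace Ω] [Countable F]
    {N : Ω → ℕ} (hN : Measurable N) {t : Ω → F} (ht : Measurable[_, ⊤] t) (f : ℕ → F → ℝ≥0∞) :
    Measurable fun ω => f (N ω) (t ω) := by
  let _ : MeasurableSpace F := ⊤
  have : MeasurableSingletonClass F := ⟨fun _ => trivial⟩
  exact (measurable_of_countable fun z : ℕ × F => f z.1 z.2).comp (hN.prodMk ht)

namespace BundleRDS

section Upper

variable {Ω : Type*} [MeasurableSpace Ω] {P : Measure Ω} {ϑ : Ω → Ω}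
  {X : Type*} [MetricSpace X] [MeasurableSpace X]

/-- The second projection of the fibered square. -/
def sqSndTotal (T : BundleRDS P ϑ X) (p : T.square.Total) : T.Total := ⟨(p.1.1, p.1.2.2), p.2.2⟩

theorem sqSndTotal_iterate (T : BundleRDS P ϑ X) (n : ℕ) (p : T.square.Total) :
    T.sqSndTotal (T.square.skew^[n] p) = T.skew^[n] (T.sqSndTotal p) := by
  induction n generalizing p with
  | zero => rfl
  | succ n ih => rw [Function.iterate_succ_apply, ih, Function.iterate_succ_apply]; rfl

/-- The weight given to the letter `b` in a coding when `j` is expected. -/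
def mixWeight (ε : ℝ≥0∞) (r : ℕ) (j b : Fin r) : ℝ≥0∞ := (1 - ε) * (if j = b then 1 else 0) + ε / r

theorem sum_mixWeight {ε : ℝ≥0∞} (hε : ε < 1) {r : ℕ} (j : Fin r) : ∑ b, mixWeight ε r j b = 1 := by
  have hr : (r : ℝ≥0∞) ≠ 0 := by
    have := j.pos
    simpa using this.ne'
  simp only [mixWeight, Finset.sum_add_distrib, ← Finset.mul_sum, Finset.sum_ite_eq,
    Finset.mem_univ, if_true, mul_one, Finset.sum_const, Finset.card_univ, Fintype.card_fin,
    nsmul_eq_mul]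
  rw [ENNReal.mul_div_cancel hr (by simp), tsub_add_cancel_of_le hε.le]

/-- The weight of the word `b` when the words in `t` are equally expected. -/
def wordWeight (ε : ℝ≥0∞) {r n : ℕ} (m : ℕ) (t : Finset (Fin n → Fin r)) (b : Fin n → Fin r) :
    ℝ≥0∞ :=
  (m : ℝ≥0∞)⁻¹ * ∑ j ∈ t, ∏ i, mixWeight ε r (j i) (b i)

/-- Each expected word contributes a product probability vector with factor `1 / m`, and there are
at most `m` of them. -/
theorem tsum_wordWeight_le {ε : ℝ≥0∞} (hε1 : ε < 1) {r n m : ℕ} {t : Finset (Fin n → Fin r)}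
    (ht : t.card ≤ m) : ∑' b, wordWeight ε m t b ≤ 1 := by
  simp only [wordWeight]
  rw [tsum_fintype, ← Finset.mul_sum, Finset.sum_comm]
  have h1 : ∀ j : Fin n → Fin r, ∑ b : Fin n → Fin r, ∏ i, mixWeight ε r (j i) (b i) = 1 :=
    fun j => by
      rw [← Fintype.prod_sum fun i b => mixWeight ε r (j i) b]
      exact Finset.prod_eq_one fun i _ => sum_mixWeight hε1 _
  simp only [h1, Finset.sum_const, nsmul_eq_mul, mul_one]
  rw [mul_comm, ← div_eq_mul_inv]
  refine ENNReal.div_le_of_le_mul ?_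
  rw [one_mul]
  exact_mod_cast ht

/-- Keeping only the summand of the word `j` leaves `log m` plus one cost for each letter. -/
theorem neglog_wordWeight_le {ε : ℝ≥0∞} {r n m : ℕ} {t : Finset (Fin n → Fin r)}
    {j : Fin n → Fin r} (hj : j ∈ t) (b : Fin n → Fin r) :
    neglog (wordWeight ε m t b) ≤
      ENNReal.ofReal (Real.log m) + ∑ i, neglog (mixWeight ε r (j i) (b i)) := by
  have h1 : (m : ℝ≥0∞)⁻¹ * ∏ i, mixWeight ε r (j i) (b i) ≤ wordWeight ε m t b := by
    rw [wordWeight]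
    gcongr
    exact Finset.single_le_sum (f := fun j : Fin n → Fin r => ∏ i, mixWeight ε r (j i) (b i))
      (fun _ _ => zero_le) hj
  refine (neglog_antitone h1).trans ((neglog_mul_le _ _).trans ?_)
  rw [neglog_inv_natCast]
  exact add_le_add le_rfl (neglog_prod_le _ _)

theorem lintegral_base (T : BundleRDS P ϑ X) {μ : Measure T.Total} (hμ : μ.map T.base = P)
    {f : Ω → ℝ≥0∞} (hf : Measurable f) : ∫⁻ p, f (T.base p) ∂μ = ∫⁻ ω, f ω ∂P := by
  conv_rhs => rw [← hμ]
  exact (lintegral_map hf T.measurable_base).symm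

variable [CompactSpace X] [BorelSpace X] [IsProbabilityMeasure P] [P.IsComplete]

/-- Coding the itineraries of the second point with respect to `γ`, given its itinerary with respect
to a partition subordinate to the cover `Q`. -/
theorem codeEntropyGiven_itinerary_le_logCover (T : BundleRDS P ϑ X)
    (hϑ : MeasurePreserving ϑ P P) (Q : T.RandomCover) {s : ℕ} {a : X → Fin s}
    {q : Fin s → Fin Q.size} (hq : ∀ p : T.Total, p ∈ Q.set (q (a p.1.2)))
    {r : ℕ} {γ : X → Fin r} {K : Fin r → Set X} (hK : ∀ b, IsClosed (K b))
    (hKγ : ∀ b, K b ⊆ γ ⁻¹' {b}) {U : Fin r → Set X} (hU : ∀ i, IsOpen (U i))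
    (hc : ⋃ i, U i = univ) (hUK : ∀ j b x, x ∈ U j → x ∈ K b → j = b)
    {ε : ℝ≥0∞} (hε1 : ε < 1) {μ : Measure T.square.Total} [IsProbabilityMeasure μ]
    (hμ : μ.map T.square.base = P) (hΘ : MeasurePreserving T.square.skew μ μ) (n : ℕ) :
    codeEntropyGiven T.firstCoordSigma μ
      (itinerary T.square.skew (fun p => a (T.sqSnd p)) n)
      (itinerary T.square.skew (fun p => γ (T.sqSnd p)) n) ≤
      ∫⁻ ω, T.logCover (T.refine (T.detCover U hU hc).set n) (T.refine Q.set n) ω ∂P +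
        n * (neglog (1 - ε) + neglog (ε / r) * μ (T.sqSnd ⁻¹' (⋃ b, K b)ᶜ)) := by
  classical
  have hQne := Q.nonempty_fin
  set R := T.detCover U hU hc with hRdef
  set N : Ω → ℕ := T.condCoverNum (T.refine R.set n) (T.refine Q.set n) with hN
  have hRm := T.measurableSet_refine hϑ.measurable R.measurableSet n
  have hQm := T.measurableSet_refine hϑ.measurable Q.measurableSet n
  have hRc := T.iUnion_refine R.iUnion_eq n
  have hNm : Measurable N := T.measurable_condCoverNum hRm hRc hQm
  have hN1 : ∀ ω, 1 ≤ N ω := fun ω => T.one_le_condCoverNum hRc _ ω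
  -- For each `Q`-word, a family of at most `N ω` `R`-words covering it is chosen measurably in `ω`.
  have hchoice : ∀ d : Fin n → Fin Q.size, ∃ t : Ω → Finset (Fin n → Fin r),
      (∀ ω, T.Covers (T.refine Q.set n d) (T.refine R.set n) (t ω) ω ∧ (t ω).card ≤ N ω) ∧
        Measurable[_, ⊤] t := fun d =>
    exists_measurable_choice (F := Finset (Fin n → Fin r))
      (p := fun t ω => T.Covers (T.refine Q.set n d) (T.refine R.set n) t ω ∧ t.card ≤ N ω)
      (fun t => (T.measurableSet_covers (hQm d) hRm t).inter (measurableSet_le measurable_const hNm))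
      (fun ω => T.exists_covers_card_le_condCoverNum hRc _ ω d)
  choose t ht htm using hchoice
  -- The itinerary `c` puts the second point in the member of `Q^(n)` with index `q ∘ c`. The code
  -- weighs the `R`-words covering this member equally. It depends on the pair only through `ω`, so
  -- it is measurable with respect to the first point.
  let k : (Fin n → Fin s) → (Fin n → Fin r) → T.square.Total → ℝ≥0∞ := fun c b p =>
    wordWeight ε (N (T.base (T.sqFst p))) (t (q ∘ c) (T.base (T.sqFst p))) b
  have hk : ∀ c, IsSubProb T.firstCoordSigma (k c) := by
    intro c
    refine ⟨fun b => ?_, fun p => ?_⟩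
    · have h2 : Measurable fun ω => wordWeight ε (N ω) (t (q ∘ c) ω) b :=
        measurable_comp_countable_pair hNm (htm _) fun m t => wordWeight ε m t b
      exact T.measurable_firstCoordSigma_comp (h2.comp T.measurable_base)
    · exact tsum_wordWeight_le hε1 (ht (q ∘ c) _).2
  refine (codeEntropyGiven_le hk).trans ?_
  let B : Set X := (⋃ b, K b)ᶜ
  have hB : MeasurableSet B := (MeasurableSet.iUnion fun b => (hK b).measurableSet).compl
  -- One of the covering `R`-words contains the point. Its letters agree with those of `γ` at every
  -- time when the second point lies in `⋃ b, K b`; at the other times only the uniform share is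
  -- available.
  have hpt : ∀ p : T.square.Total,
      neglog (k (itinerary T.square.skew (fun p => a (T.sqSnd p)) n p)
        (itinerary T.square.skew (fun p => γ (T.sqSnd p)) n p) p) ≤
      T.logCover (T.refine R.set n) (T.refine Q.set n) (T.base (T.sqFst p)) +
        ∑ i : Fin n, (neglog (1 - ε) + (T.sqSnd ⁻¹' B).indicator (fun _ => neglog (ε / r))
          (T.square.skew^[i] p)) := by
    intro p
    set c := itinerary T.square.skew (fun p => a (T.sqSnd p)) n p with hcdef
    set b := itinerary T.square.skew (fun p => γ (T.sqSnd p)) n p with hbdef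
    set ω := T.base (T.sqFst p) with hω
    have hx : (⟨p.1.2.2, p.2.2⟩ : T.fiber ω) ∈ T.incl ω ⁻¹' T.refine Q.set n (q ∘ c) := by
      refine mem_iInter.2 fun i => ?_
      change T.skew^[i] (T.sqSndTotal p) ∈ Q.set (q (c i))
      rw [← T.sqSndTotal_iterate]
      exact hq (T.sqSndTotal (T.square.skew^[i] p))
    obtain ⟨j, hj, hxj⟩ := mem_iUnion₂.1 ((ht (q ∘ c) ω).1 hx)
    have hj' : ∀ i : Fin n, T.sqSnd (T.square.skew^[i] p) ∈ U (j i) := fun i => by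
      have h1 : T.skew^[i] (T.sqSndTotal p) ∈ R.set (j i) := mem_iInter.1 hxj i
      rw [← T.sqSndTotal_iterate] at h1
      exact h1
    refine (neglog_wordWeight_le hj b).trans ?_
    refine add_le_add le_rfl (Finset.sum_le_sum fun i _ => ?_)
    by_cases hi : T.square.skew^[i] p ∈ T.sqSnd ⁻¹' B
    · rw [indicator_of_mem hi]
      exact (neglog_antitone le_add_self).trans le_add_self
    · rw [indicator_of_notMem hi, add_zero]
      obtain ⟨d, hd⟩ := mem_iUnion.1 (notMem_compl_iff.1 hi)
      have e1 : j i = d := hUK _ _ _ (hj' i) hd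
      have e2 : b i = d := hKγ d hd
      refine neglog_antitone ?_
      rw [e1, e2, mixWeight, if_pos rfl, mul_one]
      exact le_self_add
  have hBm : MeasurableSet (T.sqSnd ⁻¹' B) := T.measurable_sqSnd hB
  have hlm := T.measurable_logCover hRm hRc hQm
  have hind : Measurable ((T.sqSnd ⁻¹' B).indicator fun _ : T.square.Total => neglog (ε / r)) :=
    measurable_const.indicator hBm
  refine (lintegral_mono hpt).trans ?_
  have hlm' : Measurable fun p : T.square.Total =>
      T.logCover (T.refine R.set n) (T.refine Q.set n) (T.base (T.sqFst p)) :=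
    hlm.comp (T.measurable_base.comp T.measurable_sqFst)
  have hind' : ∀ i : Fin n, Measurable fun p : T.square.Total => neglog (1 - ε) +
      (T.sqSnd ⁻¹' B).indicator (fun _ => neglog (ε / r)) (T.square.skew^[i] p) := fun i =>
    (hind.comp (hΘ.iterate i).measurable).const_add _
  rw [lintegral_add_left hlm']
  refine add_le_add (le_of_eq (T.square.lintegral_base hμ hlm)) ?_
  rw [lintegral_finsetSum _ fun i _ => hind' i]
  refine (Finset.sum_le_card_nsmul _ _ (neglog (1 - ε) + neglog (ε / r) * μ (T.sqSnd ⁻¹' B))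
    fun i _ => ?_).trans (by rw [Finset.card_univ, Fintype.card_fin, nsmul_eq_mul])
  rw [lintegral_add_left measurable_const, lintegral_const, measure_univ, mul_one,
    (hΘ.iterate i).lintegral_comp hind, lintegral_indicator_const hBm]

/-- The entropy rate of any partition exceeds that of a partition subordinate to `Q` by at most the
tail entropy given `Q`. -/
theorem entropyRate_le_add_tailEntropyGiven (T : BundleRDS P ϑ X)
    (hϑ : MeasurePreserving ϑ P P) (Q : T.RandomCover) {s : ℕ} {a : X → Fin s} (ha : Measurable a)
    {q : Fin s → Fin Q.size} (hq : ∀ p : T.Total, p ∈ Q.set (q (a p.1.2)))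
    {r : ℕ} {γ : X → Fin r} (hγ : Measurable γ) {μ : Measure T.square.Total} [IsProbabilityMeasure μ]
    (hμ : μ.map T.square.base = P) (hΘ : MeasurePreserving T.square.skew μ μ) :
    entropyRate T.firstCoordSigma μ T.square.skew (fun p => γ (T.sqSnd p)) ≤
      entropyRate T.firstCoordSigma μ T.square.skew (fun p => a (T.sqSnd p)) +
        T.tailEntropyGiven Q := by
  refine ENNReal.le_of_forall_pos_le_add fun η hη _ => ?_
  have hη2 : (η : ℝ≥0∞) / 2 ≠ 0 := by simpa using hη.ne'
  obtain ⟨ε, hε0, hε1, hε⟩ := exists_neglog_one_sub_le hη2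
  let ν := μ.map T.sqSnd
  have hr : (r : ℝ≥0∞) ≠ 0 := by
    obtain ⟨p⟩ := nonempty_of_isProbabilityMeasure μ
    simpa using (γ (T.sqSnd p)).pos.ne'
  have hεr : ε / r ≠ 0 := by simp [ENNReal.div_eq_zero_iff, hε0]
  obtain ⟨δ, hδ0, hδ⟩ := ENNReal.exists_nnreal_pos_mul_lt
    (ENNReal.mul_ne_top (neglog_ne_top hεr) (ENNReal.natCast_ne_top r)) hη2
  -- The atoms of `γ` are shrunk to closed sets, losing measure `δ` each; the choice of `δ` makes
  -- the cost of the lost part at most `η / 2`.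
  choose K hKγ hK hKν using fun b : Fin r => (hγ (measurableSet_singleton b)).exists_isClosed_sdiff_lt
    (measure_ne_top ν _) (ENNReal.coe_ne_zero.2 hδ0.ne')
  -- Removing every `K b` except the `j`-th gives an open cover in which a point of `⋃ b, K b`
  -- belongs to the member of its own index only.
  let U : Fin r → Set X := fun j => ⋂ b, if b = j then univ else (K b)ᶜ
  have hdisj : ∀ x b b', x ∈ K b → x ∈ K b' → b = b' := fun x b b' h h' =>
    (hKγ b h : γ x = b).symm.trans (hKγ b' h' : γ x = b')
  have hU : ∀ j, IsOpen (U j) := fun j => isOpen_iInter_of_finite fun b => by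
    split_ifs
    · exact isOpen_univ
    · exact (hK b).isOpen_compl
  have hUK : ∀ j b x, x ∈ U j → x ∈ K b → j = b := fun j b x hx hb => by
    by_contra hne
    have := mem_iInter.1 hx b
    rw [if_neg (Ne.symm hne)] at this
    exact this hb
  have hc : ⋃ j, U j = univ := by
    refine eq_univ_of_forall fun x => mem_iUnion.2 ⟨γ x, mem_iInter.2 fun b => ?_⟩
    split_ifs with h
    · trivial
    · exact fun hb => h (hKγ b hb : γ x = b).symm
  have hBν : μ (T.sqSnd ⁻¹' (⋃ b, K b)ᶜ) ≤ r * δ := by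
    have hB : MeasurableSet (⋃ b, K b)ᶜ :=
      (MeasurableSet.iUnion fun b => (hK b).measurableSet).compl
    rw [← Measure.map_apply T.measurable_sqSnd hB]
    have hsub : (⋃ b, K b)ᶜ ⊆ ⋃ b, γ ⁻¹' {b} \ K b := fun x hx =>
      mem_iUnion.2 ⟨γ x, rfl, fun h => hx (mem_iUnion.2 ⟨_, h⟩)⟩
    refine (measure_mono hsub).trans ((measure_iUnion_le _).trans ?_)
    rw [tsum_fintype]
    refine (Finset.sum_le_card_nsmul _ _ (δ : ℝ≥0∞) fun b _ => (hKν b).le).trans (le_of_eq ?_)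
    simp
  have hcost : neglog (1 - ε) + neglog (ε / r) * μ (T.sqSnd ⁻¹' (⋃ b, K b)ᶜ) ≤ η := by
    calc _ ≤ (η : ℝ≥0∞) / 2 + neglog (ε / r) * (r * δ) := by gcongr
      _ = η / 2 + δ * (neglog (ε / r) * r) := by ring
      _ ≤ η / 2 + η / 2 := by gcongr
      _ = η := ENNReal.add_halves _
  have hstep : ∀ n : ℕ, codeEntropy T.firstCoordSigma μ
      (itinerary T.square.skew (fun p => γ (T.sqSnd p)) n) / n ≤
      (codeEntropy T.firstCoordSigma μ (itinerary T.square.skew (fun p => a (T.sqSnd p)) n) / n +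
      (∫⁻ ω, T.logCover (T.refine (T.detCover U hU hc).set n) (T.refine Q.set n) ω ∂P) / n) + η := by
    intro n
    have h1 := (codeEntropy_le_add_given T.firstCoordSigma_le
      (measurable_itinerary hΘ.measurable (ha.comp T.measurable_sqSnd) n) _).trans
      (add_le_add le_rfl (T.codeEntropyGiven_itinerary_le_logCover hϑ Q hq hK hKγ hU hc hUK hε1 hμ hΘ n))
    calc _ ≤ _ := ENNReal.div_le_div_right h1 (n : ℝ≥0∞)
      _ ≤ _ := by
        rw [ENNReal.add_div, ENNReal.add_div, ← add_assoc]
        refine add_le_add le_rfl (div_le_of_le_nsmul ?_)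
        gcongr
  refine (ENNReal.limsup_add_const_le (Eventually.of_forall hstep)).trans ?_
  gcongr
  refine (ENNReal.limsup_add_le_add_limsup _ _).trans ?_
  refine add_le_add le_rfl ?_
  exact le_iSup₂_of_le (T.detCover U hU hc) (T.isOpenCover_detCover U hU hc) le_rfl

end Upper

end BundleRDS

end

/-! ### Narrow convergence, random open sets and sets of negligible boundary. -/

noncomputable section

namespace BundleRDS

section Narrow

variable {Ω : Type*} [MeasurableSpace Ω] {P : Measure Ω} {ϑ : Ω → Ω}
  {X : Type*} [MetricSpace X] [MeasurableSpace X]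

/-- Narrow convergence of measures on the bundle. -/
def NarrowTendsto (T : BundleRDS P ϑ X) {J : Type*} (ν : J → Measure T.Total) (l : Filter J)
    (m : Measure T.Total) : Prop :=
  ∀ f : T.RandomContinuous, Tendsto (fun j => ∫ p, f.1 p ∂ν j) l (𝓝 (∫ p, f.1 p ∂m))

theorem tendsto_nhds_iff (T : BundleRDS P ϑ X) {J : Type*} (ν : J → T.InvMeasure) (l : Filter J)
    (m : T.InvMeasure) : Tendsto ν l (𝓝 m) ↔ T.NarrowTendsto (fun j => (ν j).1) l m.1 := by
  have : 𝓝 m = comap (fun (μ : T.InvMeasure) (f : T.RandomContinuous) => ∫ p, f.1 p ∂μ.1)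
      (𝓝 fun f : T.RandomContinuous => ∫ p, f.1 p ∂m.1) := nhds_induced _ _
  rw [this, tendsto_comap_iff, tendsto_pi_nhds]
  rfl

/-- Almost all sections are open in the fibers. -/
def FiberOpen (T : BundleRDS P ϑ X) (G : Set T.Total) : Prop :=
  ∀ᵐ ω ∂P, IsOpen (T.incl ω ⁻¹' G)

theorem FiberOpen.inter {T : BundleRDS P ϑ X} {G G' : Set T.Total} (h : T.FiberOpen G)
    (h' : T.FiberOpen G') : T.FiberOpen (G ∩ G') := by
  filter_upwards [h, h'] with ω h1 h2 using h1.inter h2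

theorem FiberOpen.union {T : BundleRDS P ϑ X} {G G' : Set T.Total} (h : T.FiberOpen G)
    (h' : T.FiberOpen G') : T.FiberOpen (G ∪ G') := by
  filter_upwards [h, h'] with ω h1 h2 using h1.union h2

/-- As `ϑ` preserves `P`, for almost every `ω` the section over `ϑ ω` is open, and almost every
fiber map is continuous. -/
theorem FiberOpen.preimage_skew {T : BundleRDS P ϑ X} (hϑ : MeasurePreserving ϑ P P)
    {G : Set T.Total} (h : T.FiberOpen G) : T.FiberOpen (T.skew ⁻¹' G) := by
  filter_upwards [hϑ.quasiMeasurePreserving.ae h, T.continuousOn_map] with ω h1 h2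
  have hc : Continuous fun x : T.fiber ω => (⟨T.map ω x.1, T.mapsTo ω x.1 x.2⟩ : T.fiber (ϑ ω)) :=
    (continuousOn_iff_continuous_domRestrict.1 h2).subtype_mk _
  exact h1.preimage hc

theorem ae_base (T : BundleRDS P ϑ X) {μ : Measure T.Total} (hμ : μ.map T.base = P)
    {p : Ω → Prop} (hp : ∀ᵐ ω ∂P, p ω) : ∀ᵐ z ∂μ, p (T.base z) := by
  rw [← hμ] at hp
  exact ae_of_ae_map T.measurable_base.aemeasurable hp

/-- The section over `ω` of the complement of a subset of the bundle. -/
def complSection (T : BundleRDS P ϑ X) (G : Set T.Total) (ω : Ω) : Set X :=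
  {x | (ω, x) ∈ (Subtype.val '' Gᶜ : Set (Ω × X))}

theorem measurable_infEDist_complSection_prod [CompactSpace X] [BorelSpace X] [IsFiniteMeasure P]
    [P.IsComplete] (T : BundleRDS P ϑ X) {G : Set T.Total} (hG : MeasurableSet G) :
    Measurable fun q : X × Ω => Metric.infEDist q.1 (T.complSection G q.2) := by
  have hK : MeasurableSet (Subtype.val '' Gᶜ : Set (Ω × X)) :=
    T.measurableSet_carrier.subtype_image hG.compl
  exact measurable_uncurry_of_continuous_of_measurable
      (fun ω => Metric.continuous_infEDist) (fun x => measurable_infEDist_section P hK x)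

theorem measurable_infEDist_complSection [CompactSpace X] [BorelSpace X] [IsFiniteMeasure P]
    [P.IsComplete] (T : BundleRDS P ϑ X) {G : Set T.Total} (hG : MeasurableSet G) :
    Measurable fun p : T.Total => Metric.infEDist p.1.2 (T.complSection G p.1.1) := by
  have h2 : Measurable fun p : T.Total => (p.1.2, p.1.1) := by fun_prop
  intro s hs
  have := h2 (T.measurable_infEDist_complSection_prod hG hs)
  rwa [← preimage_comp] at this

/-- Random continuous functions increasing to the indicator of a random open set. -/
def openApprox (T : BundleRDS P ϑ X) (G : Set T.Total) (k : ℕ) (p : T.Total) : ℝ :=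
  -- The distance is infinite where the complementary section is empty; the cap at `1` keeps the
  -- value finite and below the indicator.
  (min 1 ((k : ℝ≥0∞) * Metric.infEDist p.1.2 (T.complSection G p.1.1))).toReal

theorem openApprox_nonneg (T : BundleRDS P ϑ X) (G : Set T.Total) (k : ℕ) (p : T.Total) :
    0 ≤ T.openApprox G k p := ENNReal.toReal_nonneg

theorem openApprox_of_notMem (T : BundleRDS P ϑ X) {G : Set T.Total} (k : ℕ) {p : T.Total}
    (hp : p ∉ G) : T.openApprox G k p = 0 := by
  have : Metric.infEDist p.1.2 (T.complSection G p.1.1) = 0 :=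
    Metric.infEDist_zero_of_mem ⟨p, hp, rfl⟩
  rw [openApprox, this, mul_zero, min_eq_right zero_le, ENNReal.toReal_zero]

theorem openApprox_le (T : BundleRDS P ϑ X) (G : Set T.Total) (k : ℕ) (p : T.Total) :
    T.openApprox G k p ≤ G.indicator (fun _ => 1) p := by
  by_cases hp : p ∈ G
  · rw [indicator_of_mem hp]
    exact ENNReal.toReal_le_of_le_ofReal zero_le_one (by simp)
  · rw [T.openApprox_of_notMem k hp, indicator_of_notMem hp]

/-- Sets whose boundary in the fibers is negligible for `m`. -/
structure IsContSet (T : BundleRDS P ϑ X) (m : Measure T.Total) (D : Set T.Total) : Prop where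
  measurableSet : MeasurableSet D
  exists_approx : ∃ G F : Set T.Total, MeasurableSet G ∧ MeasurableSet F ∧ T.FiberOpen G ∧
    T.FiberOpen Fᶜ ∧ G ⊆ D ∧ D ⊆ F ∧ m (F \ G) = 0

theorem IsContSet.compl {T : BundleRDS P ϑ X} {m : Measure T.Total} {D : Set T.Total}
    (h : T.IsContSet m D) : T.IsContSet m Dᶜ := by
  obtain ⟨G, F, hG, hF, hGo, hFc, hGD, hDF, h0⟩ := h.exists_approx
  refine ⟨h.measurableSet.compl, Fᶜ, Gᶜ, hF.compl, hG.compl, hFc, by rwa [compl_compl],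
    compl_subset_compl.2 hDF, compl_subset_compl.2 hGD, ?_⟩
  convert h0 using 2
  ext p
  simp [and_comm]

theorem IsContSet.inter {T : BundleRDS P ϑ X} {m : Measure T.Total} {D D' : Set T.Total}
    (h : T.IsContSet m D) (h' : T.IsContSet m D') : T.IsContSet m (D ∩ D') := by
  obtain ⟨G, F, hG, hF, hGo, hFc, hGD, hDF, h0⟩ := h.exists_approx
  obtain ⟨G', F', hG', hF', hGo', hFc', hGD', hDF', h0'⟩ := h'.exists_approx
  refine ⟨h.measurableSet.inter h'.measurableSet, G ∩ G', F ∩ F', hG.inter hG', hF.inter hF',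
    hGo.inter hGo', by rw [compl_inter]; exact hFc.union hFc', inter_subset_inter hGD hGD',
    inter_subset_inter hDF hDF', measure_mono_null ?_ (measure_union_null h0 h0')⟩
  rintro p ⟨⟨h1, h2⟩, h3⟩
  by_cases hp : p ∈ G
  · exact Or.inr ⟨h2, fun hp' => h3 ⟨hp, hp'⟩⟩
  · exact Or.inl ⟨h1, hp⟩

theorem IsContSet.union {T : BundleRDS P ϑ X} {m : Measure T.Total} {D D' : Set T.Total}
    (h : T.IsContSet m D) (h' : T.IsContSet m D') : T.IsContSet m (D ∪ D') := by
  have := (h.compl.inter h'.compl).compl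
  rwa [compl_inter, compl_compl, compl_compl] at this

theorem IsContSet.iInter {T : BundleRDS P ϑ X} {m : Measure T.Total} {ι : Type*} [Finite ι]
    {D : ι → Set T.Total} (h : ∀ i, T.IsContSet m (D i)) : T.IsContSet m (⋂ i, D i) := by
  choose G F hG hF hGo hFc hGD hDF h0 using fun i => (h i).exists_approx
  refine ⟨.iInter fun i => (h i).measurableSet, ⋂ i, G i, ⋂ i, F i, .iInter hG, .iInter hF, ?_, ?_,
    iInter_mono hGD, iInter_mono hDF, measure_mono_null ?_ (measure_iUnion_null h0)⟩
  · filter_upwards [ae_all_iff.2 hGo] with ω hω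
    rw [preimage_iInter]
    exact isOpen_iInter_of_finite hω
  · filter_upwards [ae_all_iff.2 hFc] with ω hω
    rw [compl_iInter, preimage_iUnion]
    exact isOpen_iUnion hω
  · rintro p ⟨h1, h2⟩
    obtain ⟨i, hi⟩ := not_forall.1 (fun h => h2 (mem_iInter.2 h))
    exact mem_iUnion.2 ⟨i, mem_iInter.1 h1 i, hi⟩

/-- The inner and outer sets pull back to sets of the same kind, and the gap between them keeps
measure `0` by invariance of `m`. -/
theorem IsContSet.preimage_skew {T : BundleRDS P ϑ X} (hϑ : MeasurePreserving ϑ P P)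
    {m : Measure T.Total} (hm : MeasurePreserving T.skew m m) {D : Set T.Total}
    (h : T.IsContSet m D) : T.IsContSet m (T.skew ⁻¹' D) := by
  obtain ⟨G, F, hG, hF, hGo, hFc, hGD, hDF, h0⟩ := h.exists_approx
  refine ⟨hm.measurable h.measurableSet, T.skew ⁻¹' G, T.skew ⁻¹' F, hm.measurable hG,
    hm.measurable hF, hGo.preimage_skew hϑ, hFc.preimage_skew hϑ, preimage_mono hGD,
    preimage_mono hDF, ?_⟩
  rw [← preimage_sdiff, hm.measure_preimage (hF.diff hG).nullMeasurableSet, h0]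

theorem IsContSet.preimage_iterate_skew {T : BundleRDS P ϑ X} (hϑ : MeasurePreserving ϑ P P)
    {m : Measure T.Total} (hm : MeasurePreserving T.skew m m) {D : Set T.Total}
    (h : T.IsContSet m D) (n : ℕ) : T.IsContSet m (T.skew^[n] ⁻¹' D) := by
  induction n with
  | zero => exact h
  | succ n ih =>
    rw [Function.iterate_succ, preimage_comp]
    exact ih.preimage_skew hϑ hm

theorem abs_openApprox_le (T : BundleRDS P ϑ X) (G : Set T.Total) (k : ℕ) (p : T.Total) :
    |T.openApprox G k p| ≤ 1 := by
  rw [abs_of_nonneg (T.openApprox_nonneg G k p)]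
  exact (T.openApprox_le G k p).trans (indicator_le_self' (by simp) p)

variable [CompactSpace X] [BorelSpace X] [IsFiniteMeasure P] [P.IsComplete]

theorem measurable_openApprox (T : BundleRDS P ϑ X) {G : Set T.Total} (hG : MeasurableSet G)
    (k : ℕ) : Measurable (T.openApprox G k) :=
  (measurable_const.min ((T.measurable_infEDist_complSection hG).const_mul _)).ennreal_toReal

/-- The approximations of a random open set as random continuous functions. -/
def openApproxRC (T : BundleRDS P ϑ X) {G : Set T.Total} (hG : MeasurableSet G) (k : ℕ) :
    T.RandomContinuous :=
  ⟨T.openApprox G k, T.measurable_openApprox hG k, by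
    refine Eventually.of_forall fun ω => ?_
    have h1 : Continuous fun x : T.fiber ω => min 1 ((k : ℝ≥0∞) *
        Metric.infEDist x.1 (T.complSection G ω)) :=
      continuous_const.min (ENNReal.continuous_const_mul (ENNReal.natCast_ne_top k) |>.comp
        (Metric.continuous_infEDist.comp continuous_subtype_val))
    exact ENNReal.continuousOn_toReal.comp_continuous h1 fun x =>
      ne_top_of_le_ne_top ENNReal.one_ne_top (min_le_left _ _),
    fun _ => 1, integrable_const _, fun p => T.abs_openApprox_le G k p⟩

/-- Where the section of `G` is open, its complement in the compact fiber is closed in `X`, so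
points of `G` are at positive distance from it and the approximations reach `1`. -/
theorem tendsto_openApprox (T : BundleRDS P ϑ X) {m : Measure T.Total} [IsFiniteMeasure m]
    (hm : m.map T.base = P) {G : Set T.Total} (hG : MeasurableSet G) (hGo : T.FiberOpen G) :
    Tendsto (fun k => ∫ p, T.openApprox G k p ∂m) atTop (𝓝 (m.real G)) := by
  have h1 : m.real G = ∫ p, G.indicator (fun _ => (1 : ℝ)) p ∂m := by
    rw [integral_indicator_const _ hG, smul_eq_mul, mul_one]
  rw [h1]
  refine tendsto_integral_of_dominated_convergence (fun _ => 1)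
    (fun k => (T.measurable_openApprox hG k).aestronglyMeasurable) (integrable_const _)
    (fun k => Eventually.of_forall fun p => T.abs_openApprox_le G k p) ?_
  filter_upwards [T.ae_base hm hGo] with p hp
  by_cases hpG : p ∈ G
  · rw [indicator_of_mem hpG]
    have hcl : IsClosed (T.complSection G p.1.1) := by
      have h2 : T.complSection G p.1.1 =
          Subtype.val '' ((T.incl p.1.1 ⁻¹' G)ᶜ) := by
        ext x
        constructor
        · rintro ⟨q, hq, hqx⟩
          obtain ⟨⟨ω, y⟩, hy⟩ := q
          simp only [Prod.mk.injEq] at hqx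
          obtain ⟨rfl, rfl⟩ := hqx
          exact ⟨⟨y, hy⟩, hq, rfl⟩
        · rintro ⟨y, hy, rfl⟩
          exact ⟨T.incl p.1.1 y, hy, rfl⟩
      rw [h2]
      exact (T.isCompact_fiber p.1.1).isClosed.isClosedEmbedding_subtypeVal.isClosedMap _
        hp.isClosed_compl
    have hpos : Metric.infEDist p.1.2 (T.complSection G p.1.1) ≠ 0 := by
      intro h0
      have := (Metric.mem_iff_infEDist_zero_of_closed hcl).2 h0
      obtain ⟨q, hq, hqp⟩ := this
      exact hq ((Subtype.ext hqp : q = p) ▸ hpG)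
    refine tendsto_const_nhds.congr' ?_
    obtain ⟨n, hn⟩ := ENNReal.exists_nat_mul_gt hpos ENNReal.one_ne_top
    filter_upwards [eventually_ge_atTop n] with k hk
    have : (1 : ℝ≥0∞) ≤ (k : ℝ≥0∞) *
        Metric.infEDist p.1.2 (T.complSection G p.1.1) :=
      hn.le.trans (by gcongr)
    rw [openApprox, min_eq_left this, ENNReal.toReal_one]
  · refine tendsto_const_nhds.congr fun k => ?_
    rw [T.openApprox_of_notMem k hpG, indicator_of_notMem hpG]

/-- Portmanteau for random open sets. -/
theorem NarrowTendsto.eventually_lt_measure {T : BundleRDS P ϑ X} {J : Type*}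
    {ν : J → Measure T.Total} {l : Filter J} {m : Measure T.Total} [∀ j, IsProbabilityMeasure (ν j)]
    [IsProbabilityMeasure m] (h : T.NarrowTendsto ν l m) (hm : m.map T.base = P)
    {G : Set T.Total} (hG : MeasurableSet G) (hGo : T.FiberOpen G) {c : ℝ} (hc : c < m.real G) :
    ∀ᶠ j in l, c < (ν j).real G := by
  obtain ⟨k, hk⟩ := ((T.tendsto_openApprox hm hG hGo).eventually_const_lt hc).exists
  filter_upwards [(h (T.openApproxRC hG k)).eventually_const_lt hk] with j hj
  refine hj.trans_le ?_
  rw [show (ν j).real G = ∫ p, G.indicator (fun _ => (1 : ℝ)) p ∂(ν j) by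
    rw [integral_indicator_const _ hG, smul_eq_mul, mul_one]]
  refine integral_mono ?_ ((integrable_const _).indicator hG) fun p => T.openApprox_le G k p
  exact Integrable.of_bound (T.measurable_openApprox hG k).aestronglyMeasurable 1
    (Eventually.of_forall fun p => T.abs_openApprox_le G k p)

theorem NarrowTendsto.eventually_measure_lt {T : BundleRDS P ϑ X} {J : Type*}
    {ν : J → Measure T.Total} {l : Filter J} {m : Measure T.Total} [∀ j, IsProbabilityMeasure (ν j)]
    [IsProbabilityMeasure m] (h : T.NarrowTendsto ν l m) (hm : m.map T.base = P)
    {F : Set T.Total} (hF : MeasurableSet F) (hFc : T.FiberOpen Fᶜ) {c : ℝ} (hc : m.real F < c) :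
    ∀ᶠ j in l, (ν j).real F < c := by
  have h1 : 1 - c < m.real Fᶜ := by rw [probReal_compl_eq_one_sub hF]; linarith
  filter_upwards [h.eventually_lt_measure hm hF.compl hFc h1] with j hj
  rw [probReal_compl_eq_one_sub hF] at hj
  linarith

/-- The inner open and the outer closed set have the same `m`-measure, and the two one-sided bounds
meet. -/
theorem NarrowTendsto.tendsto_measure {T : BundleRDS P ϑ X} {J : Type*}
    {ν : J → Measure T.Total} {l : Filter J} {m : Measure T.Total} [∀ j, IsProbabilityMeasure (ν j)]
    [IsProbabilityMeasure m] (h : T.NarrowTendsto ν l m) (hm : m.map T.base = P)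
    {D : Set T.Total} (hD : T.IsContSet m D) :
    Tendsto (fun j => ν j D) l (𝓝 (m D)) := by
  obtain ⟨G, F, hG, hF, hGo, hFc, hGD, hDF, h0⟩ := hD.exists_approx
  have hGF : G ⊆ F := hGD.trans hDF
  have e : m F = m G := by
    refine le_antisymm ?_ (measure_mono hGF)
    calc m F = m (G ∪ F \ G) := by rw [union_sdiff_cancel hGF]
      _ ≤ m G + m (F \ G) := measure_union_le _ _
      _ = m G := by rw [h0, add_zero]
  have eG : m.real G = m.real D := by
    simp only [measureReal_def]
    rw [le_antisymm (measure_mono hGD) ((measure_mono hDF).trans e.le)]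
  have eF : m.real F = m.real D := by
    rw [← eG]
    simp only [measureReal_def, e]
  have : Tendsto (fun j => (ν j).real D) l (𝓝 (m.real D)) := by
    refine tendsto_order.2 ⟨fun c hc => ?_, fun c hc => ?_⟩
    · filter_upwards [h.eventually_lt_measure hm hG hGo (eG ▸ hc)] with j hj
      exact hj.trans_le (measureReal_mono hGD)
    · filter_upwards [h.eventually_measure_lt hm hF hFc (eF ▸ hc)] with j hj
      exact (measureReal_mono hDF).trans_lt hj
  have := ENNReal.tendsto_ofReal this
  simpa [ofReal_measureReal] using this

end Narrow

end BundleRDS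

end

/-! ### Upper semicontinuity of conditional entropy in the measure. -/

noncomputable section

section UpperSemicontinuity

variable {Y ι κ : Type*} {S mY : MeasurableSpace Y} {μ : Measure Y}

theorem MeasureTheory.IsSetAlgebra.setOf_mem_eq_mem {𝒞 : Set (Set Y)} (h𝒞 : IsSetAlgebra 𝒞) [Finite κ]
    {C : κ → Set Y} (hC : ∀ v, C v ∈ 𝒞) (s : Set κ) : {y | {v | y ∈ C v} = s} ∈ 𝒞 := by
  classical
  have := Fintype.ofFinite κ
  have h : {y | {v | y ∈ C v} = s} = ⋂ v ∈ (Finset.univ : Finset κ),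
      if v ∈ s then C v else (C v)ᶜ := by
    ext y
    simp only [mem_ofPred_eq, Set.ext_iff, Finset.mem_univ, iInter_true, mem_iInter]
    refine forall_congr' fun v => ?_
    by_cases hv : v ∈ s <;> simp [hv]
  rw [h]
  refine h𝒞.biInter_mem _ fun v _ => ?_
  split_ifs
  · exact hC v
  · exact h𝒞.compl_mem (hC v)

theorem lintegral_finite_pair_eq_sum [Fintype ι] [Fintype κ] {ξ : Y → ι} {D : Y → κ}
    (h : ∀ i v, MeasurableSet (ξ ⁻¹' {i} ∩ D ⁻¹' {v})) (f : ι → κ → ℝ≥0∞) :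
    ∫⁻ y, f (ξ y) (D y) ∂μ = ∑ q : ι × κ, f q.1 q.2 * μ (ξ ⁻¹' {q.1} ∩ D ⁻¹' {q.2}) := by
  classical
  have : ∀ y, f (ξ y) (D y) =
      ∑ q : ι × κ, (ξ ⁻¹' {q.1} ∩ D ⁻¹' {q.2}).indicator (fun _ => f q.1 q.2) y := fun y => by
    rw [Finset.sum_eq_single (ξ y, D y)]
    · simp
    · rintro ⟨i, v⟩ _ hq
      refine indicator_of_notMem (fun hy => hq ?_) _
      simp only [mem_inter_iff, mem_preimage, mem_singleton_iff] at hy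
      rw [hy.1, hy.2]
    · simp
  simp_rw [this]
  rw [lintegral_finsetSum _ fun q _ => measurable_const.indicator (h q.1 q.2)]
  exact Finset.sum_congr rfl fun q _ => lintegral_indicator_const (h q.1 q.2) _

theorem MeasureTheory.IsSetAlgebra.exists_measure_symmDiff_lt {Z : Type*} [mZ : MeasurableSpace Z]
    (μ : Measure Z) [IsFiniteMeasure μ] {𝒞 : Set (Set Z)} (h𝒞 : IsSetAlgebra 𝒞)
    (hgen : mZ = MeasurableSpace.generateFrom 𝒞) {s : Set Z} (hs : MeasurableSet s) {ε : ℝ}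
    (hε : 0 < ε) : ∃ t ∈ 𝒞, MeasurableSet t ∧ μ (symmDiff s t) < ENNReal.ofReal ε := by
  have hdense := Measure.MeasureDense.of_generateFrom_isSetAlgebra_finite μ h𝒞 hgen
  obtain ⟨t, ht, h⟩ := hdense.approx s hs (measure_ne_top _ _) ε hε
  exact ⟨t, ht, hdense.measurable _ ht, h⟩

/-- Finite-valued `S`-measurable maps are approximated by maps with level sets in a given algebra
generating `S`. -/
theorem exists_approx_of_generateFrom [IsFiniteMeasure μ] (hS : S ≤ mY) {𝒞 : Set (Set Y)}
    (h𝒞 : IsSetAlgebra 𝒞) (hgen : S = MeasurableSpace.generateFrom 𝒞) [Finite κ]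
    {D : Y → κ} (hD : ∀ v, MeasurableSet[S] (D ⁻¹' {v})) {δ : ℝ≥0∞} (hδ : δ ≠ 0) :
    ∃ C : κ → Set Y, (∀ v, C v ∈ 𝒞) ∧ ∃ B, MeasurableSet B ∧ μ B ≤ δ ∧
      ∀ y ∉ B, {v | y ∈ C v} = {D y} := by
  have := Fintype.ofFinite κ
  obtain ⟨ε, hε0, hε⟩ := ENNReal.exists_nnreal_pos_mul_lt
    (ENNReal.natCast_ne_top (Fintype.card κ)) hδ
  -- The algebra generates only `S`, so density is used for the restriction of `μ` to `S`.
  have hC : ∀ v, ∃ t ∈ 𝒞, MeasurableSet[S] t ∧ μ (symmDiff (D ⁻¹' {v}) t) < ε := fun v => by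
    obtain ⟨t, ht, htS, h⟩ := @IsSetAlgebra.exists_measure_symmDiff_lt Y S (μ.trim hS)
      inferInstance 𝒞 h𝒞 hgen (D ⁻¹' {v}) (hD v) ε (by exact_mod_cast hε0)
    have hm : MeasurableSet[S] (symmDiff (D ⁻¹' {v}) t) :=
      @MeasurableSet.symmDiff _ S _ _ (hD v) htS
    rw [trim_measurableSet_eq hS hm] at h
    exact ⟨t, ht, htS, by simpa using h⟩
  choose C hC hCS hCμ using hC
  have hCm : ∀ v, MeasurableSet (C v) := fun v => hS _ (hCS v)
  refine ⟨C, hC, ⋃ v, symmDiff (D ⁻¹' {v}) (C v),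
    .iUnion fun v => (hS _ (hD v)).symmDiff (hCm v), ?_, fun y hy => ?_⟩
  · refine (measure_iUnion_le _).trans ?_
    rw [tsum_fintype]
    refine (Finset.sum_le_card_nsmul _ _ (ε : ℝ≥0∞) fun i _ => (hCμ i).le).trans ?_
    rw [Finset.card_univ, nsmul_eq_mul, mul_comm]
    exact hε.le
  · ext v
    have h := fun h => hy (mem_iUnion.2 ⟨v, h⟩)
    rw [mem_symmDiff] at h
    simp only [mem_preimage, mem_singleton_iff] at h
    simp only [mem_ofPred_eq, mem_singleton_iff]
    tauto

/-- A sub-probability vector of functions, rounded down to multiples of `1 / L`. -/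
def roundDown (L : ℕ) (g : ι → Y → ℝ≥0∞) (y : Y) (i : ι) : Fin (L + 1) :=
  ⟨min L ⌊L * (g i y).toReal⌋₊, Nat.lt_succ_of_le (min_le_left _ _)⟩

theorem measurableSet_preimage_roundDown (L : ℕ) [Finite ι] {g : ι → Y → ℝ≥0∞}
    (hg : ∀ i, Measurable[S] (g i)) (v : ι → Fin (L + 1)) :
    MeasurableSet[S] (roundDown L g ⁻¹' {v}) := by
  have : Measurable[S] (roundDown L g) := by
    refine @measurable_pi_lambda _ _ _ S _ _ fun i => ?_
    have h1 : Measurable[S] fun y => ⌊L * (g i y).toReal⌋₊ :=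
      Nat.measurable_floor.comp ((hg i).ennreal_toReal.const_mul _)
    exact (measurable_of_countable fun k : ℕ =>
      (⟨min L k, Nat.lt_succ_of_le (min_le_left _ _)⟩ : Fin (L + 1))).comp h1
  exact this (measurableSet_singleton v)

theorem sum_roundDown_le (L : ℕ) [Fintype ι] {g : ι → Y → ℝ≥0∞} (hg : IsSubProb S g) (y : Y) :
    ∑ i, ((roundDown L g y i : ℕ) : ℝ≥0∞) ≤ L := by
  have h1 : ∀ i, ((roundDown L g y i : ℕ) : ℝ≥0∞) ≤ L * g i y := fun i => by
    have hgt : g i y ≠ ∞ := ne_top_of_le_ne_top ENNReal.one_ne_top (hg.le_one i y)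
    have : ((roundDown L g y i : ℕ) : ℝ) ≤ L * (g i y).toReal :=
      (Nat.cast_le.2 (min_le_right _ _)).trans (Nat.floor_le (by positivity))
    rw [← ENNReal.ofReal_natCast, ← ENNReal.ofReal_toReal hgt, ← ENNReal.ofReal_natCast,
      ← ENNReal.ofReal_mul (by positivity)]
    exact ENNReal.ofReal_le_ofReal this
  calc _ ≤ ∑ i, L * g i y := Finset.sum_le_sum fun i _ => h1 i
    _ = L * ∑ i, g i y := by rw [Finset.mul_sum]
    _ ≤ L * 1 := by
      gcongr
      simpa using hg.tsum_le_one y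
    _ = L := mul_one _

theorem mul_le_roundDown_add_one (L : ℕ) {g : ι → Y → ℝ≥0∞} (hg : IsSubProb S g) (y : Y) (i : ι) :
    L * g i y ≤ ((roundDown L g y i : ℕ) : ℝ≥0∞) + 1 := by
  have hgt : g i y ≠ ∞ := ne_top_of_le_ne_top ENNReal.one_ne_top (hg.le_one i y)
  have h1 : (g i y).toReal ≤ 1 := ENNReal.toReal_le_of_le_ofReal zero_le_one (by simpa using hg.le_one i y)
  have h2 : ⌊L * (g i y).toReal⌋₊ ≤ L := by
    refine Nat.floor_le_of_le ?_
    nlinarith [(Nat.cast_nonneg L : (0 : ℝ) ≤ L)]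
  have : L * (g i y).toReal ≤ ((roundDown L g y i : ℕ) : ℝ) + 1 := by
    simp only [roundDown, min_eq_right h2]
    exact (Nat.lt_floor_add_one _).le
  have h3 := ENNReal.ofReal_le_ofReal this
  rwa [ENNReal.ofReal_mul (by positivity), ENNReal.ofReal_toReal hgt,
    ENNReal.ofReal_add (by positivity) zero_le_one, ENNReal.ofReal_natCast, ENNReal.ofReal_natCast,
    ENNReal.ofReal_one] at h3

/-- Upper semicontinuity of conditional entropy. -/
theorem eventually_codeEntropy_lt [IsProbabilityMeasure μ] (hS : S ≤ mY) {𝒞 : Set (Set Y)}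
    (h𝒞 : IsSetAlgebra 𝒞) (hgen : S = MeasurableSpace.generateFrom 𝒞) [Finite ι]
    [MeasurableSpace ι] [MeasurableSingletonClass ι] {ξ : Y → ι} (hξ : Measurable ξ)
    {J : Type*} {l : Filter J} {ν : J → Measure Y}
    (hν : ∀ i, ∀ D ∈ 𝒞, Tendsto (fun j => ν j (ξ ⁻¹' {i} ∩ D)) l (𝓝 (μ (ξ ⁻¹' {i} ∩ D))))
    {c : ℝ≥0∞} (hc : codeEntropy S μ ξ < c) :
    ∀ᶠ j in l, codeEntropy S (ν j) ξ < c := by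
  classical
  have := Fintype.ofFinite ι
  obtain ⟨g, hg, hgc⟩ := exists_lintegral_lt_of_codeEntropy_lt hc
  obtain ⟨η, hη, hηc⟩ : ∃ η : ℝ≥0∞, η ≠ 0 ∧ ∫⁻ y, neglog (g (ξ y) y) ∂μ + (η + η) < c := by
    obtain ⟨r, hr, hrc⟩ := exists_between hgc
    obtain ⟨η, hη, h⟩ := ENNReal.exists_nnreal_pos_mul_lt (a := 2) (b := c - r) (by simp)
      (tsub_pos_of_lt hrc).ne'
    refine ⟨η, by simpa using hη.ne', ?_⟩
    rw [← two_mul, mul_comm]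
    calc _ ≤ r + η * 2 := by gcongr
      _ < c := by
        have := ENNReal.add_lt_add_left (ne_top_of_lt hrc) h
        rwa [add_tsub_cancel_of_le hrc.le] at this
  have : Nonempty ι := by
    obtain ⟨y⟩ := nonempty_of_isProbabilityMeasure μ
    exact ⟨ξ y⟩
  obtain ⟨ε, hε0, hε1, hε⟩ := exists_neglog_one_sub_le hη
  let n : ℝ≥0∞ := Fintype.card ι
  have hn0 : n ≠ 0 := by simp [n]
  have hnt : n ≠ ∞ := by simp [n]
  have hεn : ε / n ≠ 0 := by simp [ENNReal.div_eq_zero_iff, hε0, hnt]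
  -- The rounding error `1 / L` is smaller than the uniform share `ε / n`, which absorbs it.
  obtain ⟨L, hL⟩ := ENNReal.exists_nat_mul_gt hεn ENNReal.one_ne_top
  have hL0 : (L : ℝ≥0∞) ≠ 0 := fun h => by simp [h] at hL
  obtain ⟨δ, hδ0, hδ⟩ := ENNReal.exists_nnreal_pos_mul_lt (neglog_ne_top hεn) hη
  -- The nearly optimal code `g` is replaced by one with finitely many values, whose level sets are
  -- then approximated by sets of the algebra.
  let κ := {v : ι → Fin (L + 1) // ∑ i, ((v i : ℕ) : ℝ≥0∞) ≤ L}
  let D : Y → κ := fun y => ⟨roundDown L g y, sum_roundDown_le L hg y⟩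
  have hD : ∀ v, MeasurableSet[S] (D ⁻¹' {v}) := fun v => by
    have : D ⁻¹' {v} = roundDown L g ⁻¹' {v.1} := by
      ext y
      exact Subtype.ext_iff
    rw [this]
    exact measurableSet_preimage_roundDown L hg.measurable v.1
  obtain ⟨C, hC, B, hB, hBδ, hCB⟩ := exists_approx_of_generateFrom (μ := μ) hS h𝒞 hgen hD
    (δ := δ) (by simpa using hδ0.ne')
  let v₀ : κ := ⟨fun _ => 0, by simp⟩
  -- The approximating sets need not be a partition, so the set of indices containing a point is
  -- decoded to some rounded vector. Any choice is a sub-probability; off `B` the set is a singleton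
  -- and the choice is correct.
  let F : Set κ → κ := fun s => if h : s.Nonempty then h.some else v₀
  have hF : ∀ v, F {v} = v := fun v => by
    have h : ({v} : Set κ).Nonempty := singleton_nonempty v
    have := h.some_mem
    simp only [F, dif_pos h]
    exact this
  let h : ι → Set κ → ℝ≥0∞ := fun i s => (1 - ε) * (((F s).1 i : ℕ) / L) + ε / n
  let E : Y → Set κ := fun y => {v | y ∈ C v}
  have hE : ∀ s, E ⁻¹' {s} ∈ 𝒞 := fun s => h𝒞.setOf_mem_eq_mem hC s
  have hES : ∀ s, MeasurableSet[S] (E ⁻¹' {s}) := fun s => by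
    rw [hgen]; exact MeasurableSpace.measurableSet_generateFrom (hE s)
  have hh : IsSubProb S fun i y => h i (E y) := by
    refine ⟨fun i => ?_, fun y => ?_⟩
    · have : Measurable[S, ⊤] E := @measurable_to_countable' _ _ ⊤ _ S _ hES
      exact (@measurable_from_top _ _ _ (h i)).comp this
    · simp only [h, tsum_fintype, Finset.sum_add_distrib, ← Finset.mul_sum, Finset.sum_const,
        Finset.card_univ, nsmul_eq_mul]
      change _ + n * (ε / n) ≤ 1
      rw [ENNReal.mul_div_cancel hn0 hnt]
      calc _ ≤ (1 - ε) * 1 + ε := by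
            gcongr
            simp only [div_eq_mul_inv]
            rw [← Finset.sum_mul, ← div_eq_mul_inv]
            exact ENNReal.div_le_of_le_mul (by rw [one_mul]; exact (F (E y)).2)
        _ = 1 := by rw [mul_one, tsub_add_cancel_of_le hε1.le]
  have hpair : ∀ i s, MeasurableSet (ξ ⁻¹' {i} ∩ E ⁻¹' {s}) := fun i s =>
    (hξ (measurableSet_singleton i)).inter (hS _ (hES s))
  have hcost : ∫⁻ y, neglog (h (ξ y) (E y)) ∂μ < c := by
    refine lt_of_le_of_lt ?_ hηc
    have h1 : ∀ y, neglog (h (ξ y) (E y)) ≤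
        neglog (g (ξ y) y) + (η + B.indicator (fun _ => neglog (ε / n)) y) := fun y => by
      by_cases hy : y ∈ B
      · rw [indicator_of_mem hy, ← add_assoc]
        exact (neglog_antitone (by exact le_add_self)).trans le_add_self
      · rw [indicator_of_notMem hy, add_zero]
        have hEy : E y = {D y} := hCB y hy
        have : (1 - ε) * g (ξ y) y ≤ h (ξ y) (E y) := by
          simp only [h, hEy, hF]
          have h2 : g (ξ y) y ≤ ((D y).1 (ξ y) : ℕ) / L + ε / n := by
            have h3 := mul_le_roundDown_add_one L hg y (ξ y)
            calc g (ξ y) y = L * g (ξ y) y / L := by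
                  rw [mul_comm, ENNReal.mul_div_cancel_right hL0 (by simp)]
              _ ≤ (((D y).1 (ξ y) : ℕ) + L * (ε / n)) / L := by
                gcongr
                exact h3.trans (add_le_add_right hL.le _)
              _ = _ := by
                rw [ENNReal.add_div, mul_comm (L : ℝ≥0∞) (ε / n),
                  ENNReal.mul_div_cancel_right hL0 (by simp)]
          calc _ ≤ (1 - ε) * (((D y).1 (ξ y) : ℕ) / L + ε / n) := by gcongr
            _ ≤ _ := by
              rw [mul_add]
              gcongr
              exact mul_le_of_le_one_left' tsub_le_self
        calc _ ≤ neglog ((1 - ε) * g (ξ y) y) := neglog_antitone this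
          _ ≤ neglog (1 - ε) + neglog (g (ξ y) y) := neglog_mul_le _ _
          _ ≤ _ := by rw [add_comm]; gcongr
    refine (lintegral_mono h1).trans ?_
    rw [lintegral_add_left (measurable_neglog_apply hS hg.measurable hξ),
      lintegral_add_left measurable_const, lintegral_const, measure_univ, mul_one,
      lintegral_indicator_const hB]
    gcongr
    calc _ ≤ neglog (ε / n) * δ := by gcongr
      _ ≤ η := by rw [mul_comm]; exact hδ.le
  -- The code length now takes finitely many values, all finite because of the uniform share, on
  -- sets whose measures converge by hypothesis. Hence this single code certifies the bound along
  -- the filter.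
  have hlim : Tendsto (fun j => ∫⁻ y, neglog (h (ξ y) (E y)) ∂(ν j)) l
      (𝓝 (∫⁻ y, neglog (h (ξ y) (E y)) ∂μ)) := by
    simp_rw [lintegral_finite_pair_eq_sum hpair fun i s => neglog (h i s)]
    refine tendsto_finsetSum _ fun q _ => ENNReal.Tendsto.const_mul (hν q.1 _ (hE q.2)) (Or.inr ?_)
    refine neglog_ne_top fun h0 => hεn ?_
    exact le_zero_iff.1 (le_add_self.trans h0.le)
  filter_upwards [hlim.eventually_lt_const hcost] with j hj
  exact (codeEntropy_le hh).trans_lt hj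

end UpperSemicontinuity

end

/-! ### Partitions with negligible boundaries, and the upper bound for the defect. -/

noncomputable section

section NullFrontier

variable {X : Type*} [MetricSpace X] [MeasurableSpace X]

theorem exists_ball_null_frontier [BorelSpace X] (ν : Measure X) [IsFiniteMeasure ν] (x : X) {ρ : ℝ} (hρ : 0 < ρ) :
    ∃ r, 0 < r ∧ r < ρ ∧ ν (frontier (Metric.ball x r)) = 0 := by
  obtain ⟨r, hr, h⟩ := exists_null_frontier_thickening ν {x} hρ
  rw [Metric.thickening_singleton] at h
  exact ⟨r, hr.1, hr.2, h⟩

theorem isSetAlgebra_null_frontier (ν : Measure X) :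
    IsSetAlgebra {V : Set X | MeasurableSet V ∧ ν (frontier V) = 0} where
  empty_mem := ⟨.empty, by simp⟩
  compl_mem := fun V hV => ⟨hV.1.compl, by rw [frontier_compl]; exact hV.2⟩
  union_mem := fun V W hV hW => ⟨hV.1.union hW.1, measure_mono_null
    ((frontier_union_subset V W).trans (union_subset_union inter_subset_left inter_subset_right))
    (measure_union_null hV.2 hW.2)⟩

/-- Finite partitions with small atoms, whose boundaries are negligible. -/
theorem exists_partition_null_frontier [BorelSpace X] [CompactSpace X] (ν : Measure X) [IsFiniteMeasure ν]
    {ρ : ℝ} (hρ : 0 < ρ) :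
    ∃ (s : ℕ) (a : X → Fin s), Measurable a ∧ (∀ i, ν (frontier (a ⁻¹' {i})) = 0) ∧
      ∀ x y, a x = a y → dist x y < ρ := by
  choose r hr0 hrρ hr using fun x => exists_ball_null_frontier ν x (half_pos hρ)
  obtain ⟨t, ht⟩ := isCompact_univ.elim_nhds_subcover (fun x => Metric.ball x (r x))
    fun x _ => Metric.ball_mem_nhds x (hr0 x)
  classical
  let e := Fintype.equivFin (Set t)
  -- An atom records which balls contain a point. Two points of one atom share a ball of radius less
  -- than `ρ / 2`, and boundaries of atoms lie in the finite union of the null spheres.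
  let b : X → Set t := fun x => {v | x ∈ Metric.ball v.1 (r v.1)}
  have hb : ∀ s, b ⁻¹' {s} ∈ {V : Set X | MeasurableSet V ∧ ν (frontier V) = 0} := fun s =>
    (isSetAlgebra_null_frontier ν).setOf_mem_eq_mem
      (fun v : t => ⟨Metric.isOpen_ball.measurableSet, hr v.1⟩) s
  have he : ∀ i, (fun x => e (b x)) ⁻¹' {i} = b ⁻¹' {e.symm i} := fun i => by
    ext x
    exact e.eq_symm_apply.symm
  refine ⟨_, fun x => e (b x), measurable_to_countable' fun i => ?_, fun i => ?_, fun x y hxy => ?_⟩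
  · rw [he]; exact (hb _).1
  · rw [he]; exact (hb _).2
  · have hxy' : b x = b y := e.injective hxy
    obtain ⟨v, hv, hxv⟩ := mem_iUnion₂.1 (ht.2 (mem_univ x))
    have hxb : (⟨v, hv⟩ : t) ∈ b x := hxv
    have hyb : (⟨v, hv⟩ : t) ∈ b y := hxy' ▸ hxb
    have hyv : dist y v < r v := hyb
    have hxv' : dist x v < r v := hxv
    linarith [dist_triangle_right x y v, hrρ v]

/-- In a second countable space every open set is a countable union of balls with null boundary. -/
theorem measurable_of_null_frontier_balls [BorelSpace X] [SecondCountableTopology X] {Y : Type*}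
    [MeasurableSpace Y] (ν : Measure X) [IsFiniteMeasure ν] {f : Y → X}
    (h : ∀ x r, ν (frontier (Metric.ball x r)) = 0 → MeasurableSet (f ⁻¹' Metric.ball x r)) :
    Measurable f := by
  refine measurable_of_isOpen fun V hV => ?_
  have hx : ∀ x : V, ∃ r, 0 < r ∧ Metric.ball x.1 r ⊆ V ∧
      ν (frontier (Metric.ball x.1 r)) = 0 := fun x => by
    obtain ⟨ρ, hρ, hV⟩ := Metric.isOpen_iff.1 hV x x.2
    obtain ⟨r, h0, h1, h2⟩ := exists_ball_null_frontier ν x.1 hρ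
    exact ⟨r, h0, (Metric.ball_subset_ball h1.le).trans hV, h2⟩
  choose r hr0 hrV hr using hx
  obtain ⟨t, ht, htV⟩ := TopologicalSpace.isOpen_iUnion_countable
    (fun x : V => Metric.ball x.1 (r x)) fun _ => Metric.isOpen_ball
  have : V = ⋃ x ∈ t, Metric.ball x.1 (r x) := by
    rw [htV]
    refine Subset.antisymm (fun x hx => mem_iUnion.2 ⟨⟨x, hx⟩, Metric.mem_ball_self (hr0 _)⟩)
      (iUnion_subset hrV)
  rw [this, preimage_iUnion₂]
  exact .biUnion ht fun x _ => h _ _ (hr x)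

end NullFrontier

namespace BundleRDS

section ContSet

variable {Ω : Type*} [MeasurableSpace Ω] {P : Measure Ω} {ϑ : Ω → Ω}
  {X : Type*} [MetricSpace X] [MeasurableSpace X]

theorem isContSet_base (T : BundleRDS P ϑ X) (m : Measure T.Total) {B : Set Ω}
    (hB : MeasurableSet B) : T.IsContSet m (T.base ⁻¹' B) := by
  have ho : ∀ C : Set Ω, T.FiberOpen (T.base ⁻¹' C) := fun C => Eventually.of_forall fun ω => by
    have : T.incl ω ⁻¹' (T.base ⁻¹' C) = {_x : T.fiber ω | ω ∈ C} := rfl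
    rw [this]
    exact isOpen_const
  have hm := T.measurable_base hB
  exact ⟨hm, _, _, hm, hm, ho B, ho Bᶜ, Subset.rfl, Subset.rfl, by simp⟩

theorem isContSet_comp [BorelSpace X] (T : BundleRDS P ϑ X) (m : Measure T.Total) {W : Type*}
    [TopologicalSpace W] [MeasurableSpace W] [BorelSpace W] {φ : X → W} (hφ : Continuous φ)
    {V : Set W} (hV : MeasurableSet V)
    (h0 : m.map (fun p => φ p.1.2) (frontier V) = 0) :
    T.IsContSet m {p | φ p.1.2 ∈ V} := by
  have hm : Measurable fun p : T.Total => φ p.1.2 :=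
    hφ.measurable.comp (measurable_snd.comp measurable_subtype_coe)
  have ho : ∀ U : Set W, IsOpen U → T.FiberOpen {p | φ p.1.2 ∈ U} := fun U hU =>
    Eventually.of_forall fun ω => hU.preimage (hφ.comp continuous_subtype_val)
  refine ⟨hm hV, {p | φ p.1.2 ∈ interior V}, {p | φ p.1.2 ∈ closure V},
    hm isOpen_interior.measurableSet, hm isClosed_closure.measurableSet, ho _ isOpen_interior,
    ho _ isClosed_closure.isOpen_compl, fun p hp => interior_subset (s := V) hp,
    fun p hp => subset_closure (s := V) hp, ?_⟩
  rw [Measure.map_apply hm isClosed_frontier.measurableSet] at h0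
  exact h0

theorem isSetAlgebra_isContSet (T : BundleRDS P ϑ X) (m : Measure T.Total)
    (S : MeasurableSpace T.Total) :
    IsSetAlgebra {D | MeasurableSet[S] D ∧ T.IsContSet m D} where
  empty_mem := ⟨@MeasurableSet.empty _ S, T.isContSet_base m (B := ∅) .empty⟩
  compl_mem := fun _ h => ⟨@MeasurableSet.compl _ _ S h.1, h.2.compl⟩
  union_mem := fun _ _ h h' => ⟨@MeasurableSet.union _ S _ _ h.1 h'.1, h.2.union h'.2⟩

theorem entropyRate_sqSnd_lt_top (T : BundleRDS P ϑ X) (hϑ : Measurable ϑ)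
    (m : T.square.InvMeasure) {s : ℕ} {a : X → Fin s} (ha : Measurable a) :
    entropyRate T.firstCoordSigma m.1 T.square.skew (fun p => a (T.sqSnd p)) < ∞ := by
  have := m.2.1
  refine (entropyRate_le_div (μ := m.1) T.firstCoordSigma_le (ha.comp T.measurable_sqSnd)
    m.2.2.2 (T.measurable_skew_firstCoordSigma hϑ) one_ne_zero).trans_lt ?_
  exact ENNReal.div_lt_top (ne_top_of_le_ne_top ENNReal.ofReal_ne_top (codeEntropy_le_log_card _))
    (by simp)

variable [CompactSpace X] [BorelSpace X]

/-- Sets of negligible boundary generate the σ-algebra of the first point, since balls with null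
boundary generate the Borel sets. They form the algebra on which `eventually_codeEntropy_lt` tests
convergence. -/
theorem firstCoordSigma_eq_generateFrom (T : BundleRDS P ϑ X) (m : Measure T.square.Total)
    [IsFiniteMeasure m] :
    T.firstCoordSigma = MeasurableSpace.generateFrom
      {D | MeasurableSet[T.firstCoordSigma] D ∧ T.square.IsContSet m D} := by
  refine le_antisymm ?_ (MeasurableSpace.generateFrom_le fun D hD => hD.1)
  have hν : IsFiniteMeasure (m.map fun p : T.square.Total => p.1.2.1) := inferInstance
  let 𝒢 := MeasurableSpace.generateFrom
      {D | MeasurableSet[T.firstCoordSigma] D ∧ T.square.IsContSet m D}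
  have hpair : Measurable[T.firstCoordSigma] fun p : T.square.Total => (p.1.1, p.1.2.1) :=
    comap_measurable _
  have h1 : Measurable[𝒢] fun p : T.square.Total => p.1.1 := fun B hB =>
    MeasurableSpace.measurableSet_generateFrom
      ⟨(measurable_fst.comp hpair) hB, T.square.isContSet_base m hB⟩
  have h2 : Measurable[𝒢] fun p : T.square.Total => p.1.2.1 := by
    refine @measurable_of_null_frontier_balls _ _ _ _ _ _ 𝒢 _ hν _ fun x r hx => ?_
    refine MeasurableSpace.measurableSet_generateFrom
      ⟨(measurable_snd.comp hpair) Metric.isOpen_ball.measurableSet,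
        T.square.isContSet_comp m continuous_fst Metric.isOpen_ball.measurableSet hx⟩
  have h3 : Measurable[𝒢] fun p : T.square.Total => (p.1.1, p.1.2.1) := h1.prodMk h2
  exact h3.comap_le

theorem exists_ballCover_lebesgue (T : BundleRDS P ϑ X) (k : ℕ) :
    ∃ ρ : ℝ, 0 < ρ ∧ ∀ x : X, ∃ j, ∀ p : T.Total, dist p.1.2 x < ρ →
      p ∈ (T.ballCover k).set j := by
  obtain ⟨δ, hδ, hL⟩ := lebesgue_number_lemma_of_metric (isCompact_univ (X := X))
    (c := fun i => Metric.ball ((exists_finite_ball_cover X k).choose_spec.choose i)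
      (1 / ((k : ℝ) + 1))) (fun _ => Metric.isOpen_ball)
    (exists_finite_ball_cover X k).choose_spec.choose_spec.ge
  refine ⟨δ, hδ, fun x => ?_⟩
  obtain ⟨i, hi⟩ := hL x (mem_univ x)
  exact ⟨i, fun p hp => hi hp⟩

theorem exists_partition_subordinate (T : BundleRDS P ϑ X) [IsProbabilityMeasure P] (ν : Measure X)
    [IsFiniteMeasure ν] (k : ℕ) :
    ∃ (s : ℕ) (a : X → Fin s) (q : Fin s → Fin (T.ballCover k).size), Measurable a ∧
      (∀ i, ν (frontier (a ⁻¹' {i})) = 0) ∧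
      ∀ p : T.Total, p ∈ (T.ballCover k).set (q (a p.1.2)) := by
  obtain ⟨ρ, hρ, hL⟩ := T.exists_ballCover_lebesgue k
  obtain ⟨s, a, ha, ha0, had⟩ := exists_partition_null_frontier ν hρ
  have hne := (T.ballCover k).nonempty_fin
  choose j hj using hL
  classical
  refine ⟨s, a, fun i => if h : ∃ x, a x = i then j h.choose else hne.some, ha, ha0, fun p => ?_⟩
  have h : ∃ x, a x = a p.1.2 := ⟨_, rfl⟩
  simp only [dif_pos h]
  exact hj _ _ (had _ _ h.choose_spec.symm)

variable [IsProbabilityMeasure P] [P.IsComplete]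

/-- The level sets of the itinerary are finite intersections of iterated preimages of atoms, so
their boundaries are negligible too. -/
theorem NarrowTendsto.eventually_codeEntropy_itinerary_lt {T : BundleRDS P ϑ X}
    (hϑ : MeasurePreserving ϑ P P) {m : Measure T.square.Total} [IsProbabilityMeasure m]
    (hm : m.map T.square.base = P) (hΘ : MeasurePreserving T.square.skew m m) {s : ℕ}
    {a : X → Fin s} (ha : Measurable a)
    (ha0 : ∀ i, m.map (fun p => p.1.2.2) (frontier (a ⁻¹' {i})) = 0)
    {J : Type*} {l : Filter J} {ν : J → Measure T.square.Total} [∀ j, IsProbabilityMeasure (ν j)]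
    (h : T.square.NarrowTendsto ν l m) (n : ℕ) {c : ℝ≥0∞}
    (hc : codeEntropy T.firstCoordSigma m
      (itinerary T.square.skew (fun p => a (T.sqSnd p)) n) < c) :
    ∀ᶠ j in l, codeEntropy T.firstCoordSigma (ν j)
      (itinerary T.square.skew (fun p => a (T.sqSnd p)) n) < c := by
  have hasnd : Measurable fun p => a (T.sqSnd p) := ha.comp T.measurable_sqSnd
  refine eventually_codeEntropy_lt T.firstCoordSigma_le
    (T.square.isSetAlgebra_isContSet m T.firstCoordSigma)
    (T.firstCoordSigma_eq_generateFrom m)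
    (measurable_itinerary hΘ.measurable hasnd n) (fun v D hD => ?_) hc
  refine h.tendsto_measure hm (IsContSet.inter ?_ hD.2)
  have : itinerary T.square.skew (fun p => a (T.sqSnd p)) n ⁻¹' {v} =
      ⋂ i : Fin n, T.square.skew^[i] ⁻¹' {p | p.1.2.2 ∈ a ⁻¹' {v i}} := by
    ext p
    simp only [mem_preimage, mem_singleton_iff, itinerary, funext_iff, mem_iInter]
    rfl
  rw [this]
  exact IsContSet.iInter fun i => IsContSet.preimage_iterate_skew hϑ hΘ
    (T.square.isContSet_comp m continuous_snd (ha (measurableSet_singleton _)) (ha0 (v i))) i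

theorem relEntropy_le_add_tailEntropyGiven (T : BundleRDS P ϑ X) (hϑ : MeasurePreserving ϑ P P)
    (Q : T.RandomCover) {s : ℕ} {a : X → Fin s} (ha : Measurable a)
    {q : Fin s → Fin Q.size} (hq : ∀ p : T.Total, p ∈ Q.set (q (a p.1.2)))
    (μ : T.square.InvMeasure) :
    T.square.relEntropy T.firstCoordSigma μ ≤
      entropyRate T.firstCoordSigma μ.1 T.square.skew (fun p => a (T.sqSnd p)) +
        T.tailEntropyGiven Q := by
  have := μ.2.1
  exact T.relEntropy_square_le hϑ.measurable μ fun r γ hγ =>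
    T.entropyRate_le_add_tailEntropyGiven hϑ Q ha hq hγ μ.2.2.1 μ.2.2.2

theorem limsup_relEntropy_le (T : BundleRDS P ϑ X) (hϑ : MeasurePreserving ϑ P P)
    (m : T.square.InvMeasure) (k : ℕ) :
    limsup (T.square.relEntropy T.firstCoordSigma) (𝓝 m) ≤
      T.square.relEntropy T.firstCoordSigma m + T.tailEntropyGiven (T.ballCover k) := by
  have := m.2.1
  obtain ⟨s, a, q, ha, ha0, hq⟩ := T.exists_partition_subordinate (m.1.map fun p => p.1.2.2) k
  set r := entropyRate T.firstCoordSigma m.1 T.square.skew (fun p => a (T.sqSnd p)) with hr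
  have hrm : r ≤ T.square.relEntropy T.firstCoordSigma m :=
    T.square.entropyRate_le_relEntropy hϑ.measurable (ha.comp T.measurable_sqSnd)
      T.firstCoordSigma_le m
  have hΘS := T.measurable_skew_firstCoordSigma hϑ.measurable
  have hrt : r ≠ ∞ := (T.entropyRate_sqSnd_lt_top hϑ.measurable m ha).ne
  refine ENNReal.le_of_forall_pos_le_add fun ε hε _ => ?_
  have hlt : r < r + ε := ENNReal.lt_add_right hrt (by simpa using hε.ne')
  -- Fixing one time at which the entropy per step at `m` is below `r + ε` reduces the estimate for
  -- nearby measures to a single semicontinuous quantity.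
  obtain ⟨n, hn, hn0⟩ := ((eventually_lt_of_limsup_lt (hr ▸ hlt)).and
    (eventually_gt_atTop 0)).exists
  have hn0' : (n : ℝ≥0∞) ≠ 0 := by simpa using hn0.ne'
  rw [ENNReal.div_lt_iff (Or.inl hn0') (Or.inl (ENNReal.natCast_ne_top n))] at hn
  have hconv : T.square.NarrowTendsto (fun μ : T.square.InvMeasure => μ.1) (𝓝 m) m.1 :=
    (T.square.tendsto_nhds_iff id (𝓝 m) m).1 tendsto_id
  have : ∀ μ : T.square.InvMeasure, IsProbabilityMeasure μ.1 := fun μ => μ.2.1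
  have hev := hconv.eventually_codeEntropy_itinerary_lt hϑ m.2.2.1 m.2.2.2 ha ha0 n hn
  refine limsup_le_of_le (by isBoundedDefault) ?_
  filter_upwards [hev] with μ hμ
  calc _ ≤ _ := T.relEntropy_le_add_tailEntropyGiven hϑ _ ha hq μ
    _ ≤ (r + ε) + T.tailEntropyGiven (T.ballCover k) := by
      gcongr
      refine (entropyRate_le_div (μ := μ.1) T.firstCoordSigma_le (ha.comp T.measurable_sqSnd)
        μ.2.2.2 hΘS hn0.ne').trans ?_
      exact ENNReal.div_le_of_le_mul hμ.le
    _ ≤ (T.square.relEntropy T.firstCoordSigma m + ε) + T.tailEntropyGiven (T.ballCover k) := by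
      gcongr
    _ = _ := by ring

theorem relEntropy_lt_top (T : BundleRDS P ϑ X) (hϑ : MeasurePreserving ϑ P P)
    (m : T.square.InvMeasure) {k : ℕ} (hk : T.tailEntropyGiven (T.ballCover k) < ∞) :
    T.square.relEntropy T.firstCoordSigma m < ∞ := by
  have := m.2.1
  obtain ⟨s, a, q, ha, ha0, hq⟩ := T.exists_partition_subordinate (m.1.map fun p => p.1.2.2) k
  exact (T.relEntropy_le_add_tailEntropyGiven hϑ _ ha hq m).trans_lt
    (ENNReal.add_lt_top.2 ⟨T.entropyRate_sqSnd_lt_top hϑ.measurable m ha, hk⟩)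

theorem exists_tailEntropyGiven_ballCover_le (T : BundleRDS P ϑ X) (hϑ : MeasurePreserving ϑ P P)
    (hT : T.tailEntropy ≠ ∞) {ε : ℝ≥0∞} (hε : ε ≠ 0) :
    ∃ k, T.tailEntropyGiven (T.ballCover k) ≤ T.tailEntropy + ε := by
  have hε2 : ε / 2 ≠ 0 := by simpa using hε
  have hlt : T.tailEntropy < T.tailEntropy + ε / 2 := ENNReal.lt_add_right hT hε2
  rw [tailEntropy] at hlt
  obtain ⟨Q, hQ, h⟩ := by simpa only [iInf_lt_iff] using hlt
  obtain ⟨k, hk⟩ := (T.tailEntropyGiven_ballCover_le hϑ hQ hε2).exists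
  refine ⟨k, hk.trans ?_⟩
  calc _ ≤ (T.tailEntropy + ε / 2) + ε / 2 := by
        gcongr
        exact h.le
    _ = _ := by rw [add_assoc, ENNReal.add_halves]

/-- The upper bound for the defect of upper semi-continuity. -/
theorem defect_le_tailEntropy (T : BundleRDS P ϑ X) (hϑ : MeasurePreserving ϑ P P)
    (m : T.square.InvMeasure) : T.square.defect T.firstCoordSigma m ≤ T.tailEntropy := by
  by_cases hT : T.tailEntropy = ∞
  · rw [hT]; exact le_top
  -- A finite tail entropy forces finite relative entropies, which excludes the infinite branch of
  -- the defect.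
  have hfin : T.square.relEntropy T.firstCoordSigma m < ∞ := by
    obtain ⟨k, hk⟩ := T.exists_tailEntropyGiven_ballCover_le hϑ hT one_ne_zero
    exact T.relEntropy_lt_top hϑ m (hk.trans_lt (ENNReal.add_lt_top.2 ⟨lt_top_iff_ne_top.2 hT, by simp⟩))
  rw [defect, if_pos hfin]
  refine ENNReal.le_of_forall_pos_le_add fun ε hε _ => ?_
  obtain ⟨k, hk⟩ := T.exists_tailEntropyGiven_ballCover_le hϑ hT (ε := ε) (by simpa using hε.ne')
  refine tsub_le_iff_left.2 ((T.limsup_relEntropy_le hϑ m k).trans ?_)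
  gcongr

end ContSet

end BundleRDS

end

/-! ### Limits of measures with given marginal, tested on products. -/

noncomputable section

section ProductLimit

open ProbabilityTheory

theorem tendsto_of_forall_approx {J : Type*} {l : Filter J} {u : J → ℝ} {a : ℝ}
    (h : ∀ ε > 0, ∃ (v : J → ℝ) (b : ℝ), Tendsto v l (𝓝 b) ∧ (∀ j, |u j - v j| ≤ ε) ∧
      |a - b| ≤ ε) : Tendsto u l (𝓝 a) := by
  refine Metric.tendsto_nhds.2 fun ε hε => ?_
  obtain ⟨v, b, hv, h1, h2⟩ := h (ε / 4) (by positivity)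
  filter_upwards [Metric.tendsto_nhds.1 hv (ε / 4) (by positivity)] with j hj
  have h3 := abs_le.1 (h1 j)
  have h4 := abs_le.1 h2
  have h5 := abs_lt.1 hj
  exact abs_lt.2 ⟨by linarith, by linarith⟩

variable {Ω : Type*} [MeasurableSpace Ω] {P : Measure Ω}

/-- Setwise compactness of the set of measures dominated by a finite measure. -/
theorem exists_measure_tendsto_of_le [IsFiniteMeasure P] {J : Type*} (U : Ultrafilter J)
    (μ : J → Measure Ω) (hμ : ∀ j, μ j ≤ P) :
    ∃ ν : Measure Ω, ν ≤ P ∧ ∀ A, MeasurableSet A → Tendsto (fun j => μ j A) U (𝓝 (ν A)) := by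
  have hex : ∀ A : Set Ω, ∃ c, Tendsto (fun j => μ j A) U (𝓝 c) := fun A => by
    obtain ⟨c, -, hc⟩ := isCompact_univ.ultrafilter_le_nhds (U.map fun j => μ j A) (by simp)
    exact ⟨c, hc⟩
  choose c hc using hex
  have hcP : ∀ A, c A ≤ P A := fun A => le_of_tendsto (hc A) (Eventually.of_forall fun j => hμ j A)
  have hadd : ∀ A B, Disjoint A B → MeasurableSet B → c (A ∪ B) = c A + c B := fun A B hAB hB => by
    refine tendsto_nhds_unique (hc _) (((hc A).add (hc B)).congr fun j => ?_)
    exact (measure_union hAB hB).symm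
  have h0 : c ∅ = 0 := le_zero_iff.1 ((hcP ∅).trans (by simp))
  have hsum : ∀ (f : ℕ → Set Ω), (∀ i, MeasurableSet (f i)) → Pairwise (Function.onFun Disjoint f) →
      c (⋃ i, f i) = ∑' i, c (f i) := fun f hf hd => by
    -- Finite additivity passes to the limit; countable additivity follows because the tails are
    -- dominated by tails of a convergent series for `P`.
    have hfin : ∀ n, c (⋃ i, f i) = ∑ i ∈ Finset.range n, c (f i) + c (⋃ i, f (i + n)) := by
      intro n
      induction n with
      | zero => simp
      | succ n ih =>
        rw [ih, Finset.sum_range_succ, add_assoc]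
        congr 1
        have : ⋃ i, f (i + n) = (⋃ i, f (i + (n + 1))) ∪ f n := by
          ext x
          simp only [mem_iUnion, mem_union]
          constructor
          · rintro ⟨i, hi⟩
            rcases i with _ | i
            · exact Or.inr (by simpa using hi)
            · exact Or.inl ⟨i, by rwa [show i + (n + 1) = i + 1 + n by ring]⟩
          · rintro (⟨i, hi⟩ | hi)
            · exact ⟨i + 1, by rwa [show i + 1 + n = i + (n + 1) by ring]⟩
            · exact ⟨0, by simpa using hi⟩
        rw [this, hadd _ _ _ (hf n), add_comm]
        exact disjoint_iUnion_left.2 fun i => hd (by lia)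
    have hsP : ∑' i, P (f i) ≠ ∞ := by
      rw [← measure_iUnion hd hf]
      exact measure_ne_top _ _
    have htail : Tendsto (fun n => c (⋃ i, f (i + n))) atTop (𝓝 0) := by
      refine tendsto_of_tendsto_of_tendsto_of_le_of_le tendsto_const_nhds
        (ENNReal.tendsto_sum_nat_add _ hsP) (fun _ => zero_le) fun n => ?_
      exact (hcP _).trans (measure_iUnion_le _)
    have h1 : Tendsto (fun n => ∑ i ∈ Finset.range n, c (f i) + c (⋃ i, f (i + n))) atTop
        (𝓝 (∑' i, c (f i) + 0)) := (ENNReal.tendsto_nat_tsum _).add htail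
    rw [add_zero] at h1
    exact tendsto_nhds_unique (tendsto_const_nhds.congr hfin) h1
  refine ⟨Measure.ofMeasurable (fun A _ => c A) h0 hsum, Measure.le_iff.2 fun A hA => ?_,
    fun A hA => ?_⟩
  · rw [Measure.ofMeasurable_apply A hA]
    exact hcP A
  · rw [Measure.ofMeasurable_apply A hA]
    exact hc A

theorem map_compProd_comap {Z X : Type*} [MeasurableSpace Z] [MeasurableSpace X]
    [IsFiniteMeasure P] {π : Ω → Z} (hπ : Measurable π) (κ : Kernel Z X) [IsMarkovKernel κ] :
    (P ⊗ₘ (κ.comap π hπ)).map (Prod.map π id) = (P.map π) ⊗ₘ κ := by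
  have : IsFiniteMeasure (P.map π) := inferInstance
  ext s hs
  have hm : Measurable (Prod.map π (id : X → X)) := hπ.prodMap measurable_id
  rw [Measure.map_apply hm hs, Measure.compProd_apply (hm hs), Measure.compProd_apply hs,
    lintegral_map (Kernel.measurable_kernel_prodMk_left hs) hπ]
  rfl

variable {X : Type*} [MetricSpace X] [MeasurableSpace X] [CompactSpace X] [BorelSpace X]

theorem integrable_comp_snd (ν : Measure (Ω × X)) [IsFiniteMeasure ν] (f : C(X, ℝ)) :
    Integrable (fun p : Ω × X => f p.2) ν :=
  Integrable.of_bound (f.continuous.measurable.comp measurable_snd).aestronglyMeasurable ‖f‖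
    (Eventually.of_forall fun p => f.norm_coe_le_norm p.2)

/-- After an affine change putting `f` in `[0, 1]`, the weighted marginals are dominated by `P`.
Their setwise limit has a density, from which `d` is obtained by undoing the change. -/
theorem exists_density_limit [IsProbabilityMeasure P] {J : Type*}
    (U : Ultrafilter J) (ν : J → Measure (Ω × X)) [∀ j, IsProbabilityMeasure (ν j)]
    (hν : ∀ j, (ν j).fst = P) (f : C(X, ℝ)) :
    ∃ d : Ω → ℝ, Measurable d ∧ Integrable d P ∧ ∀ A, MeasurableSet A →
      Tendsto (fun j => ∫ p in Prod.fst ⁻¹' A, f p.2 ∂ν j) U (𝓝 (∫ ω in A, d ω ∂P)) := by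
  have hfb : ∀ x, |f x| ≤ ‖f‖ := fun x => f.norm_coe_le_norm x
  have hfm : Measurable fun p : Ω × X => f p.2 := f.continuous.measurable.comp measurable_snd
  -- The summand `1` keeps the divisor positive when `f = 0`.
  let c : ℝ := 2 * ‖f‖ + 1
  have hc : 0 < c := by positivity
  let g : X → ℝ := fun x => (f x + ‖f‖) / c
  have hg0 : ∀ x, 0 ≤ g x := fun x => div_nonneg (by linarith [neg_le_of_abs_le (hfb x)]) hc.le
  have hg1 : ∀ x, g x ≤ 1 := fun x => (div_le_one hc).2 (by linarith [le_of_abs_le (hfb x)])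
  have hgm : Measurable fun p : Ω × X => g p.2 := (hfm.add_const _).div_const _
  let μ : J → Measure Ω := fun j => ((ν j).withDensity fun p => ENNReal.ofReal (g p.2)).fst
  have hμ : ∀ j A, MeasurableSet A → μ j A = ∫⁻ p in Prod.fst ⁻¹' A, ENNReal.ofReal (g p.2) ∂ν j :=
    fun j A hA => by
      rw [Measure.fst_apply hA, withDensity_apply _ (measurable_fst hA)]
  have hμP : ∀ j, μ j ≤ P := fun j => Measure.le_iff.2 fun A hA => by
    rw [hμ j A hA]
    calc _ ≤ ∫⁻ p in Prod.fst ⁻¹' A, 1 ∂ν j :=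
          lintegral_mono fun p => by simpa using hg1 p.2
      _ = P A := by rw [setLIntegral_one, ← hν j, Measure.fst_apply hA]
  obtain ⟨ρ, hρP, hρ⟩ := exists_measure_tendsto_of_le U μ hμP
  have hρac : ρ ≪ P := Measure.absolutelyContinuous_of_le hρP
  have : IsFiniteMeasure ρ := isFiniteMeasure_of_le P hρP
  let d : Ω → ℝ := fun ω => c * (ρ.rnDeriv P ω).toReal - ‖f‖
  have hdm : Measurable d := ((Measure.measurable_rnDeriv ρ P).ennreal_toReal.const_mul c).sub_const _
  have hdi : Integrable (fun ω => (ρ.rnDeriv P ω).toReal) P := Measure.integrable_toReal_rnDeriv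
  refine ⟨d, hdm, (hdi.const_mul c).sub (integrable_const _), fun A hA => ?_⟩
  have h1 : ∫ ω in A, d ω ∂P = c * (ρ A).toReal - P.real A * ‖f‖ := by
    simp only [d]
    rw [integral_sub (hdi.const_mul c).integrableOn (integrable_const _).integrableOn,
      integral_const_mul, Measure.setIntegral_toReal_rnDeriv hρac, setIntegral_const, smul_eq_mul]
    rfl
  have h2 : ∀ j, ∫ p in Prod.fst ⁻¹' A, f p.2 ∂ν j = c * (μ j A).toReal - P.real A * ‖f‖ := by
    intro j
    have hgi : Integrable (fun p : Ω × X => g p.2) (ν j) :=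
      Integrable.of_bound hgm.aestronglyMeasurable 1 (Eventually.of_forall fun p => by
        rw [Real.norm_eq_abs, abs_of_nonneg (hg0 _)]; exact hg1 _)
    have e : ∀ p : Ω × X, f p.2 = c * g p.2 - ‖f‖ := fun p => by
      simp only [g]
      field_simp
      ring
    simp_rw [e]
    rw [integral_sub (hgi.const_mul c).integrableOn (integrable_const _).integrableOn,
      integral_const_mul, setIntegral_const, smul_eq_mul, hμ j A hA,
      integral_eq_lintegral_of_nonneg_ae (Eventually.of_forall fun p => hg0 _)
        hgm.aestronglyMeasurable]
    congr 2
    rw [measureReal_def, measureReal_def, ← hν j, Measure.fst_apply hA]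
  rw [h1]
  simp_rw [h2]
  have hρA : ρ A ≠ ∞ := measure_ne_top _ _
  exact (((ENNReal.tendsto_toReal hρA).comp (hρ A hA)).const_mul c).sub_const _

theorem setIntegral_compProd_snd [IsFiniteMeasure P] (κ : Kernel Ω X) [IsMarkovKernel κ]
    {A : Set Ω} (hA : MeasurableSet A) (f : C(X, ℝ)) :
    ∫ p in Prod.fst ⁻¹' A, f p.2 ∂(P ⊗ₘ κ) = ∫ ω in A, ∫ x, f x ∂κ ω ∂P := by
  have := Measure.setIntegral_compProd (μ := P) (κ := κ) hA MeasurableSet.univ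
    (f := fun p => f p.2) (integrable_comp_snd _ f).integrableOn
  simpa [prod_univ] using this

theorem abs_setIntegral_sub_le (ν : Measure (Ω × X)) [IsProbabilityMeasure ν] (f g : C(X, ℝ))
    (A : Set (Ω × X)) : |∫ p in A, f p.2 ∂ν - ∫ p in A, g p.2 ∂ν| ≤ ‖f - g‖ := by
  rw [← integral_sub (integrable_comp_snd ν f).integrableOn (integrable_comp_snd ν g).integrableOn,
    ← Real.norm_eq_abs]
  refine (norm_setIntegral_le_of_norm_le_const (C := ‖f - g‖) (measure_lt_top _ _)
    fun p _ => (f - g).norm_coe_le_norm p.2).trans ?_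
  exact mul_le_of_le_one_right (norm_nonneg _) measureReal_le_one

theorem ae_eq_of_forall_mem_piSystem {Y : Type*} [mY : MeasurableSpace Y] {P : Measure[mY] Y}
    [IsFiniteMeasure P] {𝒞 : Set (Set Y)} (h𝒞 : IsPiSystem 𝒞)
    (hle : MeasurableSpace.generateFrom 𝒞 ≤ mY) {f g : Y → ℝ}
    (hfm : StronglyMeasurable[MeasurableSpace.generateFrom 𝒞] f)
    (hgm : StronglyMeasurable[MeasurableSpace.generateFrom 𝒞] g) (hf : Integrable f P)
    (hg : Integrable g P) (huniv : ∫ ω, f ω ∂P = ∫ ω, g ω ∂P)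
    (h : ∀ A ∈ 𝒞, ∫ ω in A, f ω ∂P = ∫ ω in A, g ω ∂P) : f =ᵐ[P] g := by
  refine ae_eq_of_forall_setIntegral_eq_of_sigmaFinite' hle (fun _ _ _ => hf.integrableOn)
    (fun _ _ _ => hg.integrableOn) (fun A hA _ => ?_) hfm.aestronglyMeasurable
    hgm.aestronglyMeasurable
  induction A, hA using MeasurableSpace.induction_on_inter (m := MeasurableSpace.generateFrom 𝒞)
    rfl h𝒞 with
  | empty => simp
  | basic A hA => exact h A hA
  | compl A hA ih => rw [setIntegral_compl (hle _ hA) hf, setIntegral_compl (hle _ hA) hg, huniv,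
      ih (measure_lt_top _ _)]
  | iUnion F hd hF ih =>
    rw [integral_iUnion (fun i => hle _ (hF i)) hd hf.integrableOn,
      integral_iUnion (fun i => hle _ (hF i)) hd hg.integrableOn]
    exact tsum_congr fun i => ih i (measure_lt_top _ _)

/-- A measurable map to the Cantor space through which countably many given functions factor. -/
theorem exists_clopen_factor {Y : Type*} [mY : MeasurableSpace Y] {P : Measure[mY] Y} [IsFiniteMeasure P]
    {d : ℕ → Y → ℝ} (hdm : ∀ n, Measurable (d n)) (hdi : ∀ n, Integrable (d n) P) :
    ∃ π : Y → ℕ → Bool, Measurable π ∧ ∀ n (e : (ℕ → Bool) → ℝ), Measurable e →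
      Integrable (fun ω => e (π ω)) P →
      (∀ C, IsClopen C → ∫ ω in π ⁻¹' C, d n ω ∂P = ∫ ω in π ⁻¹' C, e (π ω) ∂P) →
      d n =ᵐ[P] fun ω => e (π ω) := by
  -- The σ-algebra generated by the functions `d n` is countably generated, hence coded by a map to
  -- the Cantor space. Preimages of clopen sets are a generating π-system for it.
  obtain ⟨m₀, hm₀, hcg, hd₀⟩ : ∃ m₀ ≤ mY, @MeasurableSpace.CountablyGenerated Y m₀ ∧
      ∀ n, Measurable[m₀] (d n) :=
    ⟨MeasurableSpace.comap (fun ω n => d n ω) MeasurableSpace.pi,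
      (measurable_pi_lambda _ hdm).comap_le, MeasurableSpace.CountablyGenerated.comap _,
      fun n => (measurable_pi_apply n).comp (comap_measurable fun ω n => d n ω)⟩
  let π : Y → ℕ → Bool := @MeasurableSpace.mapNatBool Y m₀ hcg
  have hπ₀ : Measurable[m₀] π := @MeasurableSpace.measurable_mapNatBool Y m₀ hcg
  let 𝒜 : Set (Set Y) := {A | ∃ C : Set (ℕ → Bool), IsClopen C ∧ π ⁻¹' C = A}
  have hpi : IsPiSystem 𝒜 := by
    rintro _ ⟨C, hC, rfl⟩ _ ⟨C', hC', rfl⟩ _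
    exact ⟨C ∩ C', hC.inter hC', rfl⟩
  have hgen : MeasurableSpace.generateFrom 𝒜 = m₀ := by
    refine le_antisymm (MeasurableSpace.generateFrom_le ?_) ?_
    · rintro _ ⟨C, hC, rfl⟩
      exact hπ₀ hC.isClosed.measurableSet
    · rw [← @MeasurableSpace.generateFrom_natGeneratingSequence Y m₀ hcg]
      refine MeasurableSpace.generateFrom_mono ?_
      rintro _ ⟨n, rfl⟩
      refine ⟨{z | z n = true}, (isClopen_discrete {true}).preimage (continuous_apply n), ?_⟩
      ext ω
      simp [π, MeasurableSpace.mapNatBool]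
  refine ⟨π, hπ₀.mono hm₀ le_rfl, fun n e he hei h => ?_⟩
  refine ae_eq_of_forall_mem_piSystem (mY := mY) hpi (hgen.le.trans hm₀) ?_ ?_ (hdi n) hei ?_ ?_
  · rw [hgen]; exact (hd₀ n).stronglyMeasurable
  · rw [hgen]; exact (he.comp hπ₀).stronglyMeasurable
  · simpa using h univ isClopen_univ
  · rintro _ ⟨C, hC, rfl⟩
    exact h C hC

/-- Limits along ultrafilters of measures with a given marginal, tested on products. -/
theorem exists_limit_prod [IsProbabilityMeasure P] {J : Type*}
    (U : Ultrafilter J) (ν : J → Measure (Ω × X)) [∀ j, IsProbabilityMeasure (ν j)]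
    (hν : ∀ j, (ν j).fst = P) :
    ∃ m : Measure (Ω × X), IsProbabilityMeasure m ∧ m.fst = P ∧
      ∀ A, MeasurableSet A → ∀ f : C(X, ℝ),
        Tendsto (fun j => ∫ p in Prod.fst ⁻¹' A, f p.2 ∂ν j) U
          (𝓝 (∫ p in Prod.fst ⁻¹' A, f p.2 ∂m)) := by
  have hX : Nonempty X := by
    obtain ⟨p⟩ := nonempty_of_isProbabilityMeasure (ν (U.nonempty_of_mem univ_mem).some)
    exact ⟨p.2⟩
  let φ : ℕ → C(X, ℝ) := TopologicalSpace.denseSeq C(X, ℝ)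
  choose d hdm hdi hd using fun n => exists_density_limit U ν hν (φ n)
  obtain ⟨π, hπ, hfac⟩ := exists_clopen_factor hdm hdi
  have hπX : Measurable (Prod.map π (id : X → X)) := hπ.prodMap measurable_id
  let ν' : J → ProbabilityMeasure ((ℕ → Bool) × X) := fun j =>
    ⟨(ν j).map (Prod.map π id), Measure.isProbabilityMeasure_map hπX.aemeasurable⟩
  -- On the compact product of the Cantor space with `X` the image measures converge weakly; the
  -- disintegration of the limit is then lifted to `Ω` through `π`.
  obtain ⟨ρ, -, hρ⟩ := isCompact_univ.ultrafilter_le_nhds (U.map ν') (by simp)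
  have hlim : Tendsto ν' U (𝓝 ρ) := hρ
  have hρfst : (ρ : Measure ((ℕ → Bool) × X)).fst = P.map π := by
    let P' : ProbabilityMeasure (ℕ → Bool) := ⟨P.map π, Measure.isProbabilityMeasure_map hπ.aemeasurable⟩
    have h1 := ProbabilityMeasure.tendsto_map_of_tendsto_of_continuous ν' ρ hlim continuous_fst
    have h2 : ∀ j, (ν' j).map continuous_fst.measurable.aemeasurable = P' := fun j => by
      refine Subtype.ext ?_
      change ((ν j).map (Prod.map π id)).map Prod.fst = P.map π
      rw [Measure.map_map measurable_fst hπX, ← hν j, Measure.fst,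
        Measure.map_map hπ measurable_fst]
      rfl
    simp_rw [h2] at h1
    have h3 : ρ.map continuous_fst.measurable.aemeasurable = P' :=
      tendsto_nhds_unique h1 tendsto_const_nhds
    exact congrArg Subtype.val h3
  let κ : Kernel (ℕ → Bool) X := (ρ : Measure ((ℕ → Bool) × X)).condKernel
  let m : Measure (Ω × X) := P ⊗ₘ (κ.comap π hπ)
  have hmρ : m.map (Prod.map π id) = ρ := by
    rw [map_compProd_comap, ← hρfst]
    exact Measure.disintegrate _ _
  have hset : ∀ (ξ : Measure (Ω × X)) (C : Set (ℕ → Bool)), IsClopen C → ∀ f : C(X, ℝ),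
      ∫ p in Prod.fst ⁻¹' (π ⁻¹' C), f p.2 ∂ξ =
        ∫ z, (Prod.fst ⁻¹' C).indicator (fun z => f z.2) z ∂(ξ.map (Prod.map π id)) :=
    fun ξ C hC f => by
      have hC' : MeasurableSet (Prod.fst ⁻¹' C : Set ((ℕ → Bool) × X)) :=
        measurable_fst hC.isClosed.measurableSet
      have hf : Measurable fun z : (ℕ → Bool) × X => f z.2 :=
        f.continuous.measurable.comp measurable_snd
      rw [integral_indicator hC', setIntegral_map hC' hf.aestronglyMeasurable hπX.aemeasurable]
      rfl
  have hclopen : ∀ C : Set (ℕ → Bool), IsClopen C → ∀ f : C(X, ℝ),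
      Tendsto (fun j => ∫ p in Prod.fst ⁻¹' (π ⁻¹' C), f p.2 ∂ν j) U
        (𝓝 (∫ p in Prod.fst ⁻¹' (π ⁻¹' C), f p.2 ∂m)) := fun C hC f => by
    simp_rw [hset _ C hC f]
    rw [hmρ]
    have hcont : Continuous ((Prod.fst ⁻¹' C).indicator fun z : (ℕ → Bool) × X => f z.2) :=
      (f.continuous.comp continuous_snd).indicator (by simp [(hC.preimage continuous_fst).frontier_eq])
    exact ProbabilityMeasure.tendsto_iff_forall_integral_tendsto.1 hlim
      (BoundedContinuousFunction.mkOfCompact ⟨_, hcont⟩)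
  have hmint : ∀ A, MeasurableSet A → ∀ f : C(X, ℝ), ∫ p in Prod.fst ⁻¹' A, f p.2 ∂m =
      ∫ ω in A, ∫ x, f x ∂κ (π ω) ∂P := fun A hA f => setIntegral_compProd_snd _ hA f
  have hprob : IsProbabilityMeasure m := inferInstance
  refine ⟨m, hprob, Measure.fst_compProd _ _, fun A hA f => ?_⟩
  -- Weak convergence identifies the integrals over preimages of clopen sets, where indicators are
  -- continuous. Since `d n` factors through `π`, this identifies it almost everywhere and gives
  -- convergence over all measurable `A`.
  have hae : ∀ n, d n =ᵐ[P] fun ω => ∫ x, φ n x ∂κ (π ω) := fun n => by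
    have hm : Measurable fun z => ∫ x, φ n x ∂κ z :=
      ((φ n).continuous.measurable.stronglyMeasurable.integral_kernel).measurable
    refine hfac n (fun z => ∫ x, φ n x ∂κ z) hm ?_ fun C hC => ?_
    · refine Integrable.of_bound (hm.comp hπ).aestronglyMeasurable ‖φ n‖
        (Eventually.of_forall fun ω => ?_)
      refine (norm_integral_le_of_norm_le_const
        (Eventually.of_forall fun x => (φ n).norm_coe_le_norm x)).trans ?_
      simp
    · have hCm := hπ hC.isClosed.measurableSet
      rw [← hmint _ hCm]
      exact tendsto_nhds_unique (hd n _ hCm) (hclopen C hC (φ n))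
  refine tendsto_of_forall_approx fun ε hε => ?_
  obtain ⟨n, hn⟩ := (TopologicalSpace.denseRange_denseSeq C(X, ℝ)).exists_dist_lt f hε
  rw [dist_eq_norm] at hn
  refine ⟨_, _, hd n A hA, fun j => (abs_setIntegral_sub_le _ _ _ _).trans hn.le, ?_⟩
  rw [setIntegral_congr_ae (g := fun ω => ∫ x, φ n x ∂κ (π ω)) hA
    ((hae n).mono fun ω hω _ => hω), ← hmint A hA]
  exact (abs_setIntegral_sub_le _ _ _ _).trans hn.le

end ProductLimit

end

/-! ### From products to random continuous functions and random closed sets. -/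

noncomputable section

section Caratheodory

variable {Ω : Type*} [MeasurableSpace Ω] {P : Measure Ω}
  {X : Type*} [MetricSpace X] [MeasurableSpace X] [CompactSpace X]

/-- The space `C(X, ℝ)` is separable; the first member of a dense sequence close to `F (ω, ·)`
depends measurably on `ω`, as closeness need only be tested on a countable dense set of points. -/
theorem exists_measurable_index_continuousMap {F : Ω × X → ℝ} (hF : Measurable F)
    (hFc : ∀ ω, Continuous fun x => F (ω, x)) {ε : ℝ} (hε : 0 < ε) :
    ∃ (φ : ℕ → C(X, ℝ)) (N : Ω → ℕ), Measurable N ∧ ∀ p : Ω × X, |F p - φ (N p.1) p.2| ≤ ε := by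
  let φ : ℕ → C(X, ℝ) := TopologicalSpace.denseSeq C(X, ℝ)
  have hex : ∀ ω, ∃ n, ∀ x, |F (ω, x) - φ n x| ≤ ε := fun ω => by
    obtain ⟨n, hn⟩ := (TopologicalSpace.denseRange_denseSeq C(X, ℝ)).exists_dist_lt
      (⟨_, hFc ω⟩ : C(X, ℝ)) hε
    exact ⟨n, fun x => (ContinuousMap.dist_lt_iff hε).1 hn x |>.le⟩
  classical
  refine ⟨φ, fun ω => Nat.find (hex ω), measurable_find hex fun n => ?_,
    fun p => Nat.find_spec (hex p.1) p.2⟩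
  obtain ⟨s, hs, hsd⟩ := TopologicalSpace.exists_countable_dense X
  have : {ω | ∀ x, |F (ω, x) - φ n x| ≤ ε} = ⋂ x ∈ s, {ω | |F (ω, x) - φ n x| ≤ ε} := by
    ext ω
    simp only [mem_ofPred_eq, mem_iInter]
    refine ⟨fun h x _ => h x, fun h x => ?_⟩
    have hcl : IsClosed {x | |F (ω, x) - φ n x| ≤ ε} :=
      isClosed_le ((hFc ω).sub (φ n).continuous).abs continuous_const
    exact hcl.closure_subset_iff.2 h (hsd x)
  rw [this]
  refine .biInter hs fun x _ => measurableSet_le ?_ measurable_const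
  exact ((hF.comp (measurable_id.prodMk measurable_const)).sub_const _).abs

/-- Convergence of measures with a given marginal, tested on products. -/
def ProdTendsto {J : Type*} (ν : J → Measure (Ω × X)) (l : Filter J) (m : Measure (Ω × X)) : Prop :=
  ∀ A, MeasurableSet A → ∀ f : C(X, ℝ), Tendsto (fun j => ∫ p in Prod.fst ⁻¹' A, f p.2 ∂ν j) l
    (𝓝 (∫ p in Prod.fst ⁻¹' A, f p.2 ∂m))

variable [BorelSpace X] [IsProbabilityMeasure P] {J : Type*} {l : Filter J} {ν : J → Measure (Ω × X)}
  [∀ j, IsProbabilityMeasure (ν j)] {m : Measure (Ω × X)} [IsProbabilityMeasure m]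

/-- Where the index is below `K`, the function is uniformly close to a finite sum of products. The
remaining `ω` have small `P`-measure, which is the same for all the measures involved. -/
theorem ProdTendsto.tendsto_integral (h : ProdTendsto ν l m) (hν : ∀ j, (ν j).fst = P)
    (hm : m.fst = P) {F : Ω × X → ℝ} (hF : Measurable F)
    (hFc : ∀ ω, Continuous fun x => F (ω, x)) (hF1 : ∀ p, |F p| ≤ 1) :
    Tendsto (fun j => ∫ p, F p ∂ν j) l (𝓝 (∫ p, F p ∂m)) := by
  refine tendsto_of_forall_approx fun ε hε => ?_
  obtain ⟨φ, N, hN, hφ⟩ := exists_measurable_index_continuousMap hF hFc (half_pos hε)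
  have hs : Tendsto (fun K : ℕ => P.real {ω | K ≤ N ω}) atTop (𝓝 0) := by
    have hI : ⋂ K : ℕ, {ω | K ≤ N ω} = ∅ := by
      ext ω
      simp only [mem_iInter, mem_ofPred_eq, mem_empty_iff_false, iff_false, not_forall, not_le]
      exact ⟨N ω + 1, Nat.lt_succ_self _⟩
    have := tendsto_measure_iInter_atTop (μ := P) (s := fun K : ℕ => {ω | K ≤ N ω})
      (fun K => (measurableSet_le measurable_const hN).nullMeasurableSet)
      (fun a b hab y (hy : b ≤ N y) => hab.trans hy) ⟨0, measure_ne_top _ _⟩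
    rw [hI, measure_empty] at this
    exact (ENNReal.tendsto_toReal ENNReal.zero_ne_top).comp this
  obtain ⟨K, hK⟩ := (hs.eventually_lt_const (half_pos hε)).exists
  let B : Set (Ω × X) := Prod.fst ⁻¹' {ω | K ≤ N ω}
  have hBm : MeasurableSet {ω | K ≤ N ω} := measurableSet_le measurable_const hN
  have hB : MeasurableSet B := measurable_fst hBm
  let A : ℕ → Set (Ω × X) := fun n => Prod.fst ⁻¹' (N ⁻¹' {n})
  have hA : ∀ n, MeasurableSet (A n) := fun n => measurable_fst (hN (measurableSet_singleton n))
  let G : Ω × X → ℝ := fun p => ∑ n ∈ Finset.range K, (A n).indicator (fun p => φ n p.2) p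
  have hGi : ∀ (ξ : Measure (Ω × X)) [IsProbabilityMeasure ξ] (n : ℕ),
      Integrable ((A n).indicator fun p : Ω × X => φ n p.2) ξ := fun ξ _ n =>
    (integrable_comp_snd ξ (φ n)).indicator (hA n)
  have hFG : ∀ p, |F p - G p| ≤ ε / 2 + B.indicator (fun _ => (1 : ℝ)) p := fun p => by
    have hne : ∀ n, n ≠ N p.1 → (A n).indicator (fun p : Ω × X => φ n p.2) p = 0 := fun n hn =>
      indicator_of_notMem (fun hp => hn (by simpa [A, eq_comm] using hp)) _
    by_cases hp : K ≤ N p.1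
    · have hG0 : G p = 0 := Finset.sum_eq_zero fun n hn => hne n (by
        have := Finset.mem_range.1 hn; lia)
      have hpB : p ∈ B := hp
      rw [hG0, sub_zero, indicator_of_mem hpB]
      linarith [hF1 p]
    · have hpB : p ∉ B := hp
      have hGN : G p = φ (N p.1) p.2 := by
        simp only [G]
        rw [Finset.sum_eq_single (N p.1)]
        · exact indicator_of_mem (by simp [A]) _
        · exact fun n _ hn => hne n hn
        · intro h; exact absurd (Finset.mem_range.2 (not_le.1 hp)) h
      rw [hGN, indicator_of_notMem hpB, add_zero]
      exact hφ p
  have hbound : ∀ (ξ : Measure (Ω × X)) [IsProbabilityMeasure ξ], ξ.fst = P →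
      |∫ p, F p ∂ξ - ∫ p, G p ∂ξ| ≤ ε := fun ξ _ hξ => by
    have hFi : Integrable F ξ := Integrable.of_bound hF.aestronglyMeasurable 1
      (Eventually.of_forall hF1)
    have hGi' : Integrable G ξ := integrable_finsetSum _ fun n _ => hGi ξ n
    have hBi : Integrable (B.indicator fun _ => (1 : ℝ)) ξ := (integrable_const _).indicator hB
    rw [← integral_sub hFi hGi']
    refine abs_integral_le_integral_abs.trans ((integral_mono (hFi.sub hGi').abs
      ((integrable_const (ε / 2)).add hBi) hFG).trans ?_)
    have e : ∫ p, (ε / 2 + B.indicator (fun _ => (1 : ℝ)) p) ∂ξ = ε / 2 + ξ.real B := by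
      rw [integral_add (integrable_const _) hBi, integral_indicator_const _ hB]
      simp
    have e2 : ξ.real B = P.real {ω | K ≤ N ω} := by
      rw [measureReal_def, measureReal_def, ← hξ, Measure.fst_apply hBm]
    refine (e.trans (congrArg _ e2)).le.trans ?_
    linarith
  refine ⟨fun j => ∫ p, G p ∂ν j, ∫ p, G p ∂m, ?_, fun j => hbound _ (hν j), hbound _ hm⟩
  have hGint : ∀ (ξ : Measure (Ω × X)) [IsProbabilityMeasure ξ], ∫ p, G p ∂ξ =
      ∑ n ∈ Finset.range K, ∫ p in A n, φ n p.2 ∂ξ := fun ξ _ => by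
    simp only [G]
    rw [integral_finsetSum _ fun n _ => hGi ξ n]
    exact Finset.sum_congr rfl fun n _ => integral_indicator (hA n)
  simp_rw [hGint]
  exact tendsto_finsetSum _ fun n _ => h _ (hN (measurableSet_singleton n)) (φ n)

/-- The indicator of `K` is a decreasing limit, almost everywhere, of functions of the distance to
the section of `K`, to which convergence of integrals applies. -/
theorem ProdTendsto.eventually_measure_lt [P.IsComplete] (h : ProdTendsto ν l m)
    (hν : ∀ j, (ν j).fst = P) (hm : m.fst = P) {K : Set (Ω × X)} (hK : MeasurableSet K)
    (hKc : ∀ᵐ ω ∂P, IsClosed {x | (ω, x) ∈ K}) {c : ℝ} (hc : m.real K < c) :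
    ∀ᶠ j in l, (ν j).real K < c := by
  let D : Ω × X → ℝ≥0∞ := fun p => Metric.infEDist p.2 {x | (p.1, x) ∈ K}
  have hD : Measurable D := by
    have h1 : Measurable fun q : X × Ω => Metric.infEDist q.1 {x | (q.2, x) ∈ K} :=
      measurable_uncurry_of_continuous_of_measurable
        (fun ω => Metric.continuous_infEDist) (fun x => measurable_infEDist_section P hK x)
    intro s hs
    have h2 : MeasurableSet (Prod.swap ⁻¹' _) := measurable_swap (h1 hs)
    rwa [← preimage_comp] at h2
  let F : ℕ → Ω × X → ℝ := fun k p => 1 - (min 1 ((k : ℝ≥0∞) * D p)).toReal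
  have hmin : ∀ k p, (min 1 ((k : ℝ≥0∞) * D p)).toReal ≤ 1 := fun k p =>
    ENNReal.toReal_le_of_le_ofReal zero_le_one (by simp)
  have hF : ∀ k, Measurable (F k) := fun k =>
    (measurable_const.min (hD.const_mul _)).ennreal_toReal.const_sub _
  have hF0 : ∀ k p, 0 ≤ F k p := fun k p => sub_nonneg.2 (hmin k p)
  have hF1 : ∀ k p, |F k p| ≤ 1 := fun k p => by
    rw [abs_of_nonneg (hF0 k p)]
    exact sub_le_self _ ENNReal.toReal_nonneg
  have hFc : ∀ k ω, Continuous fun x => F k (ω, x) := fun k ω => by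
    refine continuous_const.sub (ENNReal.continuousOn_toReal.comp_continuous ?_ fun x =>
      ne_top_of_le_ne_top ENNReal.one_ne_top (min_le_left _ _))
    have hDc : Continuous fun x => Metric.infEDist x {x | (ω, x) ∈ K} := Metric.continuous_infEDist
    exact continuous_const.min ((ENNReal.continuous_const_mul (ENNReal.natCast_ne_top k)).comp hDc)
  have hFK : ∀ k p, K.indicator (fun _ => (1 : ℝ)) p ≤ F k p := fun k p => by
    by_cases hp : p ∈ K
    · have : D p = 0 := Metric.infEDist_zero_of_mem hp
      simp [hp, F, this]
    · rw [indicator_of_notMem hp]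
      exact hF0 k p
  have hreal : ∀ (ξ : Measure (Ω × X)), ξ.real K = ∫ p, K.indicator (fun _ => (1 : ℝ)) p ∂ξ :=
    fun ξ => by rw [integral_indicator_const _ hK, smul_eq_mul, mul_one]
  have hlim : Tendsto (fun k => ∫ p, F k p ∂m) atTop (𝓝 (m.real K)) := by
    rw [hreal]
    refine tendsto_integral_of_dominated_convergence (fun _ => 1)
      (fun k => (hF k).aestronglyMeasurable) (integrable_const _)
      (fun k => Eventually.of_forall (hF1 k)) ?_
    rw [← hm] at hKc
    filter_upwards [ae_of_ae_map measurable_fst.aemeasurable hKc] with p hp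
    by_cases hpK : p ∈ K
    · have : D p = 0 := Metric.infEDist_zero_of_mem hpK
      simp [hpK, F, this]
    · rw [indicator_of_notMem hpK]
      have hpos : D p ≠ 0 := fun h0 => hpK ((Metric.mem_iff_infEDist_zero_of_closed hp).2 h0)
      refine tendsto_const_nhds.congr' ?_
      obtain ⟨n, hn⟩ := ENNReal.exists_nat_mul_gt hpos ENNReal.one_ne_top
      filter_upwards [eventually_ge_atTop n] with k hk
      have : (1 : ℝ≥0∞) ≤ (k : ℝ≥0∞) * D p := hn.le.trans (by gcongr)
      simp only [F]
      rw [min_eq_left this, ENNReal.toReal_one, sub_self]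
  obtain ⟨k, hk⟩ := (hlim.eventually_lt_const hc).exists
  filter_upwards [(h.tendsto_integral hν hm (hF k) (hFc k) (hF1 k)).eventually_lt_const hk]
    with j hj
  refine lt_of_le_of_lt ?_ hj
  rw [hreal]
  exact integral_mono ((integrable_const _).indicator hK)
    (Integrable.of_bound (hF k).aestronglyMeasurable 1 (Eventually.of_forall (hF1 k))) (hFK k)

end Caratheodory

section Layers

theorem sum_indicator_layers {y : ℝ} (hy0 : 0 ≤ y) {L : ℕ} (hyL : y ≤ L) :
    ∑ l ∈ Finset.range L, (if (l : ℝ) + 1 ≤ y then (1 : ℝ) else 0) = ⌊y⌋₊ := by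
  have : (Finset.range L).filter (fun l : ℕ => (l : ℝ) + 1 ≤ y) = Finset.range ⌊y⌋₊ := by
    ext k
    simp only [Finset.mem_filter, Finset.mem_range]
    have e : (k : ℝ) + 1 ≤ y ↔ k + 1 ≤ ⌊y⌋₊ := by
      rw [Nat.le_floor_iff hy0]; push_cast; rfl
    rw [e]
    have : ⌊y⌋₊ ≤ L := Nat.floor_le_of_le hyL
    lia
  rw [Finset.sum_ite, Finset.sum_const_zero, add_zero, this]
  simp

/-- Upper semicontinuity of the integral follows from that of the measures of superlevel sets. -/
theorem eventually_integral_lt_of_superlevel {Y J : Type*} [MeasurableSpace Y] {l : Filter J}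
    {ν : J → Measure Y} [∀ j, IsProbabilityMeasure (ν j)] {m : Measure Y} [IsProbabilityMeasure m]
    {u : Y → ℝ} (hu : Measurable u) (hu0 : ∀ y, 0 ≤ u y) (hu1 : ∀ y, u y ≤ 1)
    (h : ∀ t c : ℝ, m.real {y | t ≤ u y} < c → ∀ᶠ j in l, (ν j).real {y | t ≤ u y} < c)
    {c : ℝ} (hc : ∫ y, u y ∂m < c) : ∀ᶠ j in l, ∫ y, u y ∂ν j < c := by
  set δ := (c - ∫ y, u y ∂m) / 2 with hδ
  have hδ0 : 0 < δ := by rw [hδ]; linarith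
  obtain ⟨L, hL⟩ := exists_nat_gt (1 / δ)
  have hL0 : (0 : ℝ) < L := (by positivity : (0 : ℝ) < 1 / δ).trans hL
  have hLδ : 1 / (L : ℝ) < δ := by
    rw [one_div_lt hL0 hδ0]; exact hL
  let D : ℕ → Set Y := fun l => {y | ((l : ℝ) + 1) / L ≤ u y}
  have hD : ∀ l, MeasurableSet (D l) := fun l => measurableSet_le measurable_const hu
  -- `L * u` lies between `S` and `S + 1`. Rounding costs less than `L * δ` and the `L` superlevel
  -- sets cost at most `δ` each, in total the gap `2 * δ` after division by `L`.
  let S : Y → ℝ := fun y => ∑ l ∈ Finset.range L, (D l).indicator (fun _ => (1 : ℝ)) y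
  have hS : ∀ y, S y = ⌊L * u y⌋₊ := fun y => by
    rw [← sum_indicator_layers (y := L * u y) (L := L) (mul_nonneg hL0.le (hu0 y))
      (by nlinarith [hu1 y])]
    refine Finset.sum_congr rfl fun l _ => ?_
    simp only [indicator, D, mem_ofPred_eq, div_le_iff₀' hL0]
  have hS1 : ∀ y, S y ≤ L * u y := fun y => by
    rw [hS]; exact Nat.floor_le (mul_nonneg hL0.le (hu0 y))
  have hS2 : ∀ y, L * u y ≤ S y + 1 := fun y => by
    rw [hS]; exact (Nat.lt_floor_add_one _).le
  have hSint : ∀ (ξ : Measure Y) [IsProbabilityMeasure ξ], Integrable S ξ ∧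
      ∫ y, S y ∂ξ = ∑ l ∈ Finset.range L, ξ.real (D l) := fun ξ _ => by
    have hi : ∀ l, Integrable ((D l).indicator fun _ => (1 : ℝ)) ξ := fun l =>
      (integrable_const _).indicator (hD l)
    refine ⟨integrable_finsetSum _ fun l _ => hi l, ?_⟩
    simp only [S]
    rw [integral_finsetSum _ fun l _ => hi l]
    exact Finset.sum_congr rfl fun l _ => by
      rw [integral_indicator_const _ (hD l), smul_eq_mul, mul_one]
  have hui : ∀ (ξ : Measure Y) [IsProbabilityMeasure ξ], Integrable u ξ := fun ξ _ =>
    Integrable.of_bound hu.aestronglyMeasurable 1 (Eventually.of_forall fun y => by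
      rw [Real.norm_eq_abs, abs_of_nonneg (hu0 y)]; exact hu1 y)
  have hm : ∑ l ∈ Finset.range L, m.real (D l) ≤ L * ∫ y, u y ∂m := by
    rw [← (hSint m).2, ← integral_const_mul]
    exact integral_mono (hSint m).1 ((hui m).const_mul _) hS1
  have hev : ∀ᶠ j in l, ∀ i ∈ Finset.range L, (ν j).real (D i) < m.real (D i) + δ :=
    (Finset.eventually_all _).2 fun i _ => h _ _ (by linarith)
  filter_upwards [hev] with j hj
  have h1 : L * ∫ y, u y ∂ν j ≤ ∑ l ∈ Finset.range L, (ν j).real (D l) + 1 := by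
    rw [← (hSint (ν j)).2, ← integral_const_mul]
    have : ∫ y, S y ∂ν j + 1 = ∫ y, (S y + 1) ∂ν j := by
      rw [integral_add (hSint (ν j)).1 (integrable_const _)]; simp
    rw [this]
    exact integral_mono ((hui (ν j)).const_mul _) ((hSint (ν j)).1.add (integrable_const _)) hS2
  have h2 : ∑ l ∈ Finset.range L, (ν j).real (D l) ≤ ∑ l ∈ Finset.range L, m.real (D l) + L * δ := by
    calc _ ≤ ∑ l ∈ Finset.range L, (m.real (D l) + δ) := Finset.sum_le_sum fun i hi => (hj i hi).le
      _ = _ := by rw [Finset.sum_add_distrib]; simp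
  have h3 : 1 < L * δ := by rwa [div_lt_iff₀ hδ0] at hL
  have h4 : L * ∫ y, u y ∂ν j < L * c := by
    have : c = ∫ y, u y ∂m + 2 * δ := by rw [hδ]; ring
    rw [this]
    nlinarith
  exact lt_of_mul_lt_mul_left h4 hL0.le

end Layers

end

/-! ### Narrow compactness and invariance of limits. -/

noncomputable section

namespace BundleRDS

section NarrowCompactness

variable {Ω : Type*} [MeasurableSpace Ω] {P : Measure Ω} {ϑ : Ω → Ω}
  {X : Type*} [MetricSpace X] [MeasurableSpace X]

theorem isClosed_section_image (T : BundleRDS P ϑ X) {D : Set T.Total} {ω : Ω}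
    (h : IsOpen (T.incl ω ⁻¹' Dᶜ)) :
    IsClosed {x | (ω, x) ∈ (Subtype.val '' D : Set (Ω × X))} := by
  have h2 : {x | (ω, x) ∈ (Subtype.val '' D : Set (Ω × X))} =
      Subtype.val '' ((T.incl ω ⁻¹' Dᶜ)ᶜ) := by
    ext x
    constructor
    · rintro ⟨q, hq, hqx⟩
      obtain ⟨⟨ω, y⟩, hy⟩ := q
      simp only [Prod.mk.injEq] at hqx
      obtain ⟨rfl, rfl⟩ := hqx
      exact ⟨⟨y, hy⟩, fun h => h hq, rfl⟩
    · rintro ⟨y, hy, rfl⟩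
      exact ⟨T.incl ω y, not_not.1 hy, rfl⟩
  rw [h2]
  exact (T.isCompact_fiber ω).isClosed.isClosedEmbedding_subtypeVal.isClosedMap _ h.isClosed_compl

/-- The composition of a random continuous function with the skew product. -/
def RandomContinuous.compSkew {T : BundleRDS P ϑ X} (hϑ : MeasurePreserving ϑ P P)
    (f : T.RandomContinuous) : T.RandomContinuous :=
  ⟨fun p => f.1 (T.skew p), f.2.1.comp (T.measurable_skew hϑ.measurable), by
    filter_upwards [T.continuousOn_map, hϑ.quasiMeasurePreserving.ae f.2.2.1] with ω hω hf
    have hc : Continuous fun x : T.fiber ω =>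
        (⟨T.map ω x.1, T.mapsTo ω x.1 x.2⟩ : T.fiber (ϑ ω)) :=
      (continuousOn_iff_continuous_domRestrict.1 hω).subtype_mk _
    exact hf.comp hc,
    by
      obtain ⟨g, hg, hfg⟩ := f.2.2.2
      exact ⟨fun ω => g (ϑ ω), (hϑ.integrable_comp hg.aestronglyMeasurable).2 hg,
        fun p => hfg (T.skew p)⟩⟩

/-- For functions with values in `[0, 1]` the layer argument bounds the upper limit, and applied to
`1 - u` also the lower one. A general random continuous function is clipped at a level `M`, with an
error bounded by the integral of its envelope over the set where that exceeds `M`. -/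
theorem narrowTendsto_of_fiberClosed [P.IsComplete] {T : BundleRDS P ϑ X} {J : Type*} {l : Filter J}
    {ν : J → Measure T.Total} [∀ j, IsProbabilityMeasure (ν j)] (hν : ∀ j, (ν j).map T.base = P)
    {m : Measure T.Total} [IsProbabilityMeasure m] (hm : m.map T.base = P)
    (h : ∀ D, MeasurableSet D → T.FiberOpen Dᶜ → ∀ c, m.real D < c → ∀ᶠ j in l, (ν j).real D < c) :
    T.NarrowTendsto ν l m := by
  have hunit : ∀ u : T.Total → ℝ, Measurable u → (∀ᵐ ω ∂P, Continuous (u ∘ T.incl ω)) →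
      (∀ p, 0 ≤ u p) → (∀ p, u p ≤ 1) →
      ∀ c, ∫ p, u p ∂m < c → ∀ᶠ j in l, ∫ p, u p ∂ν j < c := fun u hu huc h0 h1 c hc => by
    refine eventually_integral_lt_of_superlevel hu h0 h1 (fun t c htc => ?_) hc
    refine h _ (measurableSet_le measurable_const hu) ?_ c htc
    filter_upwards [huc] with ω hω
    have : T.incl ω ⁻¹' {p | t ≤ u p}ᶜ = {x | (u ∘ T.incl ω) x < t} := by
      ext x; simp
    rw [this]
    exact isOpen_lt hω continuous_const
  have hbdd : ∀ u : T.Total → ℝ, Measurable u → (∀ᵐ ω ∂P, Continuous (u ∘ T.incl ω)) →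
      (∀ p, 0 ≤ u p) → (∀ p, u p ≤ 1) →
      Tendsto (fun j => ∫ p, u p ∂ν j) l (𝓝 (∫ p, u p ∂m)) := fun u hu huc h0 h1 => by
    have hsub_eq : ∀ (ξ : Measure T.Total) [IsProbabilityMeasure ξ],
        ∫ p, (1 - u p) ∂ξ = 1 - ∫ p, u p ∂ξ := fun ξ _ => by
      rw [integral_sub (integrable_const _)]
      · simp
      · exact Integrable.of_bound hu.aestronglyMeasurable 1 (Eventually.of_forall fun p => by
          rw [Real.norm_eq_abs, abs_of_nonneg (h0 p)]; exact h1 p)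
    refine tendsto_order.2 ⟨fun c hc => ?_, hunit u hu huc h0 h1⟩
    have := hunit (fun p => 1 - u p) (hu.const_sub _)
      (huc.mono fun ω hω => continuous_const.sub hω) (fun p => sub_nonneg.2 (h1 p))
      (fun p => sub_le_self _ (h0 p)) (1 - c) (by rw [hsub_eq]; linarith)
    filter_upwards [this] with j hj
    rw [hsub_eq] at hj
    linarith
  rintro ⟨f, hf, hfc, g, hg, hfg⟩
  refine tendsto_of_forall_approx fun ε hε => ?_
  have hg0 : ∀ p : T.Total, 0 ≤ g p.1.1 := fun p => (abs_nonneg _).trans (hfg p)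
  have hgm : Measurable g := hg.aemeasurable.nullMeasurable.measurable_of_complete
  have hsm : Tendsto (fun M : ℕ => ∫ ω in {ω | (M : ℝ) < g ω}, g ω ∂P) atTop (𝓝 0) := by
    have hI : ⋂ M : ℕ, {ω | (M : ℝ) < g ω} = ∅ := by
      ext ω
      simp only [mem_iInter, mem_ofPred_eq, mem_empty_iff_false, iff_false, not_forall, not_lt]
      exact exists_nat_ge _
    have := tendsto_setIntegral_of_antitone (μ := P) (f := g)
      (s := fun M : ℕ => {ω | (M : ℝ) < g ω})
      (fun M => measurableSet_lt measurable_const hgm)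
      (fun a b hab ω (hω : (b : ℝ) < g ω) => lt_of_le_of_lt (Nat.cast_le.2 hab) hω)
      ⟨0, hg.integrableOn⟩
    simpa [hI] using this
  obtain ⟨M, hM, hM1⟩ := ((hsm.eventually_lt_const hε).and (eventually_ge_atTop 1)).exists
  have hM0 : (0 : ℝ) < M := by exact_mod_cast hM1
  let A : Set Ω := {ω | (M : ℝ) < g ω}
  have hA : MeasurableSet A := measurableSet_lt measurable_const hgm
  -- `f` clipped to `[-M, M]` and rescaled to `[0, 1]`.
  let u : T.Total → ℝ := fun p => (max (-(M : ℝ)) (min (M : ℝ) (f p)) + M) / (2 * M)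
  have hum : Measurable u :=
    ((measurable_const.max (measurable_const.min hf)).add_const _).div_const _
  have huc : ∀ᵐ ω ∂P, Continuous (u ∘ T.incl ω) := hfc.mono fun ω hω =>
    ((continuous_const.max (continuous_const.min hω)).add continuous_const).div_const _
  have hu0 : ∀ p, 0 ≤ u p := fun p =>
    div_nonneg (by linarith [le_max_left (-(M : ℝ)) (min M (f p))]) (by positivity)
  have hu1 : ∀ p, u p ≤ 1 := fun p => (div_le_one (by positivity)).2 (by
    linarith [max_le (by linarith : -(M : ℝ) ≤ M) (min_le_left (M : ℝ) (f p))])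
  have hdiff : ∀ p, |f p - (2 * M * u p - M)| ≤ A.indicator g (T.base p) := fun p => by
    have e : 2 * M * u p - M = max (-(M : ℝ)) (min M (f p)) := by
      simp only [u]
      field_simp
      ring
    rw [e]
    by_cases hp : T.base p ∈ A
    · rw [indicator_of_mem hp]
      refine le_trans ?_ (hfg p)
      rcases le_total (f p) M with h1 | h1 <;> rcases le_total (-(M : ℝ)) (f p) with h2 | h2
      · rw [min_eq_right h1, max_eq_right h2]; simp
      · rw [min_eq_right h1, max_eq_left h2, abs_of_nonpos (by linarith), abs_of_nonpos (by linarith)]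
        linarith
      · rw [min_eq_left h1, max_eq_right (by linarith), abs_of_nonneg (by linarith),
          abs_of_nonneg (by linarith)]
        linarith
      · linarith
    · have h1 : |f p| ≤ M := (hfg p).trans (not_lt.1 hp)
      rw [min_eq_right (abs_le.1 h1).2, max_eq_right (abs_le.1 h1).1, indicator_of_notMem hp]
      simp
  have hui : ∀ (ξ : Measure T.Total) [IsProbabilityMeasure ξ], Integrable u ξ := fun ξ _ =>
    Integrable.of_bound hum.aestronglyMeasurable 1 (Eventually.of_forall fun p => by
      rw [Real.norm_eq_abs, abs_of_nonneg (hu0 p)]; exact hu1 p)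
  have hbound : ∀ (ξ : Measure T.Total) [IsProbabilityMeasure ξ], ξ.map T.base = P →
      |∫ p, f p ∂ξ - (2 * M * ∫ p, u p ∂ξ - M)| ≤ ε := fun ξ _ hξ => by
    have hgi : Integrable (fun p => g (T.base p)) ξ :=
      Integrable.comp_measurable (by rw [hξ]; exact hg) T.measurable_base
    have hfi : Integrable f ξ := hgi.mono' hf.aestronglyMeasurable (Eventually.of_forall hfg)
    have hvi : Integrable (fun p => 2 * M * u p - M) ξ :=
      ((hui ξ).const_mul _).sub (integrable_const _)
    have e1 : 2 * M * ∫ p, u p ∂ξ - M = ∫ p, (2 * M * u p - M) ∂ξ := by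
      rw [integral_sub ((hui ξ).const_mul _) (integrable_const _), integral_const_mul]
      simp
    have e2 : ∫ p, A.indicator g (T.base p) ∂ξ = ∫ ω in A, g ω ∂P := by
      have : Measurable (A.indicator g) := hgm.indicator hA
      rw [← integral_indicator hA]
      conv_rhs => rw [← hξ]
      rw [integral_map T.measurable_base.aemeasurable this.aestronglyMeasurable]
    rw [e1, ← integral_sub hfi hvi]
    refine abs_integral_le_integral_abs.trans ((integral_mono (hfi.sub hvi).abs ?_ hdiff).trans ?_)
    · have : Integrable (A.indicator g) P := hg.indicator hA
      exact Integrable.comp_measurable (by rw [hξ]; exact this) T.measurable_base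
    · rw [e2]; exact hM.le
  exact ⟨fun j => 2 * M * ∫ p, u p ∂ν j - M, 2 * M * ∫ p, u p ∂m - M,
    ((hbdd u hum huc hu0 hu1).const_mul _).sub_const _, fun j => hbound _ (hν j), hbound _ hm⟩

variable [CompactSpace X] [BorelSpace X] [IsProbabilityMeasure P] [P.IsComplete]

/-- Limits along ultrafilters of measures with marginal `P`, tested on random closed sets. -/
theorem exists_limit_fiberClosed (T : BundleRDS P ϑ X) {J : Type*} (U : Ultrafilter J)
    (ν : J → Measure T.Total) [∀ j, IsProbabilityMeasure (ν j)] (hν : ∀ j, (ν j).map T.base = P) :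
    ∃ m : Measure T.Total, IsProbabilityMeasure m ∧ m.map T.base = P ∧
      ∀ D, MeasurableSet D → T.FiberOpen Dᶜ → ∀ c, m.real D < c → ∀ᶠ j in U, (ν j).real D < c := by
  let ν' : J → Measure (Ω × X) := fun j => (ν j).map Subtype.val
  have hν'p : ∀ j, IsProbabilityMeasure (ν' j) := fun j =>
    Measure.isProbabilityMeasure_map measurable_subtype_coe.aemeasurable
  have hν' : ∀ j, (ν' j).fst = P := fun j => by
    rw [← hν j, Measure.fst, Measure.map_map measurable_fst measurable_subtype_coe]
    rfl
  obtain ⟨m', hm'p, hm', hlim⟩ := exists_limit_prod U ν' hν'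
  have hlim' : ProdTendsto ν' U m' := hlim
  have hE := T.measurableSet_carrier
  -- The bundle has closed sections and full measure along the net, so the limit cannot lose mass
  -- from it.
  have hm'E : m' T.carrierᶜ = 0 := by
    rw [prob_compl_eq_zero_iff hE]
    by_contra hne
    have hlt : m'.real T.carrier < 1 := by
      refine lt_of_le_of_ne measureReal_le_one fun h => hne ?_
      rwa [measureReal_def, ENNReal.toReal_eq_one_iff] at h
    have hcl : ∀ᵐ ω ∂P, IsClosed {x | (ω, x) ∈ T.carrier} :=
      Eventually.of_forall fun ω => (T.isCompact_fiber ω).isClosed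
    obtain ⟨j, hj⟩ := (hlim'.eventually_measure_lt hν' hm' hE hcl hlt).exists
    have h1 : ν' j T.carrier = 1 := by
      rw [Measure.map_apply measurable_subtype_coe hE, Subtype.coe_preimage_self, measure_univ]
    rw [measureReal_def, h1] at hj
    simp at hj
  let m : Measure T.Total := m'.comap Subtype.val
  have hmm' : m.map Subtype.val = m' := by
    rw [map_comap_subtype_coe hE, Measure.restrict_eq_self_of_ae_mem]
    exact hm'E
  have hmp : IsProbabilityMeasure m := by
    refine ⟨?_⟩
    rw [← preimage_univ (f := (Subtype.val : T.Total → Ω × X)),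
      ← Measure.map_apply measurable_subtype_coe .univ, hmm', measure_univ]
  refine ⟨m, hmp, ?_, fun D hD hDo c hc => ?_⟩
  · refine Eq.trans ?_ hm'
    rw [← hmm', Measure.fst, Measure.map_map measurable_fst measurable_subtype_coe]
    rfl
  · have hD' : MeasurableSet (Subtype.val '' D : Set (Ω × X)) := hE.subtype_image hD
    have hreal : ∀ ξ : Measure T.Total, (ξ.map Subtype.val).real (Subtype.val '' D : Set (Ω × X)) =
        ξ.real D := fun ξ => by
      rw [measureReal_def, Measure.map_apply measurable_subtype_coe hD',
        preimage_image_eq _ Subtype.val_injective, measureReal_def]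
    have hcl : ∀ᵐ ω ∂P, IsClosed {x | (ω, x) ∈ (Subtype.val '' D : Set (Ω × X))} := by
      filter_upwards [hDo] with ω hω using T.isClosed_section_image hω
    have := hlim'.eventually_measure_lt hν' hm' hD' hcl (c := c) (by rw [← hmm', hreal]; exact hc)
    filter_upwards [this] with j hj
    rwa [hreal] at hj

/-- Compactness of the set of measures with marginal `P` in the narrow topology. -/
theorem exists_narrowTendsto (T : BundleRDS P ϑ X) {J : Type*} (U : Ultrafilter J)
    (ν : J → Measure T.Total) [∀ j, IsProbabilityMeasure (ν j)] (hν : ∀ j, (ν j).map T.base = P) :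
    ∃ m : Measure T.Total, IsProbabilityMeasure m ∧ m.map T.base = P ∧ T.NarrowTendsto ν U m := by
  obtain ⟨m, hmp, hm, h⟩ := T.exists_limit_fiberClosed U ν hν
  exact ⟨m, hmp, hm, narrowTendsto_of_fiberClosed hν hm h⟩

/-- The approximations determine the measures of products of a measurable and an open set, which
form a generating π-system. -/
theorem ext_of_integral_openApprox (T : BundleRDS P ϑ X) {m m' : Measure T.Total}
    [IsProbabilityMeasure m] [IsProbabilityMeasure m'] (hm : m.map T.base = P)
    (hm' : m'.map T.base = P)
    (h : ∀ G, MeasurableSet G → ∀ k, ∫ p, T.openApprox G k p ∂m = ∫ p, T.openApprox G k p ∂m') :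
    m = m' := by
  let 𝒞 : Set (Set T.Total) := {G | ∃ (B : Set Ω) (V : Set X), MeasurableSet B ∧ IsOpen V ∧
    {p | p.1.1 ∈ B ∧ p.1.2 ∈ V} = G}
  have hpi : IsPiSystem 𝒞 := by
    rintro _ ⟨B, V, hB, hV, rfl⟩ _ ⟨B', V', hB', hV', rfl⟩ _
    refine ⟨B ∩ B', V ∩ V', hB.inter hB', hV.inter hV', ?_⟩
    ext p
    simp only [mem_ofPred_eq, mem_inter_iff]
    tauto
  have hmeas : ∀ G ∈ 𝒞, MeasurableSet G := by
    rintro _ ⟨B, V, hB, hV, rfl⟩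
    exact (T.measurable_base hB).inter
      ((measurable_snd.comp measurable_subtype_coe) hV.measurableSet)
  have hgen : (Subtype.instMeasurableSpace : MeasurableSpace T.Total) =
      MeasurableSpace.generateFrom 𝒞 := by
    refine le_antisymm ?_ (MeasurableSpace.generateFrom_le hmeas)
    have h1 : Measurable[MeasurableSpace.generateFrom 𝒞] fun p : T.Total => p.1.1 := fun B hB =>
      MeasurableSpace.measurableSet_generateFrom ⟨B, univ, hB, isOpen_univ, by ext p; simp⟩
    have h2 : Measurable[MeasurableSpace.generateFrom 𝒞] fun p : T.Total => p.1.2 := by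
      refine @measurable_of_isOpen _ _ _ _ _ (MeasurableSpace.generateFrom 𝒞) _ fun V hV => ?_
      exact MeasurableSpace.measurableSet_generateFrom ⟨univ, V, .univ, hV, by ext p; simp⟩
    have h3 : Measurable[MeasurableSpace.generateFrom 𝒞] (Subtype.val : T.Total → Ω × X) :=
      h1.prodMk h2
    exact h3.comap_le
  refine ext_of_generate_finite 𝒞 hgen hpi ?_ (by simp)
  rintro _ ⟨B, V, hB, hV, rfl⟩
  have hG := hmeas _ ⟨B, V, hB, hV, rfl⟩
  have hGo : T.FiberOpen {p | p.1.1 ∈ B ∧ p.1.2 ∈ V} := Eventually.of_forall fun ω => by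
    have : T.incl ω ⁻¹' {p | p.1.1 ∈ B ∧ p.1.2 ∈ V} =
        {_x : T.fiber ω | ω ∈ B} ∩ (Subtype.val : T.fiber ω → X) ⁻¹' V := rfl
    rw [this]
    exact isOpen_const.inter (hV.preimage continuous_subtype_val)
  have h1 := T.tendsto_openApprox hm hG hGo
  have h2 := T.tendsto_openApprox hm' hG hGo
  simp_rw [h _ hG] at h1
  have := tendsto_nhds_unique h1 h2
  rwa [measureReal_def, measureReal_def, ENNReal.toReal_eq_toReal_iff' (measure_ne_top _ _)
    (measure_ne_top _ _)] at this

/-- Limits of asymptotically invariant measures are invariant. -/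
theorem NarrowTendsto.measurePreserving {T : BundleRDS P ϑ X} (hϑ : MeasurePreserving ϑ P P)
    {J : Type*} {l : Filter J} [l.NeBot] {ν : J → Measure T.Total} {m : Measure T.Total}
    [IsProbabilityMeasure m] (hm : m.map T.base = P) (h : T.NarrowTendsto ν l m)
    (hinv : ∀ f : T.Total → ℝ, Measurable f → (∀ p, |f p| ≤ 1) →
      Tendsto (fun j => ∫ p, f (T.skew p) ∂ν j - ∫ p, f p ∂ν j) l (𝓝 0)) :
    MeasurePreserving T.skew m m := by
  have hs := T.measurable_skew hϑ.measurable
  have : IsProbabilityMeasure (m.map T.skew) := Measure.isProbabilityMeasure_map hs.aemeasurable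
  refine ⟨hs, T.ext_of_integral_openApprox ?_ hm fun G hG k => ?_⟩
  · rw [Measure.map_map T.measurable_base hs]
    have : T.base ∘ T.skew = ϑ ∘ T.base := rfl
    rw [this, ← Measure.map_map hϑ.measurable T.measurable_base, hm, hϑ.map_eq]
  · have hf := T.measurable_openApprox hG k
    rw [integral_map hs.aemeasurable hf.aestronglyMeasurable]
    have h1 := (h (RandomContinuous.compSkew hϑ (T.openApproxRC hG k))).sub
      (h (T.openApproxRC hG k))
    have h2 := hinv _ hf (T.abs_openApprox_le G k)
    exact sub_eq_zero.1 (tendsto_nhds_unique h1 h2)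

end NarrowCompactness

end BundleRDS

end

/-! ### Fibered powers and separated tuples of orbits. -/

noncomputable section

namespace BundleRDS

section Power

variable {Ω : Type*} [MeasurableSpace Ω] {P : Measure Ω} {ϑ : Ω → Ω}
  {X : Type*} [MetricSpace X] [MeasurableSpace X]

/-- The fibered power of a bundle random dynamical system. -/
def power (T : BundleRDS P ϑ X) (N : ℕ) : BundleRDS P ϑ (Fin N → X) where
  carrier := {p | ∀ i, (p.1, p.2 i) ∈ T.carrier}
  measurableSet_carrier := by
    have : {p : Ω × (Fin N → X) | ∀ i, (p.1, p.2 i) ∈ T.carrier} =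
        ⋂ i, (fun p : Ω × (Fin N → X) => (p.1, p.2 i)) ⁻¹' T.carrier := by
      ext p; simp
    rw [this]
    have hm : ∀ i, Measurable fun p : Ω × (Fin N → X) => (p.1, p.2 i) := fun i => by fun_prop
    exact .iInter fun i => hm i T.measurableSet_carrier
  isCompact_fiber ω := by
    have := isCompact_univ_pi fun _ : Fin N => T.isCompact_fiber ω
    convert this using 1
    ext y; simp
  nonempty_fiber := by
    filter_upwards [T.nonempty_fiber] with ω hω
    exact ⟨fun _ => hω.some, fun _ => hω.some_mem⟩
  map ω y i := T.map ω (y i)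
  mapsTo ω y hy i := T.mapsTo ω (y i) (hy i)
  measurable_map := by
    refine measurable_pi_lambda _ fun i => ?_
    have h1 : Measurable fun p : {p : Ω × (Fin N → X) | ∀ i, (p.1, p.2 i) ∈ T.carrier} =>
        (⟨(p.1.1, p.1.2 i), p.2 i⟩ : T.carrier) := Measurable.subtype_mk (by fun_prop)
    exact T.measurable_map.comp h1
  continuousOn_map := by
    filter_upwards [T.continuousOn_map] with ω hω
    refine continuousOn_pi.2 fun i => ?_
    exact hω.comp (continuous_apply i).continuousOn fun y hy => hy i

/-- The points of an element of the fibered power. -/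
def powCoord (T : BundleRDS P ϑ X) {N : ℕ} (i : Fin N) (q : (T.power N).Total) : T.Total :=
  ⟨(q.1.1, q.1.2 i), q.2 i⟩

theorem powCoord_iterate (T : BundleRDS P ϑ X) {N : ℕ} (i : Fin N) (n : ℕ)
    (q : (T.power N).Total) :
    T.powCoord i ((T.power N).skew^[n] q) = T.skew^[n] (T.powCoord i q) := by
  induction n generalizing q with
  | zero => rfl
  | succ n ih => rw [Function.iterate_succ_apply, ih, Function.iterate_succ_apply]; rfl

/-- The distance of two points of the bundle after `t` steps. -/
def orbitDist (T : BundleRDS P ϑ X) (t : ℕ) (p q : T.Total) : ℝ :=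
  dist (T.skew^[t] p).1.2 (T.skew^[t] q).1.2

theorem orbitDist_comm (T : BundleRDS P ϑ X) (t : ℕ) (p q : T.Total) :
    T.orbitDist t p q = T.orbitDist t q p := dist_comm _ _

/-- Tuples of points in a fiber whose orbits of length `n` stay within distance `ρ`, but are
separated by `δ`. -/
def sepTuples (T : BundleRDS P ϑ X) (N n : ℕ) (δ ρ : ℝ) : Set (T.power N).Total :=
  {q | ∀ i j, (∀ t : Fin n, T.orbitDist t (T.powCoord i q) (T.powCoord j q) ≤ ρ) ∧
    (i ≠ j → ∃ t : Fin n, δ ≤ T.orbitDist t (T.powCoord i q) (T.powCoord j q))}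

/-- Points are added greedily. If every point of the section of `A` stayed `δ`-close along the orbit
to one of the `k` chosen points, the `R`-words around these would cover `A`, contradicting the
covering number. -/
theorem exists_separated_finset (T : BundleRDS P ϑ X) {ι : Type*} {R : ι → Set T.Total} {δ : ℝ}
    (hδ : 0 < δ) (hR : ∀ x : X, ∃ j, ∀ p : T.Total, dist p.1.2 x < δ → p ∈ R j) (n : ℕ)
    (A : Set T.Total) {ω : Ω} (k : ℕ) (hk : k ≤ T.coverNum A (T.refine R n) ω)
    (hA : (T.incl ω ⁻¹' A).Nonempty) :
    ∃ s : Finset (T.fiber ω), s.card = k ∧ (∀ x ∈ s, T.incl ω x ∈ A) ∧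
      ∀ x ∈ s, ∀ y ∈ s, x ≠ y → ∃ t : Fin n, δ ≤ T.orbitDist t (T.incl ω x) (T.incl ω y) := by
  classical
  induction k with
  | zero => exact ⟨∅, by simp⟩
  | succ k ih =>
    obtain ⟨s, hsc, hsA, hs⟩ := ih (Nat.le_of_succ_le hk)
    have hr : ∀ x : T.fiber ω, ∃ r : Fin n → ι, ∀ y : T.fiber ω,
        (∀ t : Fin n, T.orbitDist t (T.incl ω y) (T.incl ω x) < δ) →
        T.incl ω y ∈ T.refine R n r := fun x => by
      choose j hj using hR
      exact ⟨fun t => j (T.skew^[t] (T.incl ω x)).1.2, fun y hy =>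
        mem_iInter.2 fun t => hj _ _ (hy t)⟩
    choose r hr using hr
    have hnc : ∃ y : T.fiber ω, T.incl ω y ∈ A ∧ ∀ x ∈ s,
        ∃ t : Fin n, δ ≤ T.orbitDist t (T.incl ω y) (T.incl ω x) := by
      by_contra! hcon
      have hcov : T.Covers A (T.refine R n) (s.image r) ω := fun y hy => by
        obtain ⟨x, hx, hxy⟩ := hcon y hy
        exact mem_iUnion₂.2 ⟨r x, Finset.mem_image_of_mem r hx, hr x y hxy⟩
      -- The first point comes from non-emptiness, since an empty family gives no bound on the
      -- covering number.
      rcases Nat.eq_zero_or_pos k with rfl | hk0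
      · obtain ⟨y, hy⟩ := hA
        obtain ⟨x, hx, -⟩ := hcon y hy
        simp [Finset.card_eq_zero.1 hsc] at hx
      · have := T.coverNum_le hcov hk0 (Finset.card_image_le.trans hsc.le)
        lia
    obtain ⟨y, hyA, hy⟩ := hnc
    have hys : y ∉ s := fun hmem => by
      obtain ⟨t, ht⟩ := hy y hmem
      rw [orbitDist, dist_self] at ht
      linarith
    refine ⟨insert y s, by rw [Finset.card_insert_of_notMem hys, hsc], fun x hx => ?_,
      fun x hx z hz hxz => ?_⟩
    · rcases Finset.mem_insert.1 hx with rfl | hx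
      · exact hyA
      · exact hsA x hx
    · rcases Finset.mem_insert.1 hx with rfl | hx' <;> rcases Finset.mem_insert.1 hz with rfl | hz'
      · exact absurd rfl hxz
      · exact hy z hz'
      · obtain ⟨t, ht⟩ := hy x hx'
        exact ⟨t, by rwa [orbitDist_comm]⟩
      · exact hs x hx' z hz' hxz

/-- The points are taken in a `Q`-word whose covering number is maximal. If its section is empty
this number is `1`, and any point of the fiber forms a tuple. -/
theorem exists_mem_sepTuples (T : BundleRDS P ϑ X) {ι κ : Type*} [Fintype κ]
    [Nonempty κ] {R : ι → Set T.Total} {Q : κ → Set T.Total} {δ ρ : ℝ}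
    (hδ : 0 < δ) (hρ : 0 ≤ ρ) (hR : ∀ x : X, ∃ j, ∀ p : T.Total, dist p.1.2 x < δ → p ∈ R j)
    (hQ : ∀ j, ∀ p ∈ Q j, ∀ q ∈ Q j, dist p.1.2 q.1.2 ≤ ρ) (n : ℕ) {ω : Ω}
    (hω : (T.fiber ω).Nonempty) :
    ∃ y : Fin (T.condCoverNum (T.refine R n) (T.refine Q n) ω) → X,
      (ω, y) ∈ (Subtype.val '' T.sepTuples _ n δ ρ : Set (Ω × (Fin _ → X))) := by
  obtain ⟨a, -, ha⟩ := Finset.exists_mem_eq_sup (Finset.univ : Finset (Fin n → κ))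
    Finset.univ_nonempty fun j => T.coverNum (T.refine Q n j) (T.refine R n) ω
  have ha' : T.condCoverNum (T.refine R n) (T.refine Q n) ω =
      T.coverNum (T.refine Q n a) (T.refine R n) ω := ha
  rw [ha']
  by_cases hA : (T.incl ω ⁻¹' T.refine Q n a).Nonempty
  · obtain ⟨s, hsc, hsA, hs⟩ := T.exists_separated_finset hδ hR n (T.refine Q n a) _ le_rfl hA
    let e := s.equivFinOfCardEq hsc
    refine ⟨fun i => (e.symm i).1.1, ⟨(ω, fun i => (e.symm i).1.1), fun i => (e.symm i).1.2⟩,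
      fun i j => ⟨fun t => ?_, fun hij => ?_⟩, rfl⟩
    · exact hQ _ _ (mem_iInter.1 (hsA _ (e.symm i).2) t) _ (mem_iInter.1 (hsA _ (e.symm j).2) t)
    · exact hs _ (e.symm i).2 _ (e.symm j).2 fun h => hij (e.symm.injective (Subtype.ext h))
  · have h1 : T.coverNum (T.refine Q n a) (T.refine R n) ω = 1 := by
      unfold coverNum
      rw [if_pos (not_nonempty_iff_eq_empty.1 hA)]
    rw [h1]
    obtain ⟨x, hx⟩ := hω
    refine ⟨fun _ => x, ⟨(ω, fun _ => x), fun _ => hx⟩, fun i j => ⟨fun t => ?_, fun hij => ?_⟩, rfl⟩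
    · have : i = j := Subsingleton.elim _ _
      rw [this, orbitDist, dist_self]
      exact hρ
    · exact absurd (Subsingleton.elim _ _) hij

/-- Measurable sets with closed sections in almost all fibers. -/
structure IsFiberClosed (T : BundleRDS P ϑ X) (D : Set T.Total) : Prop where
  measurableSet : MeasurableSet D
  fiberOpen_compl : T.FiberOpen Dᶜ

theorem IsFiberClosed.iInter {T : BundleRDS P ϑ X} {ι : Type*} [Countable ι] {D : ι → Set T.Total}
    (h : ∀ i, T.IsFiberClosed (D i)) : T.IsFiberClosed (⋂ i, D i) := by
  refine ⟨.iInter fun i => (h i).measurableSet, ?_⟩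
  filter_upwards [ae_all_iff.2 fun i => (h i).fiberOpen_compl] with ω hω
  rw [compl_iInter, preimage_iUnion]
  exact isOpen_iUnion hω

theorem IsFiberClosed.iUnion {T : BundleRDS P ϑ X} {ι : Type*} [Finite ι] {D : ι → Set T.Total}
    (h : ∀ i, T.IsFiberClosed (D i)) : T.IsFiberClosed (⋃ i, D i) := by
  refine ⟨.iUnion fun i => (h i).measurableSet, ?_⟩
  filter_upwards [ae_all_iff.2 fun i => (h i).fiberOpen_compl] with ω hω
  rw [compl_iUnion, preimage_iInter]
  exact isOpen_iInter_of_finite hω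

theorem IsFiberClosed.preimage_iterate_skew {T : BundleRDS P ϑ X} (hϑ : MeasurePreserving ϑ P P)
    {D : Set T.Total} (h : T.IsFiberClosed D) (n : ℕ) : T.IsFiberClosed (T.skew^[n] ⁻¹' D) := by
  induction n with
  | zero => exact h
  | succ n ih =>
    rw [Function.iterate_succ, preimage_comp]
    exact ⟨T.measurable_skew hϑ.measurable ih.measurableSet,
      ih.fiberOpen_compl.preimage_skew hϑ⟩

theorem isFiberClosed_comp [BorelSpace X] (T : BundleRDS P ϑ X) {F : Set X} (hF : IsClosed F) :
    T.IsFiberClosed {p | p.1.2 ∈ F} :=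
  ⟨(measurable_snd.comp measurable_subtype_coe) hF.measurableSet, Eventually.of_forall fun _ =>
    hF.isOpen_compl.preimage continuous_subtype_val⟩

theorem isFiberClosed_univ (T : BundleRDS P ϑ X) : T.IsFiberClosed univ :=
  ⟨.univ, Eventually.of_forall fun ω => by simp⟩

theorem isFiberClosed_sepTuples [CompactSpace X] [BorelSpace X] (T : BundleRDS P ϑ X)
    (hϑ : MeasurePreserving ϑ P P) (N n : ℕ) (δ ρ : ℝ) :
    (T.power N).IsFiberClosed (T.sepTuples N n δ ρ) := by
  classical
  -- The Boolean separates closeness from separation, each a finite combination of preimages of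
  -- closed sets.
  have e : T.sepTuples N n δ ρ = ⋂ ij : Fin N × Fin N,
      ⋂ b : Bool, if b then ⋂ t : Fin n, (T.power N).skew^[t] ⁻¹'
          {q | q.1.2 ∈ {y : Fin N → X | dist (y ij.1) (y ij.2) ≤ ρ}}
        else if ij.1 = ij.2 then univ else ⋃ t : Fin n, (T.power N).skew^[t] ⁻¹'
          {q | q.1.2 ∈ {y : Fin N → X | δ ≤ dist (y ij.1) (y ij.2)}} := by
    ext q
    have ht : ∀ (t : ℕ) (i j : Fin N), T.orbitDist t (T.powCoord i q) (T.powCoord j q) =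
        dist (((T.power N).skew^[t] q).1.2 i) (((T.power N).skew^[t] q).1.2 j) := fun t i j => by
      rw [orbitDist, ← powCoord_iterate, ← powCoord_iterate]
      rfl
    simp only [sepTuples, mem_ofPred_eq, mem_iInter, ht, Prod.forall, Bool.forall_bool]
    refine forall₂_congr fun i j => ?_
    by_cases hij : i = j <;> simp [hij, and_comm]
  rw [e]
  refine IsFiberClosed.iInter fun ij => IsFiberClosed.iInter fun b => ?_
  have hc : Continuous fun y : Fin N → X => dist (y ij.1) (y ij.2) := by fun_prop
  split_ifs
  · exact IsFiberClosed.iInter fun t => ((T.power N).isFiberClosed_comp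
      (isClosed_le hc continuous_const)).preimage_iterate_skew hϑ t
  · exact (T.power N).isFiberClosed_univ
  · exact IsFiberClosed.iUnion fun t => ((T.power N).isFiberClosed_comp
      (isClosed_le continuous_const hc)).preimage_iterate_skew hϑ t

end Power

end BundleRDS

end

/-! ### Measurable selection of separated orbits and the resulting measures. -/

noncomputable section

/-- If `N` numbers have sum at most `1`, the mean of their negative logarithms is at least
`log N`. -/
theorem log_le_sum_neglog_div {N : ℕ} (hN : N ≠ 0) {t : ℕ → ℝ≥0∞}
    (ht : ∑ j ∈ Finset.range N, t j ≤ 1) :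
    ENNReal.ofReal (Real.log N) ≤ (∑ j ∈ Finset.range N, neglog (t j)) / N := by
  have hN' : (N : ℝ≥0∞) ≠ 0 := by simpa using hN
  have hNr : (0 : ℝ) < N := by positivity
  have hlog : 0 ≤ Real.log N := Real.log_natCast_nonneg N
  -- This is `log x ≤ x - 1` at `x = N * s`. Summed over the `N` weights, the added terms cancel
  -- because the weights sum to at most `1`.
  have hone : ∀ s : ℝ≥0∞, ENNReal.ofReal (Real.log N) + 1 ≤ neglog s + N * s := fun s => by
    rcases eq_or_ne s 0 with rfl | hs
    · simp
    rcases eq_or_ne s ∞ with rfl | hst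
    · simp [ENNReal.mul_top hN']
    have hs0 : 0 < s.toReal := ENNReal.toReal_pos hs hst
    have h1 : Real.log N + 1 ≤ -Real.log s.toReal + N * s.toReal := by
      have := Real.log_le_sub_one_of_pos (mul_pos hNr hs0)
      rw [Real.log_mul hNr.ne' hs0.ne'] at this
      linarith
    have h2 := ENNReal.ofReal_le_ofReal h1
    rw [ENNReal.ofReal_add hlog zero_le_one, ENNReal.ofReal_one] at h2
    refine h2.trans (ENNReal.ofReal_add_le.trans ?_)
    rw [neglog_of_ne_zero hs, ENNReal.ofReal_mul hNr.le, ENNReal.ofReal_toReal hst,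
      ENNReal.ofReal_natCast]
  rw [ENNReal.le_div_iff_mul_le (Or.inl hN') (Or.inl (ENNReal.natCast_ne_top N)), mul_comm]
  refine ENNReal.le_of_add_le_add_right (a := N) (ENNReal.natCast_ne_top N) ?_
  calc (N : ℝ≥0∞) * ENNReal.ofReal (Real.log N) + N
      = ∑ j ∈ Finset.range N, (ENNReal.ofReal (Real.log N) + 1) := by
        rw [Finset.sum_const, Finset.card_range, nsmul_eq_mul, mul_add, mul_one]
    _ ≤ ∑ j ∈ Finset.range N, (neglog (t j) + N * t j) := Finset.sum_le_sum fun j _ => hone _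
    _ = ∑ j ∈ Finset.range N, neglog (t j) + N * ∑ j ∈ Finset.range N, t j := by
        rw [Finset.sum_add_distrib, Finset.mul_sum]
    _ ≤ _ := by
        gcongr
        calc (N : ℝ≥0∞) * ∑ j ∈ Finset.range N, t j ≤ N * 1 := by gcongr
          _ = N := mul_one _

/-- The uniform distribution on finitely many points depending measurably on a parameter. -/
theorem exists_measure_lintegral_eq_average {Ω Y : Type*} [MeasurableSpace Ω] [MeasurableSpace Y]
    (P : Measure Ω) {N : Ω → ℕ} (hN : Measurable N) {w : ℕ → Ω → Y} (hw : ∀ j, Measurable (w j)) :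
    ∃ σ : Measure Y, ∀ F : Y → ℝ≥0∞, Measurable F →
      ∫⁻ y, F y ∂σ = ∫⁻ ω, (∑ j ∈ Finset.range (N ω), F (w j ω)) / N ω ∂P := by
  let wt : ℕ → Ω → ℝ≥0∞ := fun j ω => if j < N ω then ((N ω : ℝ≥0∞))⁻¹ else 0
  have hwt : ∀ j, Measurable (wt j) := fun j =>
    (measurable_of_countable fun n : ℕ => if j < n then ((n : ℝ≥0∞))⁻¹ else 0).comp hN
  refine ⟨Measure.sum fun j => (P.withDensity (wt j)).map (w j), fun F hF => ?_⟩
  have hFw : ∀ j, Measurable fun ω => F (w j ω) := fun j => hF.comp (hw j)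
  have hmul : ∀ j, Measurable fun ω => wt j ω * F (w j ω) := fun j => (hwt j).mul (hFw j)
  rw [lintegral_sum_measure]
  have h1 : ∀ j, ∫⁻ y, F y ∂((P.withDensity (wt j)).map (w j)) = ∫⁻ ω, wt j ω * F (w j ω) ∂P :=
    fun j => by
      rw [lintegral_map hF (hw j), lintegral_withDensity_eq_lintegral_mul _ (hwt j)
        (hFw j)]
      rfl
  simp_rw [h1]
  rw [← lintegral_tsum fun j => (hmul j).aemeasurable]
  refine lintegral_congr fun ω => ?_
  rw [tsum_eq_sum (s := Finset.range (N ω)) fun j hj => by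
    simp [wt, not_lt.1 (fun h => hj (Finset.mem_range.2 h))], div_eq_mul_inv, Finset.sum_mul]
  refine Finset.sum_congr rfl fun j hj => ?_
  simp only [wt, if_pos (Finset.mem_range.1 hj), mul_comm]

namespace BundleRDS

section Selection

variable {Ω : Type*} [MeasurableSpace Ω] {P : Measure Ω} {ϑ : Ω → Ω}
  {X : Type*} [MetricSpace X] [MeasurableSpace X]

theorem sqFst_iterate (T : BundleRDS P ϑ X) (n : ℕ) (p : T.square.Total) :
    T.sqFst (T.square.skew^[n] p) = T.skew^[n] (T.sqFst p) := by
  induction n generalizing p with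
  | zero => rfl
  | succ n ih => rw [Function.iterate_succ_apply, ih, Function.iterate_succ_apply]; rfl

/-- A code measurable with respect to the first point cannot distinguish pairs sharing it; this
forces the entropy of the constructed measures to be large. -/
theorem eq_of_measurable_firstCoordSigma (T : BundleRDS P ϑ X) {Z : Type*} [MeasurableSpace Z]
    [MeasurableSingletonClass Z] {f : T.square.Total → Z} (hf : Measurable[T.firstCoordSigma] f)
    {p q : T.square.Total} (h : T.sqFst p = T.sqFst q) : f p = f q := by
  rw [T.firstCoordSigma_eq] at hf
  obtain ⟨A, -, hA⟩ := hf (measurableSet_singleton (f q))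
  have hq : q ∈ T.sqFst ⁻¹' A := hA ▸ rfl
  have hp : p ∈ f ⁻¹' {f q} := hA ▸ (show T.sqFst p ∈ A from h ▸ hq)
  exact hp

theorem exists_lift (T : BundleRDS P ϑ X) [IsProbabilityMeasure P] {z : Ω → X} (hz : Measurable z)
    (h : ∀ᵐ ω ∂P, (ω, z ω) ∈ T.carrier) :
    ∃ g : Ω → T.Total, Measurable g ∧ ∀ᵐ ω ∂P, (g ω).1 = (ω, z ω) := by
  classical
  obtain ⟨ω₀, h₀⟩ := h.exists
  have hset : MeasurableSet {ω | (ω, z ω) ∈ T.carrier} :=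
    (measurable_id.prodMk hz) T.measurableSet_carrier
  have hm : Measurable fun ω => if (ω, z ω) ∈ T.carrier then (ω, z ω) else (ω₀, z ω₀) :=
    Measurable.ite hset (measurable_id.prodMk hz) measurable_const
  have hmem : ∀ ω, (if (ω, z ω) ∈ T.carrier then (ω, z ω) else (ω₀, z ω₀)) ∈ T.carrier :=
    fun ω => by
      split_ifs with hω
      · exact hω
      · exact h₀
  refine ⟨fun ω => ⟨_, hmem ω⟩, hm.subtype_mk, ?_⟩
  filter_upwards [h] with ω hω
  exact if_pos hω

variable [CompactSpace X] [BorelSpace X]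

theorem measurableSet_lt_dist (T : BundleRDS P ϑ X) (ρ : ℝ) :
    MeasurableSet {p : T.square.Total | ρ < dist p.1.2.1 p.1.2.2} :=
  measurableSet_lt measurable_const ((continuous_dist.measurable (α := X × X)).comp
    (measurable_snd.comp measurable_subtype_coe))

variable [IsProbabilityMeasure P] [P.IsComplete]

/-- The tuple length varies with `ω`, so a selection is made for each length and restricted to the
matching `ω`. All pairs over `ω` share the first point, namely the initial entry of the tuple. -/
theorem exists_separated_selection (T : BundleRDS P ϑ X) (hϑ : MeasurePreserving ϑ P P) {n : ℕ}
    {δ ρ : ℝ} {L : Ω → ℕ} (hL : Measurable L) (hsep : ∀ᵐ ω ∂P, ∃ y : Fin (L ω + 1) → X,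
      (ω, y) ∈ (Subtype.val '' T.sepTuples (L ω + 1) n δ ρ : Set (Ω × (Fin (L ω + 1) → X)))) :
    ∃ w : ℕ → Ω → T.square.Total, (∀ j, Measurable (w j)) ∧ ∀ᵐ ω ∂P,
      (∀ j, T.sqFst (w j ω) = T.sqFst (w 0 ω)) ∧ (∀ j, T.square.base (w j ω) = ω) ∧
      (∀ j, ∀ t : Fin n, T.orbitDist t (T.sqFst (w j ω)) (T.sqSndTotal (w j ω)) ≤ ρ) ∧
      ∀ i j, i < L ω + 1 → j < L ω + 1 → i ≠ j → ∃ t : Fin n,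
        δ ≤ T.orbitDist t (T.sqSndTotal (w i ω)) (T.sqSndTotal (w j ω)) := by
  have hX : Nonempty X := by
    obtain ⟨ω, x, -⟩ := T.nonempty_fiber.exists
    exact ⟨x⟩
  have hf : ∀ M : ℕ, ∃ f : Ω → Fin (M + 1) → X, Measurable f ∧ ∀ᵐ ω ∂P, L ω = M →
      (ω, f ω) ∈ (Subtype.val '' T.sepTuples (M + 1) n δ ρ : Set (Ω × (Fin (M + 1) → X))) := by
    intro M
    have hD := T.isFiberClosed_sepTuples hϑ (M + 1) n δ ρ
    have hset : MeasurableSet {ω | L ω ≠ M} := hL (measurableSet_singleton M).compl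
    -- Over the other values of `L` everything is admitted, so that almost all sections are
    -- non-empty and closed.
    let K : Set (Ω × (Fin (M + 1) → X)) := Subtype.val '' T.sepTuples (M + 1) n δ ρ ∪
      Prod.fst ⁻¹' {ω | L ω ≠ M}
    have hK : MeasurableSet K := ((T.power (M + 1)).measurableSet_carrier.subtype_image
      hD.measurableSet).union (measurable_fst hset)
    obtain ⟨f, hfm, hf⟩ := exists_measurable_selection P hK (by
      filter_upwards [hD.fiberOpen_compl] with ω hω
      have hconst : IsClosed {_y : Fin (M + 1) → X | L ω ≠ M} := isClosed_const
      exact ((T.power (M + 1)).isClosed_section_image hω).union hconst) (by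
      filter_upwards [hsep] with ω hω
      by_cases h : L ω = M
      · subst h
        obtain ⟨y, hy⟩ := hω
        exact ⟨y, Or.inl hy⟩
      · exact ⟨Classical.arbitrary _, Or.inr h⟩)
    refine ⟨f, hfm, ?_⟩
    filter_upwards [hf] with ω hω hM
    exact hω.resolve_right fun h => h hM
  choose f hfm hf using hf
  -- Indices beyond the length are sent to `0`, which exists because lengths are written as `M + 1`.
  let idx : (M : ℕ) → ℕ → Fin (M + 1) := fun M j => if h : j < M + 1 then ⟨j, h⟩ else 0
  let y : ℕ → Ω → X := fun j ω => f (L ω) ω (idx (L ω) j)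
  have hy : ∀ j, Measurable (y j) := fun j => by
    have h0 : ∀ M, Measurable fun ω => f M ω (idx M j) := fun M =>
      (measurable_pi_apply (idx M j)).comp (hfm M)
    have h1 : Measurable fun q : ℕ × Ω => f q.1 q.2 (idx q.1 j) :=
      measurable_from_prod_countable_right h0
    exact h1.comp (hL.prodMk measurable_id)
  have hae : ∀ᵐ ω ∂P, (ω, f (L ω) ω) ∈
      (Subtype.val '' T.sepTuples (L ω + 1) n δ ρ : Set (Ω × (Fin (L ω + 1) → X))) := by
    filter_upwards [ae_all_iff.2 hf] with ω hω
    exact hω (L ω) rfl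
  have hcar : ∀ j, ∀ᵐ ω ∂P, (ω, (y 0 ω, y j ω)) ∈ T.square.carrier := fun j => by
    filter_upwards [hae] with ω hω
    obtain ⟨q, -, hq⟩ := hω
    have hqc : (ω, f (L ω) ω) ∈ (T.power (L ω + 1)).carrier := hq ▸ q.2
    exact ⟨hqc _, hqc _⟩
  choose w hw hwy using fun j => T.square.exists_lift ((hy 0).prodMk (hy j)) (hcar j)
  refine ⟨w, hw, ?_⟩
  filter_upwards [hae, ae_all_iff.2 hwy] with ω hω hwω
  obtain ⟨q, hqs, hq⟩ := hω
  have hfst : ∀ j, T.sqFst (w j ω) = T.powCoord (idx (L ω) 0) q := fun j => by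
    refine Subtype.ext ?_
    change ((w j ω).1.1, (w j ω).1.2.1) = (q.1.1, q.1.2 _)
    rw [hwω, hq]
  have hsnd : ∀ j, T.sqSndTotal (w j ω) = T.powCoord (idx (L ω) j) q := fun j => by
    refine Subtype.ext ?_
    change ((w j ω).1.1, (w j ω).1.2.2) = (q.1.1, q.1.2 _)
    rw [hwω, hq]
  refine ⟨fun j => by rw [hfst, hfst], fun j => congrArg Prod.fst (hwω j), fun j t => ?_,
    fun i j hi hj hij => ?_⟩
  · rw [hfst, hsnd]
    exact (hqs _ _).1 t
  · rw [hsnd, hsnd]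
    refine (hqs _ _).2 fun h => hij ?_
    simp only [idx, dif_pos hi, dif_pos hj, Fin.mk.injEq] at h
    exact h

/-- A measure on the fibered square whose entropy along `n` steps is at least the mean logarithm
of the number of separated orbits, carried by pairs whose orbits stay close. -/
theorem exists_separated_measure (T : BundleRDS P ϑ X) (hϑ : MeasurePreserving ϑ P P) {n : ℕ}
    {δ ρ : ℝ} {L : Ω → ℕ} (hL : Measurable L) (hsep : ∀ᵐ ω ∂P, ∃ y : Fin (L ω + 1) → X,
      (ω, y) ∈ (Subtype.val '' T.sepTuples (L ω + 1) n δ ρ : Set (Ω × (Fin (L ω + 1) → X)))) :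
    ∃ σ : Measure T.square.Total, IsProbabilityMeasure σ ∧ σ.map T.square.base = P ∧
      (∀ t < n, σ (T.square.skew^[t] ⁻¹' {p | ρ < dist p.1.2.1 p.1.2.2}) = 0) ∧
      ∀ (s : ℕ) (a : X → Fin s), Measurable a → (∀ x y, a x = a y → dist x y < δ) →
        ∫⁻ ω, ENNReal.ofReal (Real.log (L ω + 1 : ℕ)) ∂P ≤ codeEntropy T.firstCoordSigma σ
          (itinerary T.square.skew (fun p => a (T.sqSnd p)) n) := by
  obtain ⟨w, hw, hae⟩ := T.exists_separated_selection hϑ hL hsep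
  obtain ⟨σ, hσ⟩ := exists_measure_lintegral_eq_average P (N := fun ω => L ω + 1)
    ((measurable_of_countable fun n : ℕ => n + 1).comp hL) hw
  have hN0 : ∀ ω, (((L ω + 1 : ℕ) : ℝ≥0∞)) ≠ 0 := fun ω => by simp
  have hbase : ∀ G : Ω → ℝ≥0∞, Measurable G → ∫⁻ p, G (T.square.base p) ∂σ = ∫⁻ ω, G ω ∂P :=
    fun G hG => by
      rw [hσ (fun p => G (T.square.base p)) (hG.comp T.square.measurable_base)]
      refine lintegral_congr_ae ?_
      filter_upwards [hae] with ω hω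
      simp only [hω.2.1, Finset.sum_const, Finset.card_range, nsmul_eq_mul]
      rw [mul_comm, ENNReal.mul_div_cancel_right (hN0 ω) (ENNReal.natCast_ne_top _)]
  have hmarg : σ.map T.square.base = P := by
    ext B hB
    rw [← lintegral_indicator_one hB, ← lintegral_indicator_one hB,
      lintegral_map (measurable_one.indicator hB) T.square.measurable_base]
    exact hbase _ (measurable_one.indicator hB)
  have hprob : IsProbabilityMeasure σ := ⟨by
    have := hbase (fun _ => 1) measurable_const
    simpa using this⟩
  have hskew := T.square.measurable_skew hϑ.measurable
  refine ⟨σ, hprob, hmarg, fun t ht => ?_, fun s a ha had => ?_⟩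
  · have hms := (hskew.iterate t) (T.measurableSet_lt_dist ρ)
    rw [← lintegral_indicator_one hms, hσ _ (measurable_one.indicator hms), ← lintegral_zero (μ := P)]
    refine lintegral_congr_ae ?_
    filter_upwards [hae] with ω hω
    rw [Finset.sum_eq_zero, ENNReal.zero_div]
    intro j _
    have h := hω.2.2.1 j ⟨t, ht⟩
    rw [orbitDist, ← sqSndTotal_iterate, ← sqFst_iterate] at h
    have hmem : w j ω ∉ T.square.skew^[t] ⁻¹' {p | ρ < dist p.1.2.1 p.1.2.2} :=
      fun hlt => not_lt.2 h hlt
    exact indicator_of_notMem hmem _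
  · refine le_iInf₂ fun h hh => ?_
    have hξ : Measurable fun p => a (T.sqSnd p) := ha.comp T.measurable_sqSnd
    rw [hσ _ (measurable_neglog_apply T.firstCoordSigma_le hh.measurable
      (measurable_itinerary hskew hξ n))]
    refine lintegral_mono_ae ?_
    filter_upwards [hae] with ω hω
    refine log_le_sum_neglog_div (Nat.succ_ne_zero _)
      (t := fun j => h (itinerary T.square.skew (fun p => a (T.sqSnd p)) n (w j ω)) (w j ω)) ?_
    have hh0 : ∀ v j, h v (w j ω) = h v (w 0 ω) := fun v j =>
      T.eq_of_measurable_firstCoordSigma (hh.measurable v) (hω.1 j)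
    simp_rw [hh0]
    -- Separated points have different itineraries, since atoms of `a` have diameter below `δ`;
    -- hence the code weights along the tuple sum to at most `1`.
    have hinj : InjOn (fun j => itinerary T.square.skew (fun p => a (T.sqSnd p)) n (w j ω))
        (Finset.range (L ω + 1)) := fun i hi j hj hij => by
      by_contra hne
      obtain ⟨t, ht⟩ := hω.2.2.2 i j (by simpa using hi) (by simpa using hj) hne
      have h2 := had _ _ (congrFun hij t)
      rw [orbitDist, ← sqSndTotal_iterate, ← sqSndTotal_iterate] at ht
      exact absurd h2 (not_lt.2 ht)
    rw [← Finset.sum_image (f := fun v => h v (w 0 ω)) hinj]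
    exact (ENNReal.sum_le_tsum _).trans (hh.tsum_le_one _)

end Selection

end BundleRDS

end

/-! ### Orbit averages: almost invariance and entropy. -/

noncomputable section

section OrbitAverage

variable {Y ι : Type*} {S mY : MeasurableSpace Y} {μ : Measure Y} {θ : Y → Y}

/-- The average of the images of a measure under the first `n` iterates. -/
def orbitAverage (μ : Measure Y) (θ : Y → Y) (n : ℕ) : Measure Y :=
  (n : ℝ≥0∞)⁻¹ • ∑ i ∈ Finset.range n, μ.map θ^[i]

theorem orbitAverage_apply (hθ : Measurable θ) (n : ℕ) {B : Set Y} (hB : MeasurableSet B) :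
    orbitAverage μ θ n B = (n : ℝ≥0∞)⁻¹ * ∑ i ∈ Finset.range n, μ (θ^[i] ⁻¹' B) := by
  simp only [orbitAverage, Measure.smul_apply, Measure.finsetSum_apply, smul_eq_mul]
  congr 1
  exact Finset.sum_congr rfl fun i _ => Measure.map_apply (hθ.iterate i) hB

theorem isProbabilityMeasure_orbitAverage [IsProbabilityMeasure μ] (hθ : Measurable θ) {n : ℕ}
    (hn : n ≠ 0) : IsProbabilityMeasure (orbitAverage μ θ n) := ⟨by
  rw [orbitAverage_apply hθ n .univ]
  simp [ENNReal.inv_mul_cancel, hn]⟩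

theorem integral_orbitAverage [IsProbabilityMeasure μ] (hθ : Measurable θ) (n : ℕ) {f : Y → ℝ}
    (hf : Measurable f) (hb : ∀ y, |f y| ≤ 1) :
    ∫ y, f y ∂orbitAverage μ θ n = (n : ℝ)⁻¹ * ∑ i ∈ Finset.range n, ∫ y, f (θ^[i] y) ∂μ := by
  rw [orbitAverage, integral_smul_measure, integral_finsetSum_measure fun i _ => ?_]
  · rw [smul_eq_mul, ENNReal.toReal_inv, ENNReal.toReal_natCast]
    congr 1
    exact Finset.sum_congr rfl fun i _ =>
      integral_map (hθ.iterate i).aemeasurable hf.aestronglyMeasurable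
  · have := Measure.isProbabilityMeasure_map (μ := μ) (hθ.iterate i).aemeasurable
    exact Integrable.of_bound hf.aestronglyMeasurable 1
      (Eventually.of_forall fun y => by simpa using hb y)

/-- Orbit averages are almost invariant. -/
theorem abs_integral_orbitAverage_comp_sub_le [IsProbabilityMeasure μ] (hθ : Measurable θ) (n : ℕ)
    {f : Y → ℝ} (hf : Measurable f) (hb : ∀ y, |f y| ≤ 1) :
    |∫ y, f (θ y) ∂orbitAverage μ θ n - ∫ y, f y ∂orbitAverage μ θ n| ≤ 2 / n := by
  rw [integral_orbitAverage hθ n hf hb,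
    integral_orbitAverage hθ n (f := fun y => f (θ y)) (hf.comp hθ) (fun y => hb _), ← mul_sub]
  have hstep : ∀ i, ∫ y, f (θ (θ^[i] y)) ∂μ = ∫ y, f (θ^[i + 1] y) ∂μ := fun i => by
    simp only [Function.iterate_succ_apply']
  simp_rw [hstep]
  rw [← Finset.sum_sub_distrib, Finset.sum_range_sub (fun i => ∫ y, f (θ^[i] y) ∂μ), abs_mul,
    abs_of_nonneg (by positivity : (0 : ℝ) ≤ (n : ℝ)⁻¹), div_eq_mul_inv, mul_comm (2 : ℝ)]
  refine mul_le_mul_of_nonneg_left ?_ (by positivity)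
  have hi : ∀ i, |∫ y, f (θ^[i] y) ∂μ| ≤ 1 := fun i => by
    have := norm_integral_le_of_norm_le_const (μ := μ) (f := fun y => f (θ^[i] y)) (C := 1)
      (Eventually.of_forall fun y => by simpa using hb _)
    simpa using this
  have h1 := hi n
  have h0 := hi 0
  exact (abs_sub _ _).trans (by linarith)

variable [MeasurableSpace ι] [MeasurableSingletonClass ι] [Fintype ι]

/-- A sliding window of `m` consecutive lengths replaces the usual decomposition by residues modulo
`m`. Moving it from `n` to `n + 1` exchanges `A n` for `A (n + m)`, which is at most `A n + B n`. -/
theorem mul_codeEntropy_itinerary_le [IsProbabilityMeasure μ] (hS : S ≤ mY) {ξ : Y → ι}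
    (hξ : Measurable ξ) (hθ : Measurable θ) (m n : ℕ) :
    m * codeEntropy S μ (itinerary θ ξ n) ≤
      ∑ r ∈ Finset.range m, codeEntropy S μ (itinerary θ ξ r) +
        ∑ i ∈ Finset.range n, codeEntropy S μ (fun y => itinerary θ ξ m (θ^[i] y)) := by
  set A : ℕ → ℝ≥0∞ := fun n => codeEntropy S μ (itinerary θ ξ n)
  set B : ℕ → ℝ≥0∞ := fun i => codeEntropy S μ (fun y => itinerary θ ξ m (θ^[i] y))
  have hA : ∀ n, A n ≠ ∞ := fun n =>
    ne_top_of_le_ne_top ENNReal.ofReal_ne_top (codeEntropy_le_log_card _)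
  have key : ∀ n, ∑ r ∈ Finset.range m, A (n + r) ≤
      ∑ r ∈ Finset.range m, A r + ∑ i ∈ Finset.range n, B i := by
    intro n
    induction n with
    | zero => simp
    | succ n ih =>
      refine ENNReal.le_of_add_le_add_right (hA n) ?_
      have h1 : ∑ r ∈ Finset.range m, A (n + 1 + r) + A n =
          ∑ r ∈ Finset.range m, A (n + r) + A (n + m) := by
        rw [← Finset.sum_range_succ (fun r => A (n + r)),
          Finset.sum_range_succ' (fun r => A (n + r)), add_zero]
        congr 1
        exact Finset.sum_congr rfl fun r _ => by rw [add_right_comm, add_assoc]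
      rw [h1, Finset.sum_range_succ]
      calc _ ≤ (∑ r ∈ Finset.range m, A r + ∑ i ∈ Finset.range n, B i) + (A n + B n) :=
            add_le_add ih (codeEntropy_itinerary_add_le hS hξ hθ n m)
        _ = _ := by ring
  refine le_trans ?_ (key n)
  calc (m : ℝ≥0∞) * A n = ∑ r ∈ Finset.range m, A n := by simp
    _ ≤ _ := Finset.sum_le_sum fun r _ => codeEntropy_itinerary_mono θ ξ (Nat.le_add_right n r)

/-- The entropy along `n` steps is controlled by the entropy of the orbit average along `m`
steps. -/
theorem mul_codeEntropy_itinerary_le_orbitAverage [IsProbabilityMeasure μ] (hS : S ≤ mY)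
    {ξ : Y → ι} (hξ : Measurable ξ) (hθ : Measurable θ) (hθS : Measurable[S, S] θ) (m : ℕ) {n : ℕ}
    (hn : n ≠ 0) :
    m * codeEntropy S μ (itinerary θ ξ n) ≤
      ∑ r ∈ Finset.range m, ENNReal.ofReal (Real.log (Fintype.card (Fin r → ι))) +
        n * codeEntropy S (orbitAverage μ θ n) (itinerary θ ξ m) := by
  refine (mul_codeEntropy_itinerary_le hS hξ hθ m n).trans
    (add_le_add (Finset.sum_le_sum fun r _ => codeEntropy_le_log_card _) ?_)
  have hn0 : (n : ℝ≥0∞) ≠ 0 := by simpa using hn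
  have h1 : ∑ i ∈ Finset.range n, codeEntropy S μ (fun y => itinerary θ ξ m (θ^[i] y)) ≤
      codeEntropy S (∑ i ∈ Finset.range n, μ.map θ^[i]) (itinerary θ ξ m) :=
    (Finset.sum_le_sum fun i _ => codeEntropy_comp_map_le hS (measurable_itinerary hθ hξ m)
      (hθ.iterate i) (hθS.iterate_same i)).trans (sum_codeEntropy_le _ _ _)
  refine h1.trans ?_
  calc _ = (n : ℝ≥0∞) * ((n : ℝ≥0∞)⁻¹ *
        codeEntropy S (∑ i ∈ Finset.range n, μ.map θ^[i]) (itinerary θ ξ m)) := by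
        rw [← mul_assoc, ENNReal.mul_inv_cancel hn0 (ENNReal.natCast_ne_top n), one_mul]
    _ ≤ _ := by
        gcongr
        exact mul_codeEntropy_le _ _

end OrbitAverage

namespace BundleRDS

section

variable {Ω : Type*} [MeasurableSpace Ω] {P : Measure Ω} {ϑ : Ω → Ω}
  {X : Type*} [MetricSpace X] [MeasurableSpace X]

theorem map_base_orbitAverage (T : BundleRDS P ϑ X) (hϑ : MeasurePreserving ϑ P P)
    {σ : Measure T.Total} (hσ : σ.map T.base = P) {n : ℕ} (hn : n ≠ 0) :
    (orbitAverage σ T.skew n).map T.base = P := by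
  have hn0 : (n : ℝ≥0∞) ≠ 0 := by simpa using hn
  ext B hB
  rw [Measure.map_apply T.measurable_base hB,
    orbitAverage_apply (T.measurable_skew hϑ.measurable) n (T.measurable_base hB)]
  have h : ∀ i, σ (T.skew^[i] ⁻¹' (T.base ⁻¹' B)) = P B := fun i => by
    have e : T.skew^[i] ⁻¹' (T.base ⁻¹' B) = T.base ⁻¹' (ϑ^[i] ⁻¹' B) := by
      ext p
      simp only [mem_preimage, base_iterate_skew]
    have hBi := (hϑ.iterate i).measurable hB
    have h1 : σ (T.base ⁻¹' (ϑ^[i] ⁻¹' B)) = σ.map T.base (ϑ^[i] ⁻¹' B) :=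
      (Measure.map_apply T.measurable_base hBi).symm
    rw [e, h1, congrArg (fun ν : Measure Ω => ν (ϑ^[i] ⁻¹' B)) hσ,
      (hϑ.iterate i).measure_preimage hB.nullMeasurableSet]
  simp only [h, Finset.sum_const, Finset.card_range, nsmul_eq_mul]
  rw [← mul_assoc, ENNReal.inv_mul_cancel hn0 (ENNReal.natCast_ne_top n), one_mul]

theorem fiberOpen_lt_dist (T : BundleRDS P ϑ X) (ρ : ℝ) :
    T.square.FiberOpen {p : T.square.Total | ρ < dist p.1.2.1 p.1.2.2} :=
  Eventually.of_forall fun _ => by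
    have h : IsOpen {z : X × X | ρ < dist z.1 z.2} := isOpen_lt continuous_const continuous_dist
    exact h.preimage continuous_subtype_val

variable [CompactSpace X] [BorelSpace X] [IsProbabilityMeasure P] [P.IsComplete]

/-- Random open sets that are null along a net are null for its limits. -/
theorem NarrowTendsto.measure_eq_zero {T : BundleRDS P ϑ X} {J : Type*} {ν : J → Measure T.Total}
    {l : Filter J} [l.NeBot] {m : Measure T.Total} [∀ j, IsProbabilityMeasure (ν j)]
    [IsProbabilityMeasure m] (h : T.NarrowTendsto ν l m) (hm : m.map T.base = P)
    {G : Set T.Total} (hG : MeasurableSet G) (hGo : T.FiberOpen G) (h0 : ∀ᶠ j in l, ν j G = 0) :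
    m G = 0 := by
  by_contra hne
  have hpos : 0 < m.real G := ENNReal.toReal_pos hne (measure_ne_top _ _)
  obtain ⟨j, hj, hj0⟩ := ((h.eventually_lt_measure hm hG hGo hpos).and h0).exists
  simp [measureReal_def, hj0] at hj

end

end BundleRDS

end

/-! ### Invariant measures of large entropy near the diagonal. -/

noncomputable section

namespace BundleRDS

section LowerBound

variable {Ω : Type*} [MeasurableSpace Ω] {P : Measure Ω} {ϑ : Ω → Ω}
  {X : Type*} [MetricSpace X] [MeasurableSpace X] [CompactSpace X] [BorelSpace X]
  [IsProbabilityMeasure P] [P.IsComplete]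

theorem exists_separated_measure_ballCover (T : BundleRDS P ϑ X) (hϑ : MeasurePreserving ϑ P P)
    (k k' : ℕ) {δ : ℝ} (hδ : 0 < δ)
    (hR : ∀ x : X, ∃ j, ∀ p : T.Total, dist p.1.2 x < δ → p ∈ (T.ballCover k').set j) (n : ℕ) :
    ∃ σ : Measure T.square.Total, IsProbabilityMeasure σ ∧ σ.map T.square.base = P ∧
      (∀ t < n, σ (T.square.skew^[t] ⁻¹' {p | 2 / ((k : ℝ) + 1) < dist p.1.2.1 p.1.2.2}) = 0) ∧
      ∀ (s : ℕ) (a : X → Fin s), Measurable a → (∀ x y, a x = a y → dist x y < δ) →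
        ∫⁻ ω, T.logCover (T.refine (T.ballCover k').set n) (T.refine (T.ballCover k).set n) ω ∂P ≤
          codeEntropy T.firstCoordSigma σ
            (itinerary T.square.skew (fun p => a (T.sqSnd p)) n) := by
  have hne := (T.ballCover k).nonempty_fin
  set N : Ω → ℕ := T.condCoverNum (T.refine (T.ballCover k').set n)
    (T.refine (T.ballCover k).set n) with hN
  have hNm : Measurable N := T.measurable_condCoverNum
    (T.measurableSet_refine hϑ.measurable (T.ballCover k').measurableSet n)
    (T.iUnion_refine (T.ballCover k').iUnion_eq n)
    (T.measurableSet_refine hϑ.measurable (T.ballCover k).measurableSet n)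
  -- The covering number is at least `1`, so it can be written in the form `L ω + 1`.
  let L : Ω → ℕ := fun ω => N ω - 1
  have hL : Measurable L := (measurable_of_countable fun n : ℕ => n - 1).comp hNm
  have hLN : ∀ ω, L ω + 1 = N ω := fun ω => Nat.sub_add_cancel
    (T.one_le_condCoverNum (T.iUnion_refine (T.ballCover k').iUnion_eq n) _ ω)
  have hQ : ∀ j, ∀ p ∈ (T.ballCover k).set j, ∀ q ∈ (T.ballCover k).set j,
      dist p.1.2 q.1.2 ≤ 2 / ((k : ℝ) + 1) := fun j p hp q hq => by
    obtain ⟨c, hc⟩ := T.exists_mem_ball_of_mem_ballCover k j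
    have h1 := hc p hp
    have h2 := hc q hq
    rw [Metric.mem_ball] at h1 h2
    have h3 := dist_triangle_right p.1.2 q.1.2 c
    have h4 : (2 : ℝ) / ((k : ℝ) + 1) = 1 / ((k : ℝ) + 1) + 1 / ((k : ℝ) + 1) := by ring
    linarith
  obtain ⟨σ, hσp, hσ, hσ0, hσe⟩ := T.exists_separated_measure hϑ (n := n) (δ := δ)
    (ρ := 2 / ((k : ℝ) + 1)) hL (by
      filter_upwards [T.nonempty_fiber] with ω hω
      have h := T.exists_mem_sepTuples hδ (by positivity) hR hQ n hω
      rw [← hN] at h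
      rwa [hLN])
  refine ⟨σ, hσp, hσ, hσ0, fun s a ha had => le_trans (le_of_eq ?_) (hσe s a ha had)⟩
  refine lintegral_congr fun ω => ?_
  rw [hLN]
  rfl

/-- Limits of orbit averages of measures with large entropy have large entropy. -/
theorem exists_invMeasure_le_relEntropy (T : BundleRDS P ϑ X) (hϑ : MeasurePreserving ϑ P P)
    (k k' : ℕ) {c : ℝ≥0∞} (hc : ∃ᶠ n : ℕ in atTop, c ≤
      (∫⁻ ω, T.logCover (T.refine (T.ballCover k').set n) (T.refine (T.ballCover k).set n) ω ∂P)
        / (n : ℝ≥0∞)) :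
    ∃ μ : T.square.InvMeasure, μ.1 {p | 2 / ((k : ℝ) + 1) < dist p.1.2.1 p.1.2.2} = 0 ∧
      c ≤ T.square.relEntropy T.firstCoordSigma μ := by
  obtain ⟨δ, hδ, hR⟩ := T.exists_ballCover_lebesgue k'
  choose σ hσp hσ hσ0 hσe using T.exists_separated_measure_ballCover hϑ k k' hδ hR
  set I : ℕ → ℝ≥0∞ := fun n =>
    ∫⁻ ω, T.logCover (T.refine (T.ballCover k').set n) (T.refine (T.ballCover k).set n) ω ∂P
  have hskew := T.square.measurable_skew hϑ.measurable
  have hΘS := T.measurable_skew_firstCoordSigma hϑ.measurable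
  -- The shift by one avoids the empty orbit average.
  let ν : ℕ → Measure T.square.Total := fun n => orbitAverage (σ (n + 1)) T.square.skew (n + 1)
  have hνp : ∀ n, IsProbabilityMeasure (ν n) := fun n =>
    isProbabilityMeasure_orbitAverage hskew n.succ_ne_zero
  rw [← map_add_atTop_eq_nat 1, frequently_map] at hc
  have hl : (atTop ⊓ 𝓟 {n : ℕ | c ≤ I (n + 1) / (n + 1 : ℕ)}).NeBot :=
    frequently_mem_iff_neBot.1 hc
  -- The ultrafilter tends to infinity and is concentrated on the times with mean covering entropy
  -- at least `c`.
  obtain ⟨U, hU⟩ := Ultrafilter.exists_le (atTop ⊓ 𝓟 {n : ℕ | c ≤ I (n + 1) / (n + 1 : ℕ)})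
  obtain ⟨hUtop, hUc⟩ := le_inf_iff.1 hU
  obtain ⟨m, hmp, hm, hνm⟩ := T.square.exists_narrowTendsto U ν
    fun n => T.square.map_base_orbitAverage hϑ (hσ _) n.succ_ne_zero
  have hlim : Tendsto (fun n : ℕ => n + 1) U atTop := (tendsto_add_atTop_nat 1).mono_left hUtop
  have hΘ : MeasurePreserving T.square.skew m m := by
    refine hνm.measurePreserving hϑ hm fun f hf hb => ?_
    refine squeeze_zero_norm
      (fun n => abs_integral_orbitAverage_comp_sub_le hskew (n + 1) hf hb) ?_
    exact (tendsto_const_div_atTop_nhds_zero_nat (2 : ℝ)).comp hlim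
  refine ⟨⟨m, hmp, hm, hΘ⟩, ?_, ?_⟩
  · refine hνm.measure_eq_zero hm (T.measurableSet_lt_dist _) (T.fiberOpen_lt_dist _)
      (Eventually.of_forall fun n => ?_)
    rw [orbitAverage_apply hskew _ (T.measurableSet_lt_dist _),
      Finset.sum_eq_zero fun t ht => hσ0 _ t (Finset.mem_range.1 ht), mul_zero]
  obtain ⟨s, a, ha, ha0, had⟩ := exists_partition_null_frontier (m.map fun p => p.1.2.2) hδ
  have hasnd : Measurable fun p => a (T.sqSnd p) := ha.comp T.measurable_sqSnd
  refine le_trans ?_ (T.square.entropyRate_le_relEntropy hϑ.measurable hasnd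
    T.firstCoordSigma_le ⟨m, hmp, hm, hΘ⟩)
  -- If the `r`-step entropy of `m` were below `r * c`, semicontinuity would put that of the orbit
  -- averages below some `d < r * c`. The comparison with the `n`-step entropy then gives `r * c ≤ K
  -- / n + d` for times `n` tending to infinity, a contradiction.
  have key : ∀ r : ℕ, r * c ≤ codeEntropy T.firstCoordSigma m
      (itinerary T.square.skew (fun p => a (T.sqSnd p)) r) := by
    intro r
    by_contra! hlt
    obtain ⟨d, hd1, hd2⟩ := exists_between hlt
    have hev := hνm.eventually_codeEntropy_itinerary_lt hϑ hm hΘ ha ha0 r hd1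
    set K : ℝ≥0∞ := ∑ i ∈ Finset.range r,
      ENNReal.ofReal (Real.log (Fintype.card (Fin i → Fin s))) with hKdef
    have hK : K ≠ ∞ := (ENNReal.sum_lt_top.2 fun _ _ => ENNReal.ofReal_lt_top).ne
    have hb : ∀ᶠ n : ℕ in U, r * c ≤ K / (n + 1 : ℕ) + d := by
      filter_upwards [hev, le_principal_iff.1 hUc] with n hn hcn
      have hn0 : ((n + 1 : ℕ) : ℝ≥0∞) ≠ 0 := by simp
      have hnt : ((n + 1 : ℕ) : ℝ≥0∞) ≠ ∞ := ENNReal.natCast_ne_top _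
      have h1 := mul_codeEntropy_itinerary_le_orbitAverage (μ := σ (n + 1)) T.firstCoordSigma_le
        hasnd hskew hΘS r n.succ_ne_zero
      calc r * c ≤ r * (I (n + 1) / (n + 1 : ℕ)) := by gcongr
        _ = r * I (n + 1) / (n + 1 : ℕ) := by rw [mul_div_assoc]
        _ ≤ (K + (n + 1 : ℕ) * d) / (n + 1 : ℕ) := by
          gcongr
          refine le_trans ?_ (h1.trans (add_le_add le_rfl ?_))
          · gcongr
            exact hσe _ s a ha had
          · gcongr
        _ = _ := by
          rw [ENNReal.add_div, mul_comm, ENNReal.mul_div_cancel_right hn0 hnt]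
    have ht : Tendsto (fun n : ℕ => K / (n + 1 : ℕ) + d) U (𝓝 (0 + d)) := by
      refine Tendsto.add ?_ tendsto_const_nhds
      have h0 := ENNReal.Tendsto.const_div (a := K) ENNReal.tendsto_nat_nhds_top (Or.inr hK)
      rw [ENNReal.div_top] at h0
      exact h0.comp hlim
    rw [zero_add] at ht
    exact absurd (ge_of_tendsto ht hb) (not_le.2 hd2)
  refine le_limsup_of_frequently_le (Eventually.frequently ?_) (by isBoundedDefault)
  filter_upwards [eventually_gt_atTop 0] with r hr
  have hr0 : (r : ℝ≥0∞) ≠ 0 := by simpa using hr.ne'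
  rw [ENNReal.le_div_iff_mul_le (Or.inl hr0) (Or.inl (ENNReal.natCast_ne_top r)), mul_comm]
  exact key r

end LowerBound

end BundleRDS

end

/-! ### The limit measure on the diagonal and attainment of the maximum. -/

noncomputable section

namespace BundleRDS

section Diagonal

variable {Ω : Type*} [MeasurableSpace Ω] {P : Measure Ω} {ϑ : Ω → Ω}
  {X : Type*} [MetricSpace X] [MeasurableSpace X]

/-- On the diagonal the second point is determined by the first one. -/
theorem relEntropy_eq_zero_of_diagonal (T : BundleRDS P ϑ X) (hϑ : Measurable ϑ)
    (m : T.square.InvMeasure) (h0 : m.1 T.diagonalᶜ = 0) :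
    T.square.relEntropy T.firstCoordSigma m = 0 := by
  classical
  refine le_antisymm (T.relEntropy_square_le hϑ m fun r γ hγ => ?_) zero_le
  have hγ' : Measurable fun q : T.Total => γ q.1.2 :=
    hγ.comp (measurable_snd.comp measurable_subtype_coe)
  have hH : ∀ n, codeEntropy T.firstCoordSigma m.1
      (itinerary T.square.skew (fun p => γ (T.sqSnd p)) n) = 0 := by
    intro n
    -- The itinerary of the first point predicts that of the second with certainty, so this code has
    -- length `0` almost everywhere.
    let g : (Fin n → Fin r) → T.square.Total → ℝ≥0∞ := fun v p =>
      if itinerary T.skew (fun q => γ q.1.2) n (T.sqFst p) = v then 1 else 0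
    have hg : IsSubProb T.firstCoordSigma g := by
      refine ⟨fun v => ?_, fun p => ?_⟩
      · have h1 := measurable_itinerary (T.measurable_skew hϑ) hγ' n
        have h2 : Measurable fun u : Fin n → Fin r => if u = v then (1 : ℝ≥0∞) else 0 :=
          measurable_of_countable _
        exact T.measurable_firstCoordSigma_comp (h2.comp h1)
      · simp [g]
    refine le_antisymm ((codeEntropy_le hg).trans (le_of_eq ?_)) zero_le
    rw [← lintegral_zero (μ := m.1)]
    refine lintegral_congr_ae ?_
    have hae : ∀ᵐ p ∂m.1, p ∈ T.diagonal := h0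
    filter_upwards [hae] with p hp
    have hpp : T.sqFst p = T.sqSndTotal p :=
      Subtype.ext (Prod.ext rfl (show p.1.2.1 = p.1.2.2 from hp))
    have hit : itinerary T.skew (fun q => γ q.1.2) n (T.sqFst p) =
        itinerary T.square.skew (fun p => γ (T.sqSnd p)) n p := by
      funext i
      simp only [itinerary, hpp, ← sqSndTotal_iterate]
      rfl
    simp [g, hit]
  rw [entropyRate]
  simp [hH]

variable [CompactSpace X] [BorelSpace X] [IsProbabilityMeasure P] [P.IsComplete]

/-- The alternative `c = 0` covers vanishing tail entropy, where no smaller `c` exists but measures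
near the diagonal are still needed. -/
theorem exists_invMeasure_of_lt_tailEntropy (T : BundleRDS P ϑ X) (hϑ : MeasurePreserving ϑ P P)
    (k : ℕ) {c : ℝ≥0∞} (hc : c < T.tailEntropy ∨ c = 0) :
    ∃ μ : T.square.InvMeasure, μ.1 {p | 2 / ((k : ℝ) + 1) < dist p.1.2.1 p.1.2.2} = 0 ∧
      c ≤ T.square.relEntropy T.firstCoordSigma μ := by
  rcases hc with hc | rfl
  · have h1 : c < T.tailEntropyGiven (T.ballCover k) :=
      hc.trans_le (iInf₂_le _ (T.isOpenCover_ballCover k))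
    simp only [tailEntropyGiven, lt_iSup_iff] at h1
    obtain ⟨R, hR, hcR⟩ := h1
    obtain ⟨ε, hε, hcε⟩ := ENNReal.lt_iff_exists_add_pos_lt.1 hcR
    obtain ⟨k', hk'⟩ := (T.coverTailEntropy_le_ballCover hϑ hR (T.ballCover k)
      (ε := ε) (by simpa using hε.ne')).exists
    have h2 : c < T.coverTailEntropy (T.ballCover k') (T.ballCover k) :=
      (ENNReal.add_lt_add_iff_right ENNReal.coe_ne_top).1 (hcε.trans_le hk')
    rw [coverTailEntropy_eq] at h2
    exact T.exists_invMeasure_le_relEntropy hϑ k k'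
      ((frequently_lt_of_lt_limsup (by isBoundedDefault) h2).mono fun _ h => h.le)
  · exact T.exists_invMeasure_le_relEntropy hϑ k 0
      (Eventually.frequently (Eventually.of_forall fun _ => zero_le))

/-- Some invariant measure on the diagonal is approximated by invariant measures of relative entropy
close to the tail entropy. -/
theorem exists_diagonal_tailEntropy_le_limsup (T : BundleRDS P ϑ X)
    (hϑ : MeasurePreserving ϑ P P) :
    ∃ m : T.square.InvMeasure, m.1 T.diagonalᶜ = 0 ∧
      T.tailEntropy ≤ limsup (T.square.relEntropy T.firstCoordSigma) (𝓝 m) := by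
  obtain ⟨c, hc, hct⟩ : ∃ c : ℕ → ℝ≥0∞, (∀ k, c k < T.tailEntropy ∨ c k = 0) ∧
      Tendsto c atTop (𝓝 T.tailEntropy) := by
    rcases eq_or_ne T.tailEntropy 0 with h | h
    · exact ⟨fun _ => 0, fun _ => Or.inr rfl, h ▸ tendsto_const_nhds⟩
    · obtain ⟨c, -, hc, hct⟩ := exists_seq_strictMono_tendsto' (pos_iff_ne_zero.2 h)
      exact ⟨c, fun k => Or.inl (hc k).2, hct⟩
  choose μ hμ0 hμc using fun k => T.exists_invMeasure_of_lt_tailEntropy hϑ k (hc k)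
  have hμp : ∀ k, IsProbabilityMeasure (μ k).1 := fun k => (μ k).2.1
  -- Compactness is available along ultrafilters; a limit along one finer than `atTop` suffices for
  -- a lower bound on the upper limit at `m`.
  have hU : (hyperfilter ℕ : Filter ℕ) ≤ atTop := Nat.hyperfilter_le_atTop
  obtain ⟨m, hmp, hm, hμm⟩ := T.square.exists_narrowTendsto (hyperfilter ℕ) (fun k => (μ k).1)
    fun k => (μ k).2.2.1
  have hΘ : MeasurePreserving T.square.skew m m := by
    refine hμm.measurePreserving hϑ hm fun f hf _ => ?_
    have h : ∀ k, ∫ p, f (T.square.skew p) ∂(μ k).1 - ∫ p, f p ∂(μ k).1 = 0 := fun k => by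
      have hk := (μ k).2.2.2
      have h1 := integral_map (μ := (μ k).1) hk.measurable.aemeasurable
        (f := f) hf.aestronglyMeasurable
      rw [hk.map_eq] at h1
      rw [← h1, sub_self]
    simp only [h]
    exact tendsto_const_nhds
  let m' : T.square.InvMeasure := ⟨m, hmp, hm, hΘ⟩
  refine ⟨m', ?_, ?_⟩
  · have hsub : T.diagonalᶜ ⊆
        ⋃ n : ℕ, {p : T.square.Total | 1 / ((n : ℝ) + 1) < dist p.1.2.1 p.1.2.2} := fun p hp => by
      obtain ⟨n, hn⟩ := exists_nat_one_div_lt (dist_pos.2 (show p.1.2.1 ≠ p.1.2.2 from hp))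
      exact mem_iUnion.2 ⟨n, hn⟩
    refine measure_mono_null hsub (measure_iUnion_null fun n => ?_)
    refine hμm.measure_eq_zero hm (T.measurableSet_lt_dist _) (T.fiberOpen_lt_dist _) ?_
    filter_upwards [hU (eventually_ge_atTop (2 * n + 1))] with k hk
    have hk' : (2 * n + 1 : ℝ) ≤ k := by exact_mod_cast hk
    have hle : 2 / ((k : ℝ) + 1) ≤ 1 / ((n : ℝ) + 1) := by
      rw [div_le_div_iff₀ (by positivity) (by positivity)]
      linarith
    exact measure_mono_null (fun p hp => hle.trans_lt hp) (hμ0 k)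
  · have hconv : Tendsto μ (hyperfilter ℕ) (𝓝 m') :=
      (T.square.tendsto_nhds_iff μ _ m').2 hμm
    calc T.tailEntropy = limsup c (hyperfilter ℕ : Filter ℕ) := (hct.mono_left hU).limsup_eq.symm
      _ ≤ limsup (fun k => T.square.relEntropy T.firstCoordSigma (μ k)) (hyperfilter ℕ) :=
        limsup_le_limsup (Eventually.of_forall hμc)
      _ = limsup (T.square.relEntropy T.firstCoordSigma) (Filter.map μ (hyperfilter ℕ)) := rfl
      _ ≤ _ := limsup_le_limsup_of_le hconv

/-- The relative entropy vanishes on the diagonal, so nothing is subtracted from the upper limit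
there. -/
theorem exists_diagonal_defect_eq (T : BundleRDS P ϑ X) (hϑ : MeasurePreserving ϑ P P) :
    ∃ m : T.square.InvMeasure, m.1 T.diagonalᶜ = 0 ∧
      T.square.defect T.firstCoordSigma m = T.tailEntropy := by
  obtain ⟨m, hm, hlim⟩ := T.exists_diagonal_tailEntropy_le_limsup hϑ
  refine ⟨m, hm, le_antisymm (T.defect_le_tailEntropy hϑ m) ?_⟩
  have h0 := T.relEntropy_eq_zero_of_diagonal hϑ.measurable m hm
  rw [defect, if_pos (by rw [h0]; exact ENNReal.zero_lt_top), h0, tsub_zero]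
  exact hlim

end Diagonal

end BundleRDS

end

theorem theorem2p2 {Ω : Type*} [MeasurableSpace Ω] (P : Measure Ω) [IsProbabilityMeasure P]
    [P.IsComplete] (hP : CountablyGeneratedModNull P) (ϑ : Ω → Ω)
    (hϑ : MeasurePreserving ϑ P P)
    {X : Type*} [MetricSpace X] [CompactSpace X] [MeasurableSpace X] [BorelSpace X]
    (T : BundleRDS P ϑ X) :
    IsGreatest {d | ∃ μ : T.square.InvMeasure, d = T.square.defect T.firstCoordSigma μ}
        T.tailEntropy ∧
      ∃ m : T.square.InvMeasure, m.1 (T.diagonalᶜ) = 0 ∧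
        T.square.defect T.firstCoordSigma m = T.tailEntropy := by
  obtain ⟨m, hm, hd⟩ := T.exists_diagonal_defect_eq hϑ
  refine ⟨⟨⟨m, hd.symm⟩, ?_⟩, m, hm, hd⟩
  rintro _ ⟨μ, rfl⟩
  exact T.defect_le_tailEntropy hϑ μ
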